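/- Let $g\ge 0$ and work over $\mathbb C$. **The $\mathrm{KdV}_{2g+1}$ systems.** To a formal series $h=z+\sum_{l\ge1}h_lz^{-l}$ associate $H^{(0)}=1$, $H^{(1)}=h$, $H^{(k+2)}=z^2H^{(k)}-H^k_1h-H^k_2$, where $H^k_l$ is the coefficient of $z^{-l}$ in $H^{(k)}$ (this parametrizes the zeroes with $H^{(2)}=z^2$ of the second vector field of the Central System $$\tfrac{\partial H^{(k)}}{\partial t_j}=-H^{(j)}H^{(k)}+H^{(j+k)}+\sum_{l=1}^kH^j_lH^{(k-l)}+\sum_{l=1}^jH^k_lH^{(j-l)}\ ).$$ The $\mathrm{CS}_2$ vector fields are $\partial h/\partial t_j=-hH^{(j)}+H^{(j+1)}+\sum_{l=1}^jh_lH^{(j-l)}+H^j_1$. The phase space $\mathcal M_{2g+1}$ is the set of zeroes of $\partial/\partial t_{2g+1}$, and the $\mathrm{KdV}_{2g+1}$ flows (the stationary reductions of KdV) are the vector fields $\partial/\partial t_j$ on $\mathcal M_{2g+1}$. With $\lambda=z^2$, let $V^{(j)}(\lambda)$ be the $2\times2$ polynomial matrix with $(\partial/\partial t_j+H^{(j)})(1,h)^T=V^{(j)}(1,h)^T$.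 **The reduced bi-Hamiltonian manifold.** Let $A=\begin{pmatrix}0&0\\1&0\end{pmatrix}$ and let $\mathcal M_A$ be the space of $X(\lambda)=\lambda^{g+1}A+\sum_{i=0}^g\lambda^iX_i$, $X_i\in\mathfrak{sl}(2,\mathbb C)$, with tangent and cotangent spaces identified with $\mathfrak{sl}(2)^{g+1}$ through $\sum_i\mathrm{Tr}(V_iW_i)$. Put $X_{g+1}=A$, $X_k=0$ for $k>g+1$, and consider the Poisson tensors $$(P_0W)_i=\sum_{j=0}^g[X_{i+j+1},W_j],\qquad (P_1W)_0=-[X_0,W_0],\quad (P_1W)_i=\sum_{j=1}^g[X_{i+j},W_j]\ (i\ge1),$$ with brackets $\{F,G\}=\langle dF,P\,dG\rangle$. Let $\frac12\mathrm{Tr}X(\lambda)^2=\sum_iH_i\lambda^i$, let $\widetilde{\mathcal S}=\{H_{2g+1}=1,\ H_i=0\text{ for }g+1\le i\le 2g\}$, $E=P_1(\mathrm{Ker}\,P_0)\cap T\widetilde{\mathcal S}$, and let $\widetilde{\mathcal N}=\widetilde{\mathcal S}/E$ be the space of integral leaves of $E$ in $\widetilde{\mathcal S}$. Holomorphic functions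 on $\widetilde{\mathcal N}$ are the functions whose pull-back to $\widetilde{\mathcal S}$ extends holomorphically to $\mathcal M_A$; vector fields on $\widetilde{\mathcal N}$ are derivations of these. The reduced bracket of two functions on $\widetilde{\mathcal N}$ is the restriction to $\widetilde{\mathcal S}$ of the bracket of any two extensions. **Statement.** The map $h\mapsto V^{(2g+1)}$ sends $\mathcal M_{2g+1}$ into $\widetilde{\mathcal S}$, and composed with the projection it gives a bijection $\Phi:\mathcal M_{2g+1}\to\widetilde{\mathcal N}$; moreover $(h_1,\dots,h_{2g+1})$ are global coordinates on $\mathcal M_{2g+1}$ (bijective onto $\mathbb C^{2g+1}$), and a function $f$ on $\widetilde{\mathcal N}$ is holomorphic if and only if $f\circ\Phi$ is an entire function of them. For $i=0,\dots,g-1$, the vector field $$\frac{\partial X(\lambda)}{\partial t_i}=\big[(\lambda^{i-g}X(\lambda))_+,X(\lambda)\big]$$ on $\mathcal M_A$ is tangent to $\widetilde{\mathcal S}$ and projects on a vector field $Y_i$ of $\widetilde{\mathcal N}$, and under $\Phi$ this $Y_i$ coincides with the $\mathrm{KdV}_{2g+1}$ flow $\partial/\partial t_{2i+1}$. Furthermore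 these flows are bi-Hamiltonian Gel'fand--Zakharevich systems: $P_0$ and $P_1$ reduce to brackets $\{\cdot,\cdot\}_0,\{\cdot,\cdot\}_1$ on $\widetilde{\mathcal N}$ all of whose linear combinations are Poisson brackets; at each point the pencil $\{\cdot,\cdot\}_1-\lambda\{\cdot,\cdot\}_0$ has the maximal rank $2g$ for all but finitely many $\lambda\in\mathbb C$; the functions $H_0,\dots,H_g$ descend to $\widetilde{\mathcal N}$; $H_0+H_1\lambda+\dots+H_g\lambda^g$ is a Casimir of the pencil, i.e. $\{f,\sum_{i=0}^gH_i\lambda^i\}_1-\lambda\{f,\sum_{i=0}^gH_i\lambda^i\}_0=0$ for all $\lambda$ and $f$; and $Y_i f=\{f,H_{g-1-i}\}_0=\{f,H_{g-i}\}_1$ for $i=0,\dots,g-1$. -/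

import Mathlib

open Polynomial

namespace StationaryKdV

noncomputable section

/-! ### The Central System, its restriction CS₂, and the KdV_{2g+1} systems -/

/-- Formal Laurent series in `z⁻¹`: the coefficient with index `n : ℤ` is that of `z ^ (-n)`. -/
abbrev Lau : Type := HahnSeries ℤ ℂ

/-- The constant series. -/
abbrev con : ℂ →+* Lau := HahnSeries.C

/-- The series `z`. -/
def z : Lau := HahnSeries.single (-1 : ℤ) (1 : ℂ)

/-- The phase space of the Central System: sequences with `H⁽⁰⁾ = 1` and
`H⁽ᵏ⁾ = z ^ k + ∑_{l ≥ 1} Hᵏ_l z ^ (-l)` for `k ≥ 1`. -/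
def csSpace : Set (ℕ → Lau) :=
  {H | H 0 = 1 ∧ ∀ k, 1 ≤ k → ∀ n : ℤ, n ≤ 0 → (H k - z ^ k).coeff n = 0}

/-- The component `∂H⁽ᵏ⁾/∂t_j` of the `j`-th vector field of the Central System. -/
def csField (H : ℕ → Lau) (j k : ℕ) : Lau :=
  -(H j * H k) + H (j + k) + ∑ l ∈ Finset.Icc 1 k, con ((H j).coeff l) * H (k - l)
    + ∑ l ∈ Finset.Icc 1 j, con ((H k).coeff l) * H (j - l)

/-- The invariant submanifold of zeroes of the second vector field on which `H⁽²⁾ = z ^ 2`. -/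
def cs2Set : Set (ℕ → Lau) :=
  {H | H ∈ csSpace ∧ (∀ k, 1 ≤ k → csField H 2 k = 0) ∧ H 2 = z ^ 2}

/-- The series `h = z + ∑_{l ≥ 1} h_l z ^ (-l)`; these parametrize `cs2Set`
(see `mem_cs2Set_iff`). -/
def cs2Space : Set Lau := {h | ∀ n : ℤ, n ≤ 0 → (h - z).coeff n = 0}

/-- The point of `cs2Set` with `H⁽¹⁾ = h`. -/
def cur (h : Lau) : ℕ → Lau
  | 0 => 1
  | 1 => h
  | k + 2 => z ^ 2 * cur h k - con ((cur h k).coeff 1) * h - con ((cur h k).coeff 2)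

/-- The vector field `∂h/∂t_j` of CS₂: the restriction of the Central System to `cs2Set`, in the
coordinate `h`. -/
def cs2Field (h : Lau) (j : ℕ) : Lau := csField (cur h) j 1

/-- The phase space of KdV_{2g+1}: the zeroes of the `(2g+1)`-st vector field of CS₂. The
KdV_{2g+1} systems are the vector fields `cs2Field` on it. -/
def kdvSpace (g : ℕ) : Set Lau := {h | h ∈ cs2Space ∧ cs2Field h (2 * g + 1) = 0}

/-- The first `N` coefficients `(h_1, …, h_N)`. -/
def coords (N : ℕ) (h : Lau) : Fin N → ℂ := fun l => h.coeff ((l : ℤ) + 1)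

/-! ### The Lax matrices -/

/-- The value of a polynomial in `λ` at `λ = z ^ 2`. -/
abbrev atZ2 : ℂ[X] →+* Lau := eval₂RingHom con (z ^ 2)

/-- The polynomials `p_k` in `λ = z ^ 2` with `H⁽ᵏ⁾ = p_k + q_k h`. -/
def pPoly (h : Lau) : ℕ → ℂ[X]
  | 0 => 1
  | 1 => 0
  | k + 2 => X * pPoly h k - C ((cur h k).coeff 2)

/-- The polynomials `q_k` in `λ = z ^ 2` with `H⁽ᵏ⁾ = p_k + q_k h`. -/
def qPoly (h : Lau) : ℕ → ℂ[X]
  | 0 => 0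
  | 1 => 1
  | k + 2 => X * qPoly h k - C ((cur h k).coeff 1)

/-- The matrix `V⁽ʲ⁾`, polynomial in `λ = z ^ 2`, with `(∂/∂t_j + H⁽ʲ⁾) (1, h)ᵀ = V⁽ʲ⁾ (1, h)ᵀ`
(see `lax_spec`). -/
def lax (h : Lau) (j : ℕ) : Matrix (Fin 2) (Fin 2) ℂ[X] :=
  !![pPoly h j, qPoly h j;
     pPoly h (j + 1) + ∑ l ∈ Finset.Icc 1 j, C (h.coeff (l : ℤ)) * pPoly h (j - l)
       + C ((cur h j).coeff 1),
     qPoly h (j + 1) + ∑ l ∈ Finset.Icc 1 j, C (h.coeff (l : ℤ)) * qPoly h (j - l)]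

theorem cur_eq (h : Lau) (k : ℕ) :
    cur h k = atZ2 (pPoly h k) + atZ2 (qPoly h k) * h := by
  induction k using Nat.strong_induction_on with
  | _ k ih =>
    match k, ih with
    | 0, _ => simp [cur, pPoly, qPoly]
    | 1, _ => simp [cur, pPoly, qPoly]
    | k + 2, ih =>
      have e := ih k (by omega)
      have hX : atZ2 X = z ^ 2 := by simp
      have hC : ∀ c, atZ2 (C c) = con c := fun c => by simp
      rw [cur, pPoly, qPoly, map_sub, map_sub, map_mul, map_mul, hX, hC, hC]
      linear_combination z ^ 2 * e

/-- The defining relation of the Lax matrices; `∂1/∂t_j = 0`. -/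
theorem lax_spec (h : Lau) (j : ℕ) :
    cur h j = atZ2 (lax h j 0 0) + atZ2 (lax h j 0 1) * h ∧
    cs2Field h j + cur h j * h
      = atZ2 (lax h j 1 0) + atZ2 (lax h j 1 1) * h := by
  refine ⟨by simpa [lax] using cur_eq h j, ?_⟩
  have hC : ∀ c, atZ2 (C c) = con c := fun c => by simp
  have e : ∑ l ∈ Finset.Icc 1 j, con (h.coeff l) * cur h (j - l)
      = ∑ l ∈ Finset.Icc 1 j, con (h.coeff l) * atZ2 (pPoly h (j - l))
        + (∑ l ∈ Finset.Icc 1 j, con (h.coeff l) * atZ2 (qPoly h (j - l))) * h := by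
    rw [Finset.sum_mul, ← Finset.sum_add_distrib]
    refine Finset.sum_congr rfl fun l _ => ?_
    rw [cur_eq h (j - l)]
    ring
  have c1 : cur h 1 = h := by simp [cur]
  have c0 : cur h 0 = 1 := by simp [cur]
  have l0 : lax h j 1 0 = pPoly h (j + 1)
      + ∑ l ∈ Finset.Icc 1 j, C (h.coeff (l : ℤ)) * pPoly h (j - l) + C ((cur h j).coeff 1) := rfl
  have l1 : lax h j 1 1 = qPoly h (j + 1)
      + ∑ l ∈ Finset.Icc 1 j, C (h.coeff (l : ℤ)) * qPoly h (j - l) := rfl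
  rw [l0, l1, cs2Field, csField, c1, e, cur_eq h (j + 1)]
  simp only [Finset.Icc_self, Finset.sum_singleton, Nat.sub_self, c0, Nat.cast_one, map_add,
    map_sum, map_mul, hC]
  ring

theorem mem_cs2Set_iff (H : ℕ → Lau) : H ∈ cs2Set ↔ H 1 ∈ cs2Space ∧ H = cur (H 1) := by
  have zpow : ∀ k : ℕ, z ^ k = HahnSeries.single (-(k : ℤ)) (1 : ℂ) := fun k => by
    rw [z, HahnSeries.single_pow]; simp
  have key : ∀ H : ℕ → Lau, H 0 = 1 → H 2 = z ^ 2 → ∀ k, csField H 2 k = 0 ↔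
      H (k + 2) = z ^ 2 * H k - con ((H k).coeff 1) * H 1 - con ((H k).coeff 2) := by
    intro H h0 h2 k
    have hs : ∑ l ∈ Finset.Icc 1 k, con ((H 2).coeff l) * H (k - l) = 0 := by
      refine Finset.sum_eq_zero fun l hl => ?_
      have := (Finset.mem_Icc.1 hl).1
      rw [h2, zpow, HahnSeries.coeff_single_of_ne (by omega), map_zero, zero_mul]
    have ht : ∑ l ∈ Finset.Icc (1 : ℕ) 2, con ((H k).coeff l) * H (2 - l)
        = con ((H k).coeff 1) * H 1 + con ((H k).coeff 2) := by
      rw [show Finset.Icc (1 : ℕ) 2 = {1, 2} from rfl, Finset.sum_pair (by decide)]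
      simp [h0]
    rw [csField, hs, ht, h2, add_comm 2 k]
    constructor
    · intro e; linear_combination e
    · intro e; linear_combination e
  have one_coeff : ∀ n : ℤ, 1 ≤ n → (1 : Lau).coeff n = 0 := fun n hn => by
    rw [HahnSeries.coeff_one, if_neg (by omega)]
  constructor
  · rintro ⟨⟨h0, hc⟩, hf, h2⟩
    refine ⟨fun n hn => by simpa using hc 1 le_rfl n hn, funext fun k => ?_⟩
    induction k using Nat.strong_induction_on with
    | _ k ih =>
      match k, ih with
      | 0, _ => simp [cur, h0]
      | 1, _ => simp [cur]
      | k + 2, ih =>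
        rw [cur, ← ih k (by omega)]
        rcases Nat.eq_zero_or_pos k with rfl | hk
        · rw [h0, h2, one_coeff 1 (by norm_num), one_coeff 2 (by norm_num)]
          simp
        · exact (key H h0 h2 k).1 (hf k hk)
  · rintro ⟨h1, e⟩
    have h0 : H 0 = 1 := by rw [e]; simp [cur]
    have rec' : ∀ k, H (k + 2) =
        z ^ 2 * H k - con ((H k).coeff 1) * H 1 - con ((H k).coeff 2) := fun k => by
      have e' := fun n => congrFun e n
      rw [e' (k + 2), cur, ← e' k]
    have h2 : H 2 = z ^ 2 := by
      rw [rec' 0, h0, one_coeff 1 (by norm_num), one_coeff 2 (by norm_num)]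
      simp
    refine ⟨⟨h0, fun k => ?_⟩, fun k _ => (key H h0 h2 k).2 (rec' k), h2⟩
    induction k using Nat.strong_induction_on with
    | _ k ih =>
      match k, ih with
      | 0, _ => intro h; omega
      | 1, _ => intro _ n hn; simpa using h1 n hn
      | k + 2, ih =>
        intro _ n hn
        rcases Nat.eq_zero_or_pos k with rfl | hk
        · rw [h2, sub_self, HahnSeries.coeff_zero]
        have i1 := ih k (by omega) hk
        have es : H (k + 2) - z ^ (k + 2) = z ^ 2 * (H k - z ^ k)
            - con ((H k).coeff 1) * (H 1 - z) - con ((H k).coeff 1) * z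
            - con ((H k).coeff 2) := by
          rw [rec' k]; ring
        have em : (z ^ 2 * (H k - z ^ k)).coeff n = (H k - z ^ k).coeff (n + 2) := by
          have := HahnSeries.coeff_single_mul_add (r := (1 : ℂ)) (x := H k - z ^ k)
            (a := n + 2) (b := (-2 : ℤ))
          rw [show n + 2 + -2 = n by ring, one_mul] at this
          rw [zpow 2]
          exact_mod_cast this
        have ec : ∀ m : ℤ, 1 ≤ m → (H k - z ^ k).coeff m = (H k).coeff m := fun m hm => by
          rw [zpow, HahnSeries.coeff_sub, HahnSeries.coeff_single_of_ne (by omega), sub_zero]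
        have cc : ∀ (c : ℂ) (x : Lau), (con c * x).coeff n = c * x.coeff n := fun c x => by
          rw [con, HahnSeries.C_mul_eq_smul, HahnSeries.coeff_smul, smul_eq_mul]
        have cd : ∀ c : ℂ, (con c).coeff n = if n = 0 then c else 0 := fun c => by
          simp [con, HahnSeries.C_apply, HahnSeries.coeff_single]
        rw [es, HahnSeries.coeff_sub, HahnSeries.coeff_sub, HahnSeries.coeff_sub, em, cc, cc, cd,
          h1 n hn]
        rcases lt_trichotomy n (-1) with h | h | h
        · rw [i1 (n + 2) (by omega), z, HahnSeries.coeff_single_of_ne (by omega),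
            if_neg (by omega)]
          simp
        · subst h
          rw [ec _ (by norm_num), z, HahnSeries.coeff_single_same, if_neg (by norm_num)]
          norm_num
        · obtain rfl : n = 0 := by omega
          rw [ec _ (by norm_num), z, HahnSeries.coeff_single_of_ne (by norm_num), if_pos rfl]
          norm_num

/-! ### The space of matrix polynomials `λ ^ (g+1) A + ∑_{i ≤ g} λ ^ i X_i`, `X_i ∈ sl(2)` -/

/-- The coordinates `(p, r, q)` of the traceless matrix `[[p, r], [q, -p]]`. -/
def mat (a : Fin 3 → ℂ) : Matrix (Fin 2) (Fin 2) ℂ := !![a 0, a 1; a 2, -a 0]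

/-- The inverse of `mat` on traceless matrices. -/
def ofMat (M : Matrix (Fin 2) (Fin 2) ℂ) : Fin 3 → ℂ := ![M 0 0, M 0 1, M 1 0]

theorem ofMat_mat (a : Fin 3 → ℂ) : ofMat (mat a) = a := by
  ext i; fin_cases i <;> simp [mat, ofMat]

theorem mat_ofMat (M : Matrix (Fin 2) (Fin 2) ℂ) (hM : M.trace = 0) : mat (ofMat M) = M := by
  rw [Matrix.trace_fin_two] at hM
  ext i j; fin_cases i <;> fin_cases j <;> simp [mat, ofMat]
  linear_combination -hM

/-- The commutator on `sl(2)`. -/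
def lie (a b : Fin 3 → ℂ) : Fin 3 → ℂ := ofMat (mat a * mat b - mat b * mat a)

theorem mat_lie (a b : Fin 3 → ℂ) : mat (lie a b) = mat a * mat b - mat b * mat a :=
  mat_ofMat _ (by rw [Matrix.trace_sub, Matrix.trace_mul_comm, sub_self])

/-- The matrix `A = [[0, 0], [1, 0]]`. -/
def aVec : Fin 3 → ℂ := ![0, 0, 1]

/-- The affine space of the polynomials `λ ^ (g+1) A + ∑_{i ≤ g} λ ^ i X_i` with `X_i` in `sl(2)`,
through the coefficients `(X_0, …, X_g)`; also its tangent and cotangent spaces. -/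
abbrev MA (g : ℕ) : Type := Fin (g + 1) → Fin 3 → ℂ

variable {g : ℕ}

/-- The coefficient of `λ ^ k` in `X(λ)`. -/
def coef (x : MA g) (k : ℕ) : Fin 3 → ℂ :=
  if hk : k < g + 1 then x ⟨k, hk⟩ else if k = g + 1 then aVec else 0

/-- The matrix polynomial `X(λ)`. -/
def toPoly (x : MA g) : (Matrix (Fin 2) (Fin 2) ℂ)[X] :=
  ∑ k ∈ Finset.range (g + 2), monomial k (mat (coef x k))

/-- The coefficient `H_i` of `λ ^ i` in `(1/2) Tr X(λ)²`. -/
def ham (i : ℕ) (x : MA g) : ℂ := ((toPoly x ^ 2).coeff i).trace / 2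

/-- The vector field `∂X(λ)/∂t_i = [(λ ^ (i-g) X(λ))_+, X(λ)]`, for `i ≤ g`. -/
def laxField (i : ℕ) (x : MA g) : MA g := fun m =>
  ofMat ((divX^[g - i] (toPoly x) * toPoly x - toPoly x * divX^[g - i] (toPoly x)).coeff m)

/-- The pairing `∑_i Tr (V_i W_i)` of tangent and cotangent vectors. -/
def pairing (v w : MA g) : ℂ := ∑ i, (mat (v i) * mat (w i)).trace

/-- The identification of covectors with elements of `MA g` through `pairing`. -/
def grad (α : MA g →L[ℂ] ℂ) : MA g := fun i =>
  ![α (Pi.single i ![1, 0, 0]) / 2, α (Pi.single i ![0, 0, 1]), α (Pi.single i ![0, 1, 0])]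

theorem pairing_grad (α : MA g →L[ℂ] ℂ) (v : MA g) : pairing v (grad α) = α v := by
  have hv : v = ∑ i, (v i 0 • (Pi.single i ![1, 0, 0] : MA g) + v i 1 • (Pi.single i ![0, 1, 0] : MA g)
      + v i 2 • (Pi.single i ![0, 0, 1] : MA g)) := by
    ext i k
    simp only [Finset.sum_apply, Pi.add_apply, Pi.smul_apply]
    rw [Finset.sum_eq_single i (fun j _ hj => by simp [Pi.single_eq_of_ne hj.symm]) (by simp)]
    fin_cases k <;> simp
  conv_rhs => rw [hv]
  simp only [map_sum, map_add, map_smul, pairing, smul_eq_mul]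
  refine Finset.sum_congr rfl fun i _ => ?_
  simp only [mat, grad, Matrix.trace_fin_two, Matrix.mul_apply, Fin.sum_univ_two]
  simp
  ring

/-- The first Poisson tensor, `Ẋ_i = ∑_{j ≥ 0} [X_{i+j+1}, W_j]`, where `X_{g+1} = A`. -/
def P0 (x w : MA g) : MA g := fun i => ∑ j : Fin (g + 1), lie (coef x (i + j + 1)) (w j)

/-- The second Poisson tensor, `Ẋ_0 = -[X_0, W_0]` and `Ẋ_i = ∑_{j ≥ 1} [X_{i+j}, W_j]` for
`i ≥ 1`, where `X_{g+1} = A`. -/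
def P1 (x w : MA g) : MA g := fun i =>
  if i = 0 then -lie (x 0) (w 0)
  else ∑ j : Fin (g + 1), if j = 0 then 0 else lie (coef x (i + j)) (w j)

/-- The bracket `{F, G} = ⟨dF, P dG⟩`. -/
def pbr (P : MA g → MA g → MA g) (F G : MA g → ℂ) (x : MA g) : ℂ :=
  fderiv ℂ F x (P x (grad (fderiv ℂ G x)))

/-! ### The reduction -/

variable (g) in
/-- The symplectic leaf of `P0` given by `H_{2g+1} = 1` and `H_i = 0` for `g+1 ≤ i ≤ 2g`. -/
def leafS : Set (MA g) :=
  {x | ham (2 * g + 1) x = 1 ∧ ∀ i, g + 1 ≤ i → i ≤ 2 * g → ham i x = 0}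

/-- The tangent space of `leafS g`. -/
def tangentS (x : MA g) : Set (MA g) :=
  {v | ∀ i, g + 1 ≤ i → i ≤ 2 * g + 1 → fderiv ℂ (ham i) x v = 0}

/-- The distribution `D = P1 (Ker P0)`. -/
def distD (x : MA g) : Set (MA g) := {v | ∃ w, P0 x w = 0 ∧ P1 x w = v}

/-- The distribution `E = D ∩ TS`. -/
def distE (x : MA g) : Set (MA g) := distD x ∩ tangentS x

/-- Two points of `leafS g` on the same integral leaf of `E`. -/
def leafRel (x y : leafS g) : Prop :=
  ∃ γ : ℝ → MA g, γ 0 = x ∧ γ 1 = y ∧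
    ∀ t, γ t ∈ leafS g ∧ ∃ v ∈ distE (γ t), HasDerivAt γ v t

variable (g) in
/-- The quotient of `leafS g` by the integral leaves of `E`. -/
def Ntilde : Type := Quot (leafRel (g := g))

/-- The projection of `leafS g` on the quotient. -/
def proj (x : leafS g) : Ntilde g := Quot.mk _ x

/-- `F` is a holomorphic prolongation to `MA g` of the function `f` on the quotient. -/
def Prolongs (F : MA g → ℂ) (f : Ntilde g → ℂ) : Prop :=
  Differentiable ℂ F ∧ ∀ x : leafS g, F x = f (proj x)

variable (g) in
/-- The holomorphic functions on the quotient. -/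
def holFun : Subalgebra ℂ (Ntilde g → ℂ) where
  carrier := {f | ∃ F, Prolongs F f}
  mul_mem' := by
    rintro a b ⟨F, hF, hF'⟩ ⟨K, hK, hK'⟩
    exact ⟨fun x => F x * K x, hF.mul hK, fun x => by simp [hF', hK']⟩
  add_mem' := by
    rintro a b ⟨F, hF, hF'⟩ ⟨K, hK, hK'⟩
    exact ⟨fun x => F x + K x, hF.add hK, fun x => by simp [hF', hK']⟩
  algebraMap_mem' c := ⟨fun _ => c, differentiable_const c, fun _ => rfl⟩

/-- The vector field `Z` on `MA g` is tangent to `leafS g` and projects on the vector field `δ` of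
the quotient. -/
def ProjectsTo (Z : MA g → MA g) (δ : Derivation ℂ (holFun g) (holFun g)) : Prop :=
  ∀ x : leafS g, Z x ∈ tangentS (x : MA g) ∧
    ∀ (f : holFun g) (F : MA g → ℂ), Prolongs F f → fderiv ℂ F x (Z x) = (δ f).1 (proj x)

/-- `B` is the reduction of the Poisson tensor `P`: the bracket of two functions on the quotient
is computed on arbitrary prolongations (which annihilate `D` on `leafS g`, as `D` is tangent to
`leafS g`). -/
def IsReduction (P : MA g → MA g → MA g)
    (B : holFun g →ₗ[ℂ] holFun g →ₗ[ℂ] holFun g) : Prop :=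
  ∀ (f k : holFun g) (F K : MA g → ℂ), Prolongs F f → Prolongs K k →
    ∀ x : leafS g, pbr P F K x = (B f k).1 (proj x)

/-- A Poisson bracket on a commutative algebra. -/
structure IsPoisson {R : Type*} [CommRing R] [Algebra ℂ R] (B : R →ₗ[ℂ] R →ₗ[ℂ] R) : Prop where
  skew : ∀ a b, B a b = -B b a
  leibniz : ∀ a b c, B a (b * c) = B a b * c + b * B a c
  jacobi : ∀ a b c, B a (B b c) + B b (B c a) + B c (B a b) = 0

/-- The pencil `B1 - μ B0`. -/
def pencil (B0 B1 : holFun g →ₗ[ℂ] holFun g →ₗ[ℂ] holFun g) (μ : ℂ) :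
    holFun g →ₗ[ℂ] holFun g →ₗ[ℂ] holFun g := B1 + (-μ) • B0

/-- Evaluation of functions at a point of the quotient. -/
def evalAt (n : Ntilde g) : holFun g →ₗ[ℂ] ℂ where
  toFun f := f.1 n
  map_add' _ _ := rfl
  map_smul' _ _ := rfl

/-- The rank at `n` of the bivector with bracket `B`. -/
def rankAt (B : holFun g →ₗ[ℂ] holFun g →ₗ[ℂ] holFun g) (n : Ntilde g) : Cardinal :=
  LinearMap.rank (B.compr₂ (evalAt n))

/-- Under the map `Φ` from the phase space of KdV_{2g+1} to the quotient, the `j`-th flow of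
KdV_{2g+1} corresponds to the vector field `δ`: for every expression `G(h_1, …, h_N)` of `f ∘ Φ`,
the derivative of `G` along `∂h/∂t_j` is `(δ f) ∘ Φ`. -/
def KdVCorresponds (Φ : kdvSpace g → Ntilde g) (j : ℕ)
    (δ : Derivation ℂ (holFun g) (holFun g)) : Prop :=
  ∀ (f : holFun g) (N : ℕ) (G : (Fin N → ℂ) → ℂ), Differentiable ℂ G →
    (∀ h : kdvSpace g, f.1 (Φ h) = G (coords N h)) →
    ∀ h : kdvSpace g,
      fderiv ℂ G (coords N h) (coords N (cs2Field h j)) = (δ f).1 (Φ h)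

end

end StationaryKdV

namespace StationaryKdV

noncomputable section

/-! ### Entire functions of several variables -/

section Entire

variable {E : Type*} [NormedAddCommGroup E] [NormedSpace ℂ E]

/-! Write `X = [[p, r], [q, -p]]`. On `leafS g` the polynomial `r` is monic of degree `g`, and
conjugation by `1 + tA` translates `p_g` by `-t`. The distribution `E` is the line spanned by the
generator `[A, X]` of this conjugation (`mem_distE_iff`), so its leaves are the gauge orbits and the
slice `p_g = 0` meets each orbit exactly once. Lax matrices lie on the slice.

For the Lax matrix, stationarity of `h` is the quadratic equation `r h² + 2 p h = q`. Conversely, if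
`h` solves it for a point of the slice, then `w = p + r h` satisfies `w² = p² + r q = λ^(2g+1) +
O(λ^g)`, hence `w = z^(2g+1) + O(1/z)`; this identifies `w` with the current of index `2g+1` and `X`
with the Lax matrix of `h` (`mem_kdvSpace_of_equation`). The quadratic equation is a contracting
fixed point equation for power series in `1/z` over the ring of entire functions on `MA g`, so `h`
depends on `X` through entire functions; in the other direction the Lax matrix is a polynomial
expression in `h_1, …, h_{2g+1}` alone. Thus `leafS g` is the image of `ℂ^(2g+1) × ℂ` under an
entire map with an entire left inverse (`param`, `paramInv`), which settles the bijections, the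
holomorphic functions and the tangent spaces.

Each `a P1 + b P0` is linear plus constant in `X`. Its Jacobi identity reduces to that of `sl(2)`
because the structure coefficients are cyclically symmetric (`penCoef_rotate`). A function constant
on gauge orbits in `leafS g` has all its Hamiltonian fields tangent to `leafS g`, so brackets of
prolongations depend only on the functions on the quotient, and every identity descends. The Lenard
relations `P1 dH_{n+1} = P0 dH_n`, with `P1 dH_0 = 0` and `P0 dH_g = [A, X]`, give the Casimir and
both Hamiltonian forms of the flows.

For the rank: the image of `P0` is the whole tangent space of `leafS g`, so the reduced `P0` has
corank at most one; rank can drop only for finitely many members of a pencil, and a skew matrix of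
odd size is singular.

For the flows, the quadratic equation is differentiated along the Lax field corrected by a multiple
of `[A, X]` so as to stay on the slice. Up to a multiple of `A`, the matrix `(λ^(i-g) X)_+` is the
Lax matrix of index `2i+1`, so the result is the Riccati equation for `∂h/∂t_{2i+1}`; comparing
orders in `z` fixes the multiple (`hat_derSer_flow`). -/

theorem hasDerivAt_comp_line {F : E → ℂ} (hF : Differentiable ℂ F) (x v : E) (s : ℂ) :
    HasDerivAt (fun s : ℂ => F (x + s • v)) (fderiv ℂ F (x + s • v) v) s := by
  have h1 : HasDerivAt (fun s : ℂ => x + s • v) v s := by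
    simpa using ((hasDerivAt_id s).smul_const v).const_add x
  exact (hF (x + s • v)).hasFDerivAt.comp_hasDerivAt s h1

/-- Cauchy's estimate for the derivative of an entire function of several variables. -/
theorem norm_fderiv_le_of_bound {F : E → ℂ} (hF : Differentiable ℂ F) (x : E) {M : ℝ}
    (hM : ∀ y, ‖y - x‖ ≤ 1 → ‖F y‖ ≤ M) : ‖fderiv ℂ F x‖ ≤ M := by
  have hM0 : 0 ≤ M := (norm_nonneg _).trans (hM x (by simp))
  refine ContinuousLinearMap.opNorm_le_bound _ hM0 fun v => ?_
  rcases eq_or_ne v 0 with rfl | hv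
  · simp
  have hv' : 0 < ‖v‖ := norm_pos_iff.2 hv
  have hd : Differentiable ℂ (fun s : ℂ => F (x + s • v)) :=
    fun s => (hasDerivAt_comp_line hF x v s).differentiableAt
  have h := Complex.norm_deriv_le_of_forall_mem_sphere_norm_le (c := 0) (R := ‖v‖⁻¹) (C := M)
    (f := fun s : ℂ => F (x + s • v)) (inv_pos.2 hv') hd.diffContOnCl (fun s hs => hM _ (by
      rw [mem_sphere_zero_iff_norm] at hs
      rw [add_sub_cancel_left, norm_smul, hs, inv_mul_cancel₀ hv'.ne']))
  rw [(hasDerivAt_comp_line hF x v 0).deriv] at h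
  simpa [div_inv_eq_mul] using h

/-- Cauchy's formula on the unit circle of the complex line through `x` along `v` writes the
directional derivative as an integral of values of `F`. It can be differentiated under the integral
sign because Cauchy's estimate bounds `fderiv ℂ F` uniformly near a given point. -/
theorem differentiable_fderiv_apply [FiniteDimensional ℂ E] {F : E → ℂ} (hF : Differentiable ℂ F) (v : E) :
    Differentiable ℂ (fun x => fderiv ℂ F x v) := by
  have key : (fun x => fderiv ℂ F x v) = fun x => (2 * Real.pi * Complex.I : ℂ)⁻¹ •
      ∫ θ in (0 : ℝ)..2 * Real.pi, (deriv (circleMap 0 1) θ * (circleMap 0 1 θ ^ 2)⁻¹) *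
        F (x + circleMap 0 1 θ • v) := by
    funext x
    have hd : Differentiable ℂ (fun s : ℂ => F (x + s • v)) :=
      fun s => (hasDerivAt_comp_line hF x v s).differentiableAt
    have h := DiffContOnCl.deriv_eq_smul_circleIntegral (c := 0) (R := 1) one_pos
      (f := fun s : ℂ => F (x + s • v)) hd.diffContOnCl
    rw [(hasDerivAt_comp_line hF x v 0).deriv, zero_smul, add_zero] at h
    rw [eq_inv_smul_iff₀ (by simp), ← h, circleIntegral]
    refine intervalIntegral.integral_congr fun θ _ => ?_
    simp only [sub_zero, smul_eq_mul, one_div, mul_assoc]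
  rw [key]
  intro x₀
  refine DifferentiableAt.fun_const_smul ?_ _
  let _ : MeasurableSpace E := borel E
  have : BorelSpace E := ⟨rfl⟩
  have : CompleteSpace E := FiniteDimensional.complete ℂ E
  have : ProperSpace E := FiniteDimensional.proper ℂ E
  have : SecondCountableTopology E := inferInstance
  have hcm : Continuous (circleMap (0 : ℂ) 1) := continuous_circleMap 0 1
  have hk : Continuous fun θ : ℝ => deriv (circleMap 0 1) θ * (circleMap 0 1 θ ^ 2)⁻¹ := by
    refine Continuous.mul ?_ ((hcm.pow 2).inv₀ fun θ => pow_ne_zero _ ?_)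
    · rw [show deriv (circleMap (0 : ℂ) 1) = fun θ => circleMap 0 1 θ * Complex.I from
        funext fun θ => deriv_circleMap 0 1 θ]
      exact hcm.mul continuous_const
    · exact circleMap_ne_center one_ne_zero
  -- The radius covers the unit balls around all points `x + e^(iθ) v` with `x` within distance 1 of
  -- `x₀`.
  obtain ⟨M, hM⟩ := (isCompact_closedBall x₀ (‖v‖ + 2)).exists_bound_of_continuousOn
    hF.continuous.continuousOn
  have hbound : ∀ x ∈ Metric.ball x₀ 1, ∀ θ : ℝ, ‖fderiv ℂ F (x + circleMap 0 1 θ • v)‖ ≤ M := by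
    intro x hx θ
    refine norm_fderiv_le_of_bound hF _ fun y hy => hM y ?_
    rw [mem_closedBall_iff_norm]
    rw [mem_ball_iff_norm] at hx
    have e : y - x₀ = (y - (x + circleMap 0 1 θ • v)) + (x - x₀) + circleMap 0 1 θ • v := by abel
    rw [e]
    refine (norm_add_le _ _).trans ?_
    have h1 := norm_add_le (y - (x + circleMap 0 1 θ • v)) (x - x₀)
    have h2 : ‖circleMap 0 1 θ • v‖ = ‖v‖ := by rw [norm_smul, norm_circleMap_zero]; simp
    linarith
  have hcont : ∀ x : E, Continuous fun θ : ℝ =>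
      (deriv (circleMap 0 1) θ * (circleMap 0 1 θ ^ 2)⁻¹) * F (x + circleMap 0 1 θ • v) :=
    fun x => hk.mul (hF.continuous.comp (continuous_const.add (hcm.smul continuous_const)))
  exact (intervalIntegral.hasFDerivAt_integral_of_dominated_of_fderiv_le
    (𝕜 := ℂ) (μ := MeasureTheory.volume) (s := Metric.ball x₀ 1)
    (F := fun x θ => (deriv (circleMap 0 1) θ * (circleMap 0 1 θ ^ 2)⁻¹)
        * F (x + circleMap 0 1 θ • v))
    (F' := fun x θ => (deriv (circleMap 0 1) θ * (circleMap 0 1 θ ^ 2)⁻¹) •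
        fderiv ℂ F (x + circleMap 0 1 θ • v))
    (bound := fun θ => ‖deriv (circleMap (0 : ℂ) 1) θ * (circleMap 0 1 θ ^ 2)⁻¹‖ * M)
    (Metric.ball_mem_nhds x₀ one_pos)
    (Filter.Eventually.of_forall fun x => (hcont x).aestronglyMeasurable)
    ((hcont x₀).intervalIntegrable _ _)
    (hk.aestronglyMeasurable.smul ((measurable_fderiv ℂ F).comp (by fun_prop)).aestronglyMeasurable)
    (Filter.Eventually.of_forall fun θ _ x hx => by
      rw [norm_smul]
      exact mul_le_mul_of_nonneg_left (hbound x hx θ) (norm_nonneg _))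
    ((hk.norm.mul continuous_const).intervalIntegrable _ _)
    (Filter.Eventually.of_forall fun θ _ x _ => by
      have h1 : HasFDerivAt (fun x : E => x + circleMap 0 1 θ • v) (ContinuousLinearMap.id ℂ E) x :=
        (hasFDerivAt_id x).add_const _
      have h2 := (hF (x + circleMap 0 1 θ • v)).hasFDerivAt.comp x h1
      exact h2.const_mul _)).differentiableAt

/-- Order 2 is what matters below: symmetry of the second derivative makes the Hessians cancel in
the Jacobi identity. -/
theorem contDiff_of_differentiable [FiniteDimensional ℂ E] {F : E → ℂ} (hF : Differentiable ℂ F) (n : ℕ) :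
    ContDiff ℂ n F := by
  induction n generalizing F with
  | zero => exact_mod_cast contDiff_zero.2 hF.continuous
  | succ n ih =>
    push_cast
    exact contDiff_succ_iff_fderiv_apply.2
      ⟨hF, fun h => by simp at h, fun y => ih (differentiable_fderiv_apply hF y)⟩

theorem differentiable_fderiv [FiniteDimensional ℂ E] {F : E → ℂ} (hF : Differentiable ℂ F) :
    Differentiable ℂ (fderiv ℂ F) :=
  ((contDiff_of_differentiable hF 2).fderiv_right (m := 1) (by norm_num)).differentiable_one

theorem fderiv_fderiv_comm [FiniteDimensional ℂ E] {F : E → ℂ} (hF : Differentiable ℂ F) (x u v : E) :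
    fderiv ℂ (fderiv ℂ F) x u v = fderiv ℂ (fderiv ℂ F) x v u :=
  ((contDiff_of_differentiable hF 2).contDiffAt.isSymmSndFDerivAt (by simp)).eq u v

end Entire

/-! ### Algebra of `sl(2)` in coordinates -/

theorem lie_eq (a b : Fin 3 → ℂ) : lie a b =
    ![a 1 * b 2 - b 1 * a 2, 2 * (a 0 * b 1 - a 1 * b 0), 2 * (a 2 * b 0 - a 0 * b 2)] := by
  ext i
  fin_cases i <;> simp [lie, ofMat, mat] <;> ring

/-- The commutator as a bilinear map. -/
def lieHom : (Fin 3 → ℂ) →ₗ[ℂ] (Fin 3 → ℂ) →ₗ[ℂ] (Fin 3 → ℂ) :=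
  LinearMap.mk₂ ℂ lie
    (fun a b c => by ext i; fin_cases i <;> simp [lie_eq] <;> ring)
    (fun s a b => by ext i; fin_cases i <;> simp [lie_eq] <;> ring)
    (fun a b c => by ext i; fin_cases i <;> simp [lie_eq] <;> ring)
    (fun s a b => by ext i; fin_cases i <;> simp [lie_eq] <;> ring)

theorem lieHom_apply (a b : Fin 3 → ℂ) : lieHom a b = lie a b := rfl

theorem lie_zero (a : Fin 3 → ℂ) : lie a 0 = 0 := (lieHom a).map_zero
theorem zero_lie (a : Fin 3 → ℂ) : lie 0 a = 0 := by simp [← lieHom_apply]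
theorem lie_swap (a b : Fin 3 → ℂ) : lie a b = -lie b a := by
  ext i; fin_cases i <;> simp [lie_eq] <;> ring
theorem lie_self (a : Fin 3 → ℂ) : lie a a = 0 := by
  ext i; fin_cases i <;> simp [lie_eq] <;> ring

/-- The trace form on `sl(2)`. -/
def kil (a b : Fin 3 → ℂ) : ℂ := 2 * a 0 * b 0 + a 1 * b 2 + a 2 * b 1

theorem trace_mat_mul (a b : Fin 3 → ℂ) : (mat a * mat b).trace = kil a b := by
  simp [mat, kil, Matrix.trace_fin_two]; ring

/-- The trace form as a bilinear map. -/
def kilHom : (Fin 3 → ℂ) →ₗ[ℂ] (Fin 3 → ℂ) →ₗ[ℂ] ℂ :=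
  LinearMap.mk₂ ℂ kil
    (fun a b c => by simp [kil]; ring) (fun s a b => by simp [kil]; ring)
    (fun a b c => by simp [kil]; ring) (fun s a b => by simp [kil]; ring)

theorem kilHom_apply (a b : Fin 3 → ℂ) : kilHom a b = kil a b := rfl

theorem kil_comm (a b : Fin 3 → ℂ) : kil a b = kil b a := by simp [kil]; ring

theorem kil_lie (u x w : Fin 3 → ℂ) : kil u (lie x w) = -kil w (lie x u) := by
  simp [kil, lie_eq]; ring

/-- Invariance of the trace form moves `z` out of the brackets; what remains is `z` paired with the
Jacobi identity of `u`, `v`, `w`. -/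
theorem kil_lie_jacobi (z u v w : Fin 3 → ℂ) :
    kil u (lie (lie z w) v) + kil v (lie (lie z u) w) + kil w (lie (lie z v) u) = 0 := by
  simp [kil, lie_eq]; ring

theorem eq_zero_of_kil (a : Fin 3 → ℂ) (h : ∀ b, kil b a = 0) : a = 0 := by
  ext i
  have h0 := h ![1, 0, 0]
  have h1 := h ![0, 1, 0]
  have h2 := h ![0, 0, 1]
  simp [kil] at h0 h1 h2
  fin_cases i <;> simp [h0, h1, h2]

variable {g : ℕ}

theorem pairing_eq (v w : MA g) : pairing v w = ∑ i, kil (v i) (w i) := by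
  simp [pairing, trace_mat_mul]

/-- The pairing as a bilinear map. -/
def pairingHom : MA g →ₗ[ℂ] MA g →ₗ[ℂ] ℂ :=
  LinearMap.mk₂ ℂ pairing
    (fun a b c => by simp [pairing_eq, ← kilHom_apply, Finset.sum_add_distrib])
    (fun s a b => by simp [pairing_eq, ← kilHom_apply, Finset.mul_sum])
    (fun a b c => by simp [pairing_eq, ← kilHom_apply, Finset.sum_add_distrib])
    (fun s a b => by simp [pairing_eq, ← kilHom_apply, Finset.mul_sum])

theorem pairingHom_apply (v w : MA g) : pairingHom v w = pairing v w := rfl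

theorem pairing_comm (v w : MA g) : pairing v w = pairing w v := by
  simp [pairing_eq, kil_comm]

theorem eq_of_pairing (w w' : MA g) (h : ∀ v, pairing v w = pairing v w') : w = w' := by
  rw [← sub_eq_zero]
  ext1 i
  refine eq_zero_of_kil _ fun b => ?_
  have h1 : pairing (Pi.single i b : MA g) (w - w') = 0 := by
    rw [← pairingHom_apply, map_sub, pairingHom_apply, pairingHom_apply, h, sub_self]
  rw [pairing_eq, Finset.sum_eq_single i] at h1
  · simpa using h1
  · intro j _ hj
    rw [Pi.single_eq_of_ne hj]
    simp [← kilHom_apply]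
  · simp

/-- `grad` as a linear map. -/
def gradHom : (MA g →L[ℂ] ℂ) →ₗ[ℂ] MA g where
  toFun := grad
  map_add' α β := by
    ext i k; fin_cases k <;> simp [grad]; ring
  map_smul' c α := by
    ext i k; fin_cases k <;> simp [grad]; ring

theorem gradHom_apply (α : MA g →L[ℂ] ℂ) : gradHom α = grad α := rfl

theorem grad_eq (α : MA g →L[ℂ] ℂ) (w : MA g) (h : ∀ v, α v = pairing v w) : grad α = w :=
  eq_of_pairing _ _ fun v => by rw [pairing_grad, h]

/-! ### The pencil of Poisson tensors -/

/-- The sign with which `X_{i+j}` enters the second Poisson tensor. -/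
def eps (i j : ℕ) : ℂ := if i = 0 ∧ j = 0 then -1 else if i = 0 ∨ j = 0 then 0 else 1

theorem eps_comm (i j : ℕ) : eps i j = eps j i := by
  simp only [eps, and_comm, or_comm]

/-- The tensor `a P1 + b P0`. -/
def pen (a b : ℂ) (x w : MA g) : MA g := a • P1 x w + b • P0 x w

/-- The coefficient of `λ ^ k` of a tangent vector. -/
def coef0 (y : MA g) (k : ℕ) : Fin 3 → ℂ := if hk : k < g + 1 then y ⟨k, hk⟩ else 0

theorem coef_fin (x : MA g) (i : Fin (g + 1)) : coef x i = x i := by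
  rw [coef, dif_pos i.2]

theorem coef0_fin (x : MA g) (i : Fin (g + 1)) : coef0 x i = x i := by
  rw [coef0, dif_pos i.2]

theorem coef_of_lt (x : MA g) {k : ℕ} (h : g + 1 < k) : coef x k = 0 := by
  rw [coef, dif_neg (by omega), if_neg (by omega)]

theorem coef_top (x : MA g) : coef x (g + 1) = aVec := by simp [coef]

theorem coef_eq_add (x : MA g) (k : ℕ) :
    coef x k = coef0 x k + if k = g + 1 then aVec else 0 := by
  unfold coef coef0
  split_ifs <;> first | omega | simp

theorem coef0_add (x y : MA g) (k : ℕ) : coef0 (x + y) k = coef0 x k + coef0 y k := by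
  unfold coef0; split_ifs <;> simp

theorem coef0_smul (c : ℂ) (x : MA g) (k : ℕ) : coef0 (c • x) k = c • coef0 x k := by
  unfold coef0; split_ifs <;> simp

/-- The tensor `a P1 + b P0` for an arbitrary sequence of coefficients. -/
def penSeq (a b : ℂ) (c : ℕ → Fin 3 → ℂ) (w : MA g) (i : ℕ) : Fin 3 → ℂ :=
  ∑ j : Fin (g + 1), (b • lie (c (i + j + 1)) (w j) + (a * eps i j) • lie (c (i + j)) (w j))

theorem pen_apply (a b : ℂ) (x w : MA g) (i : Fin (g + 1)) :
    pen a b x w i = penSeq a b (coef x) w i := by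
  simp only [pen, P1, P0, Pi.add_apply, Pi.smul_apply, penSeq, Finset.sum_add_distrib]
  rw [← Finset.smul_sum, add_comm]
  congr 1
  simp only [mul_smul]
  rw [← Finset.smul_sum]
  congr 1
  split_ifs with hi
  · subst hi
    rw [Finset.sum_eq_single 0]
    · simp [eps, coef]
    · intro j _ hj
      have : (j : ℕ) ≠ 0 := fun h => hj (Fin.ext h)
      simp [eps, this]
    · simp
  · have hi' : (i : ℕ) ≠ 0 := fun h => hi (Fin.ext h)
    refine Finset.sum_congr rfl fun j _ => ?_
    split_ifs with hj
    · simp [eps, hj, hi']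
    · have hj' : (j : ℕ) ≠ 0 := fun h => hj (Fin.ext h)
      simp [eps, hj', hi']

/-- `penSeq` needs no truncation, which allows the tensor to be iterated with free indices. For `m ≥
g + 1` the only term with a nonzero coefficient of `X` is `[X_{g+1}, W_0]` with `m = g + 1`, and its
sign `eps m 0` is 0. -/
theorem coef0_pen (a b : ℂ) (x w : MA g) (m : ℕ) :
    coef0 (pen a b x w) m = penSeq a b (coef x) w m := by
  by_cases hm : m < g + 1
  · rw [coef0, dif_pos hm, pen_apply]
  · rw [coef0, dif_neg hm, penSeq]
    refine (Finset.sum_eq_zero fun j _ => ?_).symm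
    rw [coef_of_lt x (by omega), zero_lie, smul_zero, zero_add]
    by_cases hj : (j : ℕ) = 0
    · rw [eps, if_neg (by omega), if_pos (by omega), mul_zero, zero_smul]
    · rw [coef_of_lt x (by omega), zero_lie, smul_zero]

/-- The pencil as a linear map in the covector. -/
def penHom (a b : ℂ) (x : MA g) : MA g →ₗ[ℂ] MA g where
  toFun := pen a b x
  map_add' v w := by
    ext1 i
    rw [Pi.add_apply, pen_apply, pen_apply, pen_apply, penSeq, penSeq, penSeq,
      ← Finset.sum_add_distrib]
    refine Finset.sum_congr rfl fun j _ => ?_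
    simp only [← lieHom_apply, Pi.add_apply, map_add, smul_add]
    abel
  map_smul' c w := by
    ext1 i
    rw [Pi.smul_apply, pen_apply, pen_apply, penSeq, penSeq, RingHom.id_apply, Finset.smul_sum]
    refine Finset.sum_congr rfl fun j _ => ?_
    simp only [← lieHom_apply, Pi.smul_apply, map_smul, smul_add]
    rw [smul_comm c b, smul_comm c (a * _)]

theorem penHom_apply (a b : ℂ) (x w : MA g) : penHom a b x w = pen a b x w := rfl

theorem P0_eq_pen (x w : MA g) : P0 x w = pen 0 1 x w := by simp [pen]

theorem P1_eq_pen (x w : MA g) : P1 x w = pen 1 0 x w := by simp [pen]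

theorem pairing_pen (a b : ℂ) (c : ℕ → Fin 3 → ℂ) (v w : MA g) :
    pairing v (fun i : Fin (g + 1) => penSeq a b c w i) = ∑ i : Fin (g + 1), ∑ j : Fin (g + 1),
      (b * kil (v i) (lie (c (i + j + 1)) (w j))
        + a * eps i j * kil (v i) (lie (c (i + j)) (w j))) := by
  rw [pairing_eq]
  refine Finset.sum_congr rfl fun i _ => ?_
  simp only [penSeq, ← kilHom_apply, map_sum, map_add, map_smul, smul_eq_mul]

theorem pen_eq_penSeq (a b : ℂ) (x w : MA g) : pen a b x w = fun i : Fin (g + 1) => penSeq a b (coef x) w i :=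
  funext fun i => pen_apply a b x w i

theorem pairing_pen_skew (a b : ℂ) (x v w : MA g) :
    pairing v (pen a b x w) = -pairing w (pen a b x v) := by
  rw [pen_eq_penSeq, pen_eq_penSeq, pairing_pen, pairing_pen, Finset.sum_comm,
    ← Finset.sum_neg_distrib]
  refine Finset.sum_congr rfl fun i _ => ?_
  rw [← Finset.sum_neg_distrib]
  refine Finset.sum_congr rfl fun j _ => ?_
  rw [kil_lie (v j), kil_lie (v j), eps_comm (j : ℕ), add_comm (j : ℕ)]
  ring

/-- The linear part of the pencil. -/
def penLin (a b : ℂ) (y w : MA g) : MA g := fun i => penSeq a b (coef0 y) w i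

/-- The coefficients of the iterated linear Poisson structure, symmetric in `i`, `j`, `k`. -/
def penCoef (a b : ℂ) (c : ℕ → Fin 3 → ℂ) (i j k : ℕ) : Fin 3 → ℂ :=
  (b * b) • c (i + j + k + 2) + (a * b * (eps (i + j + 1) k + eps i j)) • c (i + j + k + 1)
    + (a * a * (eps i j * eps (i + j) k)) • c (i + j + k)

theorem pairing_penLin_pen (a b : ℂ) (x u v w : MA g) :
    pairing u (penLin a b (pen a b x w) v) =
      ∑ i : Fin (g + 1), ∑ j : Fin (g + 1), ∑ k : Fin (g + 1),
        kil (u i) (lie (lie (penCoef a b (coef x) i j k) (w k)) (v j)) := by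
  rw [show penLin a b (pen a b x w) v = fun i : Fin (g + 1) =>
    penSeq a b (coef0 (pen a b x w)) v i from rfl, pairing_pen]
  refine Finset.sum_congr rfl fun i _ => Finset.sum_congr rfl fun j _ => ?_
  rw [coef0_pen, coef0_pen, penSeq, penSeq]
  simp only [← kilHom_apply, ← lieHom_apply, map_sum, map_add, map_smul, LinearMap.sum_apply,
    LinearMap.add_apply, LinearMap.smul_apply, smul_eq_mul, Finset.mul_sum, penCoef]
  rw [← Finset.sum_add_distrib]
  refine Finset.sum_congr rfl fun k _ => ?_
  rw [show (i : ℕ) + j + 1 + k + 1 = i + j + k + 2 by ring,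
    show (i : ℕ) + j + 1 + k = i + j + k + 1 by ring]
  ring

/-- The `b²`, `ab` and `a²` components express respectively the Jacobi identity of `P0`, the
compatibility of the two tensors and the Jacobi identity of `P1`. The identities between signs
depend only on which indices vanish. -/
theorem penCoef_rotate (a b : ℂ) (c : ℕ → Fin 3 → ℂ) (i j k : ℕ) :
    penCoef a b c i j k = penCoef a b c j k i := by
  have h1 : eps (i + j + 1) k + eps i j = eps (j + k + 1) i + eps j k := by
    rcases i with _ | i <;> rcases j with _ | j <;> rcases k with _ | k <;> norm_num [eps]
  have h2 : eps i j * eps (i + j) k = eps j k * eps (j + k) i := by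
    rcases i with _ | i <;> rcases j with _ | j <;> rcases k with _ | k <;> norm_num [eps]
  rw [penCoef, penCoef, h1, h2, show j + k + i = i + j + k by ring]

/-- Since the coefficients are cyclically symmetric, renaming the summation indices merges the three
triple sums into one, whose general term is `kil_lie_jacobi`. -/
theorem penLin_jacobi (a b : ℂ) (x u v w : MA g) :
    pairing u (penLin a b (pen a b x w) v) + pairing v (penLin a b (pen a b x u) w)
      + pairing w (penLin a b (pen a b x v) u) = 0 := by
  have hr : ∀ f : Fin (g + 1) → Fin (g + 1) → Fin (g + 1) → ℂ,
      ∑ i, ∑ j, ∑ k, f i j k = ∑ i, ∑ j, ∑ k, f j k i := fun f => by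
    rw [Finset.sum_comm_cycle]
  rw [pairing_penLin_pen, pairing_penLin_pen, pairing_penLin_pen,
    hr fun i j k => kil (v i) (lie (lie (penCoef a b (coef x) i j k) (u k)) (w j)),
    hr fun i j k => kil (w i) (lie (lie (penCoef a b (coef x) i j k) (v k)) (u j)),
    hr fun i j k => kil (w j) (lie (lie (penCoef a b (coef x) j k i) (v i)) (u k))]
  simp only [← Finset.sum_add_distrib]
  refine Finset.sum_eq_zero fun i _ => Finset.sum_eq_zero fun j _ => Finset.sum_eq_zero fun k _ => ?_
  rw [penCoef_rotate a b _ k i j, ← penCoef_rotate a b _ i j k]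
  exact kil_lie_jacobi _ _ _ _

/-- The linear part of the pencil as a bilinear map. -/
def penLinHom (a b : ℂ) : MA g →ₗ[ℂ] MA g →ₗ[ℂ] MA g :=
  LinearMap.mk₂ ℂ (penLin a b)
    (fun y y' w => by
      ext1 i
      simp only [penLin, Pi.add_apply, penSeq, ← Finset.sum_add_distrib]
      refine Finset.sum_congr rfl fun j _ => ?_
      simp only [coef0_add, ← lieHom_apply, map_add, LinearMap.add_apply, smul_add]
      abel)
    (fun c y w => by
      ext1 i
      rw [Pi.smul_apply]
      simp only [penLin, penSeq, Finset.smul_sum]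
      refine Finset.sum_congr rfl fun j _ => ?_
      simp only [coef0_smul, ← lieHom_apply, map_smul, LinearMap.smul_apply, smul_add]
      rw [smul_comm c b, smul_comm c (a * _)])
    (fun y w w' => by
      ext1 i
      simp only [penLin, Pi.add_apply, penSeq, ← Finset.sum_add_distrib]
      refine Finset.sum_congr rfl fun j _ => ?_
      simp only [← lieHom_apply, map_add, smul_add]
      abel)
    (fun c y w => by
      ext1 i
      rw [Pi.smul_apply]
      simp only [penLin, penSeq, Finset.smul_sum]
      refine Finset.sum_congr rfl fun j _ => ?_
      simp only [Pi.smul_apply, ← lieHom_apply, map_smul, smul_add]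
      rw [smul_comm c b, smul_comm c (a * _)])

/-- The constant part comes from the fixed top coefficient `A`; hence the derivative of the tensor
in `x` is `penLin`. -/
theorem pen_eq_add (a b : ℂ) (x w : MA g) : pen a b x w = penLin a b x w + pen a b 0 w := by
  ext1 i
  simp only [penLin, Pi.add_apply, pen_apply, penSeq, ← Finset.sum_add_distrib]
  refine Finset.sum_congr rfl fun j _ => ?_
  have hc : ∀ k, coef x k = coef0 x k + coef (0 : MA g) k := fun k => by
    rw [coef_eq_add, coef_eq_add (0 : MA g)]
    simp [coef0]
  simp only [hc, ← lieHom_apply, map_add, LinearMap.add_apply, smul_add]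
  abel

/-! ### The bracket on `MA g` -/

theorem pbr_eq (P : MA g → MA g → MA g) (F G : MA g → ℂ) (x : MA g) :
    pbr P F G x = pairing (grad (fderiv ℂ F x)) (P x (grad (fderiv ℂ G x))) := by
  rw [pbr, pairing_comm, pairing_grad]

theorem pbr_pen (a b : ℂ) (F G : MA g → ℂ) (x : MA g) :
    pbr (pen a b) F G x = a * pbr P1 F G x + b * pbr P0 F G x := by
  simp [pbr, pen]

theorem pbr_pen_skew (a b : ℂ) (F G : MA g → ℂ) (x : MA g) :
    pbr (pen a b) F G x = -pbr (pen a b) G F x := by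
  rw [pbr_eq, pairing_pen_skew, ← pbr_eq]

theorem hasFDerivAt_pbr (a b : ℂ) {F G : MA g → ℂ} (hF : Differentiable ℂ F)
    (hG : Differentiable ℂ G) (x : MA g) :
    DifferentiableAt ℂ (pbr (pen a b) F G) x ∧ ∀ y, fderiv ℂ (pbr (pen a b) F G) x y =
      fderiv ℂ (fderiv ℂ F) x y (pen a b x (grad (fderiv ℂ G x)))
      + fderiv ℂ F x (penLin a b y (grad (fderiv ℂ G x)))
      + fderiv ℂ F x (pen a b x (grad (fderiv ℂ (fderiv ℂ G) x y))) := by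
  have hdF := (differentiable_fderiv hF x).hasFDerivAt
  have hdG := (differentiable_fderiv hG x).hasFDerivAt
  let γ : (MA g →L[ℂ] ℂ) →L[ℂ] MA g := LinearMap.toContinuousLinearMap gradHom
  let L : MA g →L[ℂ] MA g →L[ℂ] MA g := (penLinHom a b).toContinuousBilinearMap
  let c : MA g →L[ℂ] MA g := LinearMap.toContinuousLinearMap (penHom a b 0)
  have e : pbr (pen a b) F G =
      fun x => fderiv ℂ F x (L x (γ (fderiv ℂ G x)) + c (γ (fderiv ℂ G x))) := by
    funext x
    rw [pbr, pen_eq_add]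
    rfl
  have h1 : HasFDerivAt (fun x => γ (fderiv ℂ G x)) (γ.comp (fderiv ℂ (fderiv ℂ G) x)) x :=
    γ.hasFDerivAt.comp x hdG
  have h2 := (L.hasFDerivAt_of_bilinear (hasFDerivAt_id x) h1).add (c.hasFDerivAt.comp x h1)
  have h3 := hdF.clm_apply h2
  rw [e]
  refine ⟨h3.differentiableAt, fun y => ?_⟩
  have h4 := congrArg (fun T => T y) h3.fderiv
  refine h4.trans ?_
  rw [pen_eq_add a b x (grad (fderiv ℂ G x)), pen_eq_add a b x (grad (fderiv ℂ (fderiv ℂ G) x y))]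
  have eL : ∀ u w, L u w = penLin a b u w := fun _ _ => rfl
  have ec : ∀ w, c w = pen a b 0 w := fun _ => rfl
  have eγ : ∀ α, γ α = grad α := fun _ => rfl
  simp only [add_apply, ContinuousLinearMap.comp_apply,
    ContinuousLinearMap.flip_apply, ContinuousLinearMap.precompR_apply,
    ContinuousLinearMap.precompL_apply, id_eq, eL, ec, eγ, map_add, ContinuousLinearMap.id_apply,
    Function.comp_apply, Pi.add_apply, ContinuousLinearMap.compL_apply]
  ring

theorem differentiable_pbr (a b : ℂ) {F G : MA g → ℂ} (hF : Differentiable ℂ F)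
    (hG : Differentiable ℂ G) : Differentiable ℂ (pbr (pen a b) F G) :=
  fun x => (hasFDerivAt_pbr a b hF hG x).1

theorem pbr_pen_leibniz (a b : ℂ) {F G K : MA g → ℂ}
    (hG : Differentiable ℂ G) (hK : Differentiable ℂ K) (x : MA g) :
    pbr (pen a b) F (fun y => G y * K y) x
      = pbr (pen a b) F G x * K x + G x * pbr (pen a b) F K x := by
  rw [pbr, pbr, pbr, fderiv_fun_mul (hG x) (hK x), ← gradHom_apply, ← gradHom_apply,
    ← gradHom_apply, map_add, map_smul, map_smul, ← penHom_apply, map_add, map_smul, map_smul,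
    map_add, map_smul, map_smul, penHom_apply, penHom_apply]
  simp only [smul_eq_mul]
  ring

/-- Each double bracket consists of two Hessian terms and one derivative of the tensor. The six
Hessian terms cancel in pairs by symmetry of second derivatives, and the other three sum to zero by
`penLin_jacobi`. -/
theorem pbr_pen_jacobi (a b : ℂ) {F G K : MA g → ℂ} (hF : Differentiable ℂ F)
    (hG : Differentiable ℂ G) (hK : Differentiable ℂ K) (x : MA g) :
    pbr (pen a b) F (pbr (pen a b) G K) x + pbr (pen a b) G (pbr (pen a b) K F) x
      + pbr (pen a b) K (pbr (pen a b) F G) x = 0 := by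
  have key : ∀ {F G K : MA g → ℂ}, Differentiable ℂ F → Differentiable ℂ G → Differentiable ℂ K →
      pbr (pen a b) F (pbr (pen a b) G K) x =
        -(fderiv ℂ (fderiv ℂ G) x (pen a b x (grad (fderiv ℂ F x)))
            (pen a b x (grad (fderiv ℂ K x)))
          + pairing (grad (fderiv ℂ G x))
            (penLin a b (pen a b x (grad (fderiv ℂ F x))) (grad (fderiv ℂ K x)))
          - fderiv ℂ (fderiv ℂ K) x (pen a b x (grad (fderiv ℂ F x)))
              (pen a b x (grad (fderiv ℂ G x)))) := by
    intro F G K hF hG hK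
    rw [pbr_pen_skew, pbr, (hasFDerivAt_pbr a b hG hK x).2, ← pairing_grad (fderiv ℂ G x),
      ← pairing_grad (fderiv ℂ G x), pairing_comm _ (grad (fderiv ℂ G x)),
      pairing_comm _ (grad (fderiv ℂ G x)), pairing_pen_skew,
      pairing_comm _ (pen a b x (grad (fderiv ℂ G x))), pairing_grad]
    ring
  rw [key hF hG hK, key hG hK hF, key hK hF hG]
  have h := penLin_jacobi a b x (grad (fderiv ℂ F x)) (grad (fderiv ℂ G x)) (grad (fderiv ℂ K x))
  rw [fderiv_fderiv_comm hG x (pen a b x (grad (fderiv ℂ F x))),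
    fderiv_fderiv_comm hK x (pen a b x (grad (fderiv ℂ F x))),
    fderiv_fderiv_comm hF x (pen a b x (grad (fderiv ℂ G x)))]
  linear_combination -h

/-! ### The gauge group -/

/-- Conjugation by `1 + t A`. -/
def gau (t : ℂ) (a : Fin 3 → ℂ) : Fin 3 → ℂ := ![a 0 - t * a 1, a 1, a 2 + 2 * t * a 0 - t ^ 2 * a 1]

theorem gau_add (s t : ℂ) (a : Fin 3 → ℂ) : gau s (gau t a) = gau (s + t) a := by
  ext i; fin_cases i <;> simp [gau] <;> ring

theorem gau_zero (a : Fin 3 → ℂ) : gau 0 a = a := by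
  ext i; fin_cases i <;> simp [gau]

theorem gau_aVec (t : ℂ) : gau t aVec = aVec := by
  ext i; fin_cases i <;> simp [gau, aVec]

theorem lie_gau (t : ℂ) (a b : Fin 3 → ℂ) : lie (gau t a) (gau t b) = gau t (lie a b) := by
  ext i; fin_cases i <;> simp [gau, lie_eq] <;> ring

theorem kil_gau (t : ℂ) (a b : Fin 3 → ℂ) : kil (gau t a) (gau t b) = kil a b := by
  simp [gau, kil]; ring

theorem lie_aVec (a : Fin 3 → ℂ) : lie aVec a = ![-a 1, 0, 2 * a 0] := by
  ext i; fin_cases i <;> simp [lie_eq, aVec]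

/-- `gau t` as a linear map. -/
def gauHom (t : ℂ) : (Fin 3 → ℂ) →ₗ[ℂ] (Fin 3 → ℂ) where
  toFun := gau t
  map_add' a b := by ext i; fin_cases i <;> simp [gau] <;> ring
  map_smul' c a := by ext i; fin_cases i <;> simp [gau] <;> ring

theorem gauHom_apply (t : ℂ) (a : Fin 3 → ℂ) : gauHom t a = gau t a := rfl

/-- The flow of the generator of the distribution `E`. -/
def gauge (t : ℂ) (x : MA g) : MA g := fun i => gau t (x i)

/-- `gauge t` as a linear map. -/
def gaugeHom (t : ℂ) : MA g →ₗ[ℂ] MA g where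
  toFun := gauge t
  map_add' a b := by ext1 i; exact (gauHom t).map_add _ _
  map_smul' c a := by ext1 i; exact (gauHom t).map_smul _ _

theorem gauge_add (s t : ℂ) (x : MA g) : gauge s (gauge t x) = gauge (s + t) x :=
  funext fun _ => gau_add _ _ _

theorem gauge_zero (x : MA g) : gauge 0 x = x := funext fun _ => gau_zero _

theorem gauge_neg_gauge (t : ℂ) (x : MA g) : gauge (-t) (gauge t x) = x := by
  rw [gauge_add, neg_add_cancel, gauge_zero]

theorem gauge_gauge_neg (t : ℂ) (x : MA g) : gauge t (gauge (-t) x) = x := by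
  rw [gauge_add, add_neg_cancel, gauge_zero]

theorem coef_gauge (t : ℂ) (x : MA g) (k : ℕ) : coef (gauge t x) k = gau t (coef x k) := by
  unfold coef
  split_ifs
  · rfl
  · rw [gau_aVec]
  · exact ((gauHom t).map_zero).symm

/-- Conjugation preserves commutators and fixes `A`, so both the linear and the constant part are
respected: the gauge group acts by Poisson maps. -/
theorem pen_gauge (a b : ℂ) (t : ℂ) (x w : MA g) :
    pen a b (gauge t x) (gauge t w) = gauge t (pen a b x w) := by
  ext1 i
  simp only [pen_apply, penSeq, gauge, ← gauHom_apply, map_sum, map_add, map_smul]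
  refine Finset.sum_congr rfl fun j _ => ?_
  have h : ∀ k, coef (fun i => gauHom t (x i)) k = gau t (coef x k) := coef_gauge t x
  simp only [gauHom_apply] at h ⊢
  rw [← lie_gau, ← lie_gau, ← h, ← h]
  rfl

theorem pairing_gauge (t : ℂ) (v w : MA g) : pairing (gauge t v) (gauge t w) = pairing v w := by
  simp [pairing_eq, gauge, kil_gau]

/-- The generator `X ↦ [A, X]` of the gauge group. -/
def gen (x : MA g) : MA g := fun i => lie aVec (x i)

theorem hasDerivAt_gau (a : Fin 3 → ℂ) (t : ℂ) :
    HasDerivAt (fun t => gau t a) (lie aVec (gau t a)) t := by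
  rw [hasDerivAt_pi]
  have h1 := hasDerivAt_id t
  intro i
  fin_cases i
  · simpa [gau, lie_aVec] using (h1.mul_const (a 1)).const_sub (a 0)
  · simpa [gau, lie_aVec] using hasDerivAt_const t (a 1)
  · have := (((h1.const_mul 2).mul_const (a 0)).const_add (a 2)).sub ((h1.pow 2).mul_const (a 1))
    refine (this.congr_deriv ?_).congr_of_eventuallyEq (Filter.Eventually.of_forall fun s => ?_)
    · simp [gau, lie_aVec]; ring
    · simp [gau]

theorem hasDerivAt_gauge (x : MA g) (t : ℂ) :
    HasDerivAt (fun t => gauge t x) (gen (gauge t x)) t :=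
  hasDerivAt_pi.2 fun i => hasDerivAt_gau (x i) t

theorem differentiable_gauge (t : ℂ) : Differentiable ℂ (gauge t : MA g → MA g) :=
  (LinearMap.toContinuousLinearMap (gaugeHom (g := g) t)).differentiable

theorem fderiv_comp_gauge {F : MA g → ℂ} (hF : Differentiable ℂ F) (t : ℂ) (x v : MA g) :
    fderiv ℂ (fun y => F (gauge t y)) x v = fderiv ℂ F (gauge t x) (gauge t v) := by
  have h := (hF (gauge t x)).hasFDerivAt.comp x
    (LinearMap.toContinuousLinearMap (gaugeHom (g := g) t)).hasFDerivAt
  exact congrArg (fun T => T v) h.fderiv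

theorem pbr_comp_gauge (a b : ℂ) {F K : MA g → ℂ} (hF : Differentiable ℂ F)
    (hK : Differentiable ℂ K) (t : ℂ) (x : MA g) :
    pbr (pen a b) (fun y => F (gauge t y)) (fun y => K (gauge t y)) x
      = pbr (pen a b) F K (gauge t x) := by
  have h : grad (fderiv ℂ (fun y => K (gauge t y)) x)
      = gauge (-t) (grad (fderiv ℂ K (gauge t x))) := by
    refine grad_eq _ _ fun v => ?_
    rw [fderiv_comp_gauge hK, ← pairing_gauge t, gauge_gauge_neg, pairing_grad]
  rw [pbr, fderiv_comp_gauge hF, h, ← pen_gauge, gauge_gauge_neg, pbr]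

/-! ### The Hamiltonians -/

/-- The polynomial with coefficients the `e`-th entries of the `X_k`. -/
def ent (x : MA g) (e : Fin 3) : ℂ[X] := ∑ k ∈ Finset.range (g + 2), monomial k (coef x k e)

theorem coeff_ent (x : MA g) (e : Fin 3) (k : ℕ) : (ent x e).coeff k = coef x k e := by
  simp only [ent, finsetSum_coeff, coeff_monomial]
  rw [Finset.sum_ite_eq' ]
  split_ifs with h
  · rfl
  · rw [coef_of_lt x (by rw [Finset.mem_range] at h; omega)]; rfl

theorem coeff_toPoly (x : MA g) (k : ℕ) : (toPoly x).coeff k = mat (coef x k) := by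
  simp only [toPoly, finsetSum_coeff, coeff_monomial]
  rw [Finset.sum_ite_eq' ]
  split_ifs with h
  · rfl
  · rw [coef_of_lt x (by rw [Finset.mem_range] at h; omega)]; ext i j; fin_cases i <;> fin_cases j <;> simp [mat]

theorem toPoly_eq (x : MA g) :
    toPoly x = matPolyEquiv !![ent x 0, ent x 1; ent x 2, -ent x 0] := by
  ext k i j
  rw [coeff_toPoly, matPolyEquiv_coeff_apply]
  fin_cases i <;> fin_cases j <;> simp [mat, coeff_ent]

theorem ham_eq_coeff (i : ℕ) (x : MA g) :
    ham i x = (ent x 0 ^ 2 + ent x 1 * ent x 2).coeff i := by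
  rw [ham, toPoly_eq, ← map_pow, Matrix.trace_fin_two, matPolyEquiv_coeff_apply,
    matPolyEquiv_coeff_apply, ← coeff_add, div_eq_iff two_ne_zero, mul_comm, two_mul, ← coeff_add]
  have e : (!![ent x 0, ent x 1; ent x 2, -ent x 0] ^ 2) 0 0
      + (!![ent x 0, ent x 1; ent x 2, -ent x 0] ^ 2) 1 1
      = (ent x 0 ^ 2 + ent x 1 * ent x 2) + (ent x 0 ^ 2 + ent x 1 * ent x 2) := by
    simp [pow_two, Matrix.mul_apply]
    ring
  rw [e]

theorem ham_eq_sum (i : ℕ) (x : MA g) :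
    ham i x = ∑ p ∈ Finset.HasAntidiagonal.antidiagonal i,
      (coef x p.1 0 * coef x p.2 0 + coef x p.1 1 * coef x p.2 2) := by
  rw [ham_eq_coeff, coeff_add, pow_two, coeff_mul, coeff_mul, ← Finset.sum_add_distrib]
  simp only [coeff_ent]

theorem ent_gauge (t : ℂ) (x : MA g) : ent (gauge t x) 0 = ent x 0 - C t * ent x 1
    ∧ ent (gauge t x) 1 = ent x 1
    ∧ ent (gauge t x) 2 = ent x 2 + C (2 * t) * ent x 0 - C (t ^ 2) * ent x 1 := by
  refine ⟨?_, ?_, ?_⟩ <;> ext k <;>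
    simp [coeff_ent, coef_gauge, gau, -map_mul, -map_pow]

theorem ham_gauge (i : ℕ) (t : ℂ) (x : MA g) : ham i (gauge t x) = ham i x := by
  obtain ⟨h0, h1, h2⟩ := ent_gauge t x
  rw [ham_eq_coeff, ham_eq_coeff, h0, h1, h2, map_mul, map_pow, map_ofNat]
  refine congrArg (fun P : ℂ[X] => P.coeff i) ?_
  ring

theorem hasFDerivAt_coef (x : MA g) (k : ℕ) (e : Fin 3) :
    DifferentiableAt ℂ (fun x : MA g => coef x k e) x ∧
      ∀ v, fderiv ℂ (fun x : MA g => coef x k e) x v = coef0 v k e := by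
  by_cases hk : k < g + 1
  · let L : MA g →L[ℂ] ℂ := (ContinuousLinearMap.proj (R := ℂ) (φ := fun _ : Fin 3 => ℂ) e).comp
      (ContinuousLinearMap.proj (R := ℂ) (φ := fun _ : Fin (g + 1) => Fin 3 → ℂ) ⟨k, hk⟩)
    have e' : (fun x : MA g => coef x k e) = L := funext fun x => by
      rw [coef, dif_pos hk]; rfl
    rw [e']
    refine ⟨L.differentiableAt, fun v => ?_⟩
    rw [L.fderiv, coef0, dif_pos hk]; rfl
  · have e' : (fun x : MA g => coef x k e) = fun _ => coef 0 k e := funext fun x => by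
      rw [coef, dif_neg hk, coef, dif_neg hk]
    rw [e']
    refine ⟨differentiableAt_const _, fun v => ?_⟩
    rw [coef0, dif_neg hk]; simp

theorem differentiable_coef (k : ℕ) (e : Fin 3) : Differentiable ℂ (fun x : MA g => coef x k e) :=
  fun x => (hasFDerivAt_coef x k e).1

theorem differentiable_ham (i : ℕ) : Differentiable ℂ (ham i : MA g → ℂ) := by
  rw [show (ham i : MA g → ℂ) = _ from funext fun x => ham_eq_sum i x]
  exact Differentiable.fun_sum fun p _ => ((differentiable_coef _ _).mul (differentiable_coef _ _)).add
    ((differentiable_coef _ _).mul (differentiable_coef _ _))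

theorem fderiv_ham (i : ℕ) (x v : MA g) : fderiv ℂ (ham i) x v =
    ∑ p ∈ Finset.HasAntidiagonal.antidiagonal i, kil (coef0 v p.1) (coef x p.2) := by
  have hd := fun k e => (hasFDerivAt_coef x k e).1
  have hv := fun k e => (hasFDerivAt_coef x k e).2 v
  rw [show (ham i : MA g → ℂ) = _ from funext fun x => ham_eq_sum i x,
    fderiv_fun_sum fun p _ => ((hd _ _).fun_mul (hd _ _)).fun_add ((hd _ _).fun_mul (hd _ _)),
    sum_apply]
  have e : ∀ p : ℕ × ℕ, fderiv ℂ (fun x : MA g => coef x p.1 0 * coef x p.2 0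
        + coef x p.1 1 * coef x p.2 2) x v = (coef0 v p.1 0 * coef x p.2 0
          + coef0 v p.1 1 * coef x p.2 2) +
        (coef x p.1 0 * coef0 v p.2 0 + coef x p.1 1 * coef0 v p.2 2) := fun p => by
    rw [fderiv_fun_add ((hd _ _).fun_mul (hd _ _)) ((hd _ _).fun_mul (hd _ _)), fderiv_fun_mul (hd _ _) (hd _ _),
      fderiv_fun_mul (hd _ _) (hd _ _)]
    simp [hv]
    ring
  simp only [e]
  rw [Finset.sum_add_distrib]
  rw [← Finset.Nat.sum_antidiagonal_swap (n := i) (f := fun p =>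
    coef x p.1 0 * coef0 v p.2 0 + coef x p.1 1 * coef0 v p.2 2), ← Finset.sum_add_distrib]
  refine Finset.sum_congr rfl fun p _ => ?_
  simp [kil]
  ring

/-- The gradient of `ham i`. -/
def hamGrad (i : ℕ) (x : MA g) : MA g := fun j => if (j : ℕ) ≤ i then coef x (i - j) else 0

theorem sum_fin_le_eq {M : Type*} [AddCommMonoid M] (i : ℕ) (f : ℕ → M)
    (hf : ∀ j, g + 1 ≤ j → f j = 0) :
    ∑ j : Fin (g + 1), (if (j : ℕ) ≤ i then f j else 0) = ∑ j ∈ Finset.range (i + 1), f j := by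
  rw [Fin.sum_univ_eq_sum_range (fun j => if j ≤ i then f j else 0), ← Finset.sum_filter]
  refine Finset.sum_subset (fun j hj => ?_) fun j hj hj' => hf j ?_
  · simp at hj ⊢; omega
  · simp at hj hj'; omega

theorem grad_ham (i : ℕ) (x : MA g) : grad (fderiv ℂ (ham i) x) = hamGrad i x := by
  refine grad_eq _ _ fun v => ?_
  rw [fderiv_ham, Finset.Nat.sum_antidiagonal_eq_sum_range_succ
    (fun a b => kil (coef0 v a) (coef x b)), pairing_eq,
    ← sum_fin_le_eq (g := g) i (fun j => kil (coef0 v j) (coef x (i - j)))]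
  · refine Finset.sum_congr rfl fun j _ => ?_
    rw [hamGrad, coef0_fin]
    split_ifs
    · rfl
    · exact ((kilHom (v j)).map_zero).symm
  · intro j hj
    rw [coef0, dif_neg (by omega)]
    simp [← kilHom_apply]

/-! ### The Lenard relations -/

/-- A partial sum of `∑_l [X_{N-l}, X_l]`. -/
def lieSum (x : MA g) (N s : ℕ) : Fin 3 → ℂ :=
  ∑ l ∈ Finset.range s, lie (coef x (N - l)) (coef x l)

/-- The full sum over `0 ≤ l ≤ N` vanishes by antisymmetry, and the reflection `l ↦ N - l` turns the
tail after `s` terms into minus the sum of the first `t` terms. -/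
theorem lieSum_eq_lieSum (x : MA g) {N s t : ℕ} (h : s + t = N + 1) :
    lieSum x N s = lieSum x N t := by
  have key : ∀ {s t : ℕ}, s + t = N + 1 → lieSum x N (N + 1) = lieSum x N s - lieSum x N t := by
    intro s t h
    have h1 : lieSum x N t = -∑ l ∈ Finset.range t, lie (coef x (N - (s + l))) (coef x (s + l)) := by
      rw [lieSum, ← Finset.sum_range_reflect, ← Finset.sum_neg_distrib]
      refine Finset.sum_congr rfl fun l hl => ?_
      rw [Finset.mem_range] at hl
      rw [lie_swap, show t - 1 - l = N - (s + l) by omega, show N - (N - (s + l)) = s + l by omega]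
    have h2 : lieSum x N (N + 1) = lieSum x N s
        + ∑ l ∈ Finset.range t, lie (coef x (N - (s + l))) (coef x (s + l)) := by
      rw [lieSum, ← h, Finset.sum_range_add]; rfl
    rw [h2, h1, sub_neg_eq_add]
  have h0 : lieSum x N (N + 1) = 0 := by
    -- With `s = 0` the identity says that the full sum equals its own opposite.
    have := key (s := 0) (t := N + 1) (by omega)
    rwa [show lieSum x N 0 = 0 from rfl, zero_sub, eq_neg_iff_add_eq_zero, ← two_smul ℂ,
      smul_eq_zero_iff_right two_ne_zero] at this
  exact sub_eq_zero.1 ((key h).symm.trans h0)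

theorem P0_hamGrad (n : ℕ) (x : MA g) (m : Fin (g + 1)) :
    P0 x (hamGrad n x) m = lieSum x (m + n + 1) (m + 1) := by
  rw [lieSum_eq_lieSum x (t := n + 1) (by omega), lieSum, ← Finset.sum_range_reflect, P0]
  have e : ∀ j : Fin (g + 1), lie (coef x (m + j + 1)) (hamGrad n x j)
      = if (j : ℕ) ≤ n then lie (coef x (m + j + 1)) (coef x (n - j)) else 0 := fun j => by
    rw [hamGrad]; split_ifs
    · rfl
    · exact lie_zero _
  simp only [e]
  rw [sum_fin_le_eq (g := g) n (fun j => lie (coef x (m + j + 1)) (coef x (n - j)))]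
  · refine Finset.sum_congr rfl fun j hj => ?_
    rw [Finset.mem_range] at hj
    rw [show (m : ℕ) + n + 1 - (n + 1 - 1 - j) = m + j + 1 by omega,
      show n + 1 - 1 - j = n - j by omega]
  · intro j hj
    rw [coef_of_lt x (by omega), zero_lie]

/-- All terms of the sum vanish by degree except the one containing `X_{g+1} = A`. This is why the
gauge direction disappears on the quotient as the `P0`-Hamiltonian field of `H_g`. -/
theorem P0_hamGrad_top (x : MA g) : P0 x (hamGrad g x) = gen x := by
  ext1 m
  rw [P0_hamGrad, lieSum, Finset.sum_range_succ, Finset.sum_eq_zero, zero_add,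
    show (m : ℕ) + g + 1 - m = g + 1 by omega, coef_top, coef_fin, gen]
  intro l hl
  rw [Finset.mem_range] at hl
  rw [coef_of_lt x (by omega), zero_lie]

theorem P0_hamGrad_of_lt (x : MA g) {n : ℕ} (hn : g < n) : P0 x (hamGrad n x) = 0 := by
  ext1 m
  rw [P0_hamGrad, lieSum]
  refine Finset.sum_eq_zero fun l hl => ?_
  rw [Finset.mem_range] at hl
  rw [coef_of_lt x (by omega), zero_lie]

/-- In the rows `i ≥ 1` the two sides differ by the shift `j ↦ j + 1`, and the term lost at `j = g`
contains `X_{i+g+1} = 0`. Row 0 is the single commutator `-[X_0, X_{n+1}]`, which agrees with the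
one-term form of the right-hand side. -/
theorem P1_hamGrad_succ (n : ℕ) (x : MA g) : P1 x (hamGrad (n + 1) x) = P0 x (hamGrad n x) := by
  ext1 m
  rw [P1]
  split_ifs with hm
  · subst hm
    rw [P0_hamGrad, lieSum]
    simp [hamGrad, ← coef_fin x 0]
    rw [lie_swap, neg_neg]
  · rw [Fin.sum_univ_succ, if_pos rfl, zero_add, P0, Fin.sum_univ_castSucc]
    have hl : lie (coef x (m + (Fin.last g : ℕ) + 1)) (hamGrad n x (Fin.last g)) = 0 := by
      have : (m : ℕ) ≠ 0 := fun h => hm (Fin.ext h)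
      rw [Fin.val_last, coef_of_lt x (show g + 1 < (m : ℕ) + g + 1 by omega), zero_lie]
    rw [hl, add_zero]
    refine Finset.sum_congr rfl fun j _ => ?_
    rw [if_neg (Fin.succ_ne_zero j)]
    simp [hamGrad, add_assoc]

theorem P1_hamGrad_zero (x : MA g) : P1 x (hamGrad 0 x) = 0 := by
  ext1 m
  rw [P1]
  split_ifs with hm
  · simp [hamGrad, ← coef_fin x 0, lie_self]
  · refine Finset.sum_eq_zero fun j _ => ?_
    split_ifs with hj
    · rfl
    · have : (j : ℕ) ≠ 0 := fun h => hj (Fin.ext h)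
      rw [hamGrad, if_neg (by omega), lie_zero]

theorem laxField_eq_sum (i : ℕ) (x : MA g) (m : Fin (g + 1)) :
    laxField i x m = lieSum x (m + (g - i)) (m + 1) := by
  have hd : ∀ n k, (divX^[n] (toPoly x)).coeff k = mat (coef x (k + n)) := fun n => by
    induction n with
    | zero => intro k; simp [coeff_toPoly]
    | succ n ih => intro k; rw [Function.iterate_succ_apply', coeff_divX, ih]; congr 2; ring
  let L : Matrix (Fin 2) (Fin 2) ℂ →+ (Fin 3 → ℂ) :=
    { toFun := ofMat, map_zero' := by ext i; fin_cases i <;> simp [ofMat]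
      map_add' := fun M N => by ext i; fin_cases i <;> simp [ofMat] }
  have hL : ∀ M, ofMat M = L M := fun _ => rfl
  have e : ∀ a b : Fin 3 → ℂ, L (mat a * mat b - mat b * mat a) = lie a b := fun _ _ => rfl
  have h1 : (divX^[g - i] (toPoly x) * toPoly x - toPoly x * divX^[g - i] (toPoly x)).coeff m
      = ∑ l ∈ Finset.range (m + 1), (mat (coef x (m + (g - i) - l)) * mat (coef x l)
        - mat (coef x l) * mat (coef x (m + (g - i) - l))) := by
    rw [coeff_sub, coeff_mul, coeff_mul,
      ← Finset.Nat.sum_antidiagonal_swap (n := (m : ℕ)) (f := fun p =>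
        (divX^[g - i] (toPoly x)).coeff p.1 * (toPoly x).coeff p.2),
      Finset.Nat.sum_antidiagonal_eq_sum_range_succ_mk,
      Finset.Nat.sum_antidiagonal_eq_sum_range_succ_mk, ← Finset.sum_sub_distrib]
    refine Finset.sum_congr rfl fun l hl => ?_
    rw [Finset.mem_range] at hl
    simp only [hd, coeff_toPoly, Prod.fst_swap, Prod.snd_swap]
    rw [show (m : ℕ) - l + (g - i) = m + (g - i) - l by omega]
  rw [laxField, hL, h1, map_sum, lieSum]
  simp only [e]

theorem laxField_eq {i : ℕ} (hi : i < g) (x : MA g) :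
    laxField i x = P0 x (hamGrad (g - 1 - i) x) := by
  ext1 m
  rw [laxField_eq_sum, P0_hamGrad, show (m : ℕ) + (g - i) = m + (g - 1 - i) + 1 by omega]

/-! ### The kernel and the image of `P0` -/

theorem eq_smul_of_lie_aVec {a : Fin 3 → ℂ} (h : lie aVec a = 0) : a = a 2 • aVec := by
  rw [lie_aVec] at h
  have h0 := congrFun h 0
  have h2 := congrFun h 2
  simp at h0 h2
  ext i; fin_cases i <;> simp [aVec, h0, h2]

/-- The last row of `P0 x w = 0` reads `[A, W_0] = 0`, so `W_0 = a A`. Row `k + 1` of `P1 x w` is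
row `k` of `P0 x w` without its term in `W_0`, hence equals `-[X_{k+1}, a A]`. -/
theorem P1_of_P0_eq_zero {x w : MA g} (h : P0 x w = 0) : ∃ a : ℂ, P1 x w = a • gen x := by
  have h0 : lie aVec (w 0) = 0 := by
    have := congrFun h (Fin.last g)
    rw [P0, Finset.sum_eq_single 0] at this
    · simpa [coef_top] using this
    · intro j _ hj
      have : (j : ℕ) ≠ 0 := fun h => hj (Fin.ext h)
      rw [coef_of_lt x (by simp; omega), zero_lie]
    · simp
  have h1 := eq_smul_of_lie_aVec h0
  refine ⟨w 0 2, ?_⟩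
  have h2 : ∀ i, lie (x i) (w 0) = -(w 0 2 • lie aVec (x i)) := fun i => by
    rw [h1, ← lieHom_apply, map_smul, lieHom_apply, lie_swap, smul_neg]
    simp [aVec]
  ext1 m
  rw [P1, Pi.smul_apply, gen]
  split_ifs with hm
  · subst hm; rw [h2, neg_neg]
  · obtain ⟨k, rfl⟩ := Fin.exists_succ_eq_of_ne_zero hm
    have h3 := congrFun h k.castSucc
    rw [P0, Fin.sum_univ_succ] at h3
    rw [Fin.sum_univ_succ, if_pos rfl, zero_add]
    have h4 : lie (coef x ((k.castSucc : Fin (g + 1)) + ((0 : Fin (g + 1)) : ℕ) + 1)) (w 0)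
        = -(w 0 2 • lie aVec (x k.succ)) := by
      rw [← h2, ← coef_fin x k.succ]; simp
    rw [h4, Pi.zero_apply, neg_add_eq_zero] at h3
    rw [h3]
    refine Finset.sum_congr rfl fun j _ => ?_
    rw [if_neg (Fin.succ_ne_zero j)]
    simp only [Fin.val_succ, Fin.val_castSucc]
    rw [show (k : ℕ) + 1 + (j + 1) = k + (j + 1) + 1 by ring]

theorem mem_distD_gen (x : MA g) (a : ℂ) : a • gen x ∈ distD x := by
  -- The differential of `H_{g+1}` is in the kernel of `P0`, and `P1` sends it to `P0 dH_g = [A,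
  -- X]`.
  refine ⟨a • hamGrad (g + 1) x, ?_, ?_⟩
  · rw [P0_eq_pen, ← penHom_apply, map_smul, penHom_apply, ← P0_eq_pen,
      P0_hamGrad_of_lt x (by omega), smul_zero]
  · rw [P1_eq_pen, ← penHom_apply, map_smul, penHom_apply, ← P1_eq_pen, P1_hamGrad_succ,
      P0_hamGrad_top]

theorem fderiv_ham_pen (a b : ℂ) (i : ℕ) (x w : MA g) :
    fderiv ℂ (ham i) x (pen a b x w) = -pairing w (pen a b x (hamGrad i x)) := by
  rw [← pairing_grad, grad_ham, pairing_comm, pairing_pen_skew]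

theorem fderiv_ham_gen (i : ℕ) (x : MA g) : fderiv ℂ (ham i) x (gen x) = 0 := by
  have h := ((differentiable_ham i (gauge 0 x)).hasFDerivAt).comp_hasDerivAt (0 : ℂ)
    (hasDerivAt_gauge x 0)
  rw [gauge_zero] at h
  rw [← h.deriv]
  have e : (ham i ∘ fun t => gauge t x) = fun _ => ham i x := funext fun t => ham_gauge i t x
  rw [e, deriv_const]

/-- Intersecting with the tangent space loses nothing: the generator preserves all the `H_i`, so `E`
equals `D` and its integral curves run along gauge orbits. -/
theorem mem_distE_iff (x v : MA g) : v ∈ distE x ↔ ∃ a : ℂ, v = a • gen x := by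
  constructor
  · rintro ⟨⟨w, hw, rfl⟩, -⟩
    exact P1_of_P0_eq_zero hw
  · rintro ⟨a, rfl⟩
    refine ⟨mem_distD_gen x a, fun i _ _ => ?_⟩
    rw [map_smul, fderiv_ham_gen, smul_zero]

theorem P0_mem_tangentS (x w : MA g) : P0 x w ∈ tangentS x := by
  intro i hi _
  rw [P0_eq_pen, fderiv_ham_pen, ← P0_eq_pen, P0_hamGrad_of_lt x (by omega), ← pairingHom_apply,
    map_zero, neg_zero]

/-- By skewness the derivative of `H_i` along `P1 x w` is `-⟨w, P1 dH_i⟩`. The Lenard relations make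
`P1 dH_i` vanish for `i > g + 1` and equal `[A, X]` for `i = g + 1`, so the only obstruction is the
pairing of `w` with the generator. -/
theorem P1_mem_tangentS {x w : MA g} (hw : pairing (gen x) w = 0) : P1 x w ∈ tangentS x := by
  intro i hi _
  obtain ⟨n, rfl⟩ : ∃ n, i = n + 1 := ⟨i - 1, by omega⟩
  rw [P1_eq_pen, fderiv_ham_pen, ← P1_eq_pen, P1_hamGrad_succ]
  rcases (show g ≤ n by omega).eq_or_lt with rfl | h
  · rw [P0_hamGrad_top, pairing_comm, hw, neg_zero]
  · rw [P0_hamGrad_of_lt x h, ← pairingHom_apply, map_zero, neg_zero]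

theorem pen_mem_tangentS (a b : ℂ) {x w : MA g} (hw : pairing (gen x) w = 0) :
    pen a b x w ∈ tangentS x := by
  intro i hi hi'
  rw [pen, map_add, map_smul, map_smul, P1_mem_tangentS hw i hi hi', P0_mem_tangentS x w i hi hi',
    smul_zero, smul_zero, add_zero]

/-- The differentials of the functions defining `leafS g`. -/
def tanMap (x : MA g) : MA g →ₗ[ℂ] (Fin (g + 1) → ℂ) :=
  LinearMap.pi fun k => (fderiv ℂ (ham (g + 1 + k)) x : MA g →ₗ[ℂ] ℂ)

theorem mem_ker_tanMap (x v : MA g) : v ∈ LinearMap.ker (tanMap x) ↔ v ∈ tangentS x := by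
  rw [LinearMap.mem_ker, funext_iff]
  constructor
  · intro h i hi hi'
    have := h ⟨i - (g + 1), by omega⟩
    simp only [tanMap, LinearMap.pi_apply, Nat.add_sub_cancel' hi] at this
    exact this
  · intro h k
    exact h _ (by omega) (by omega)

/-- Varying only the entries `r_j` already suffices: since the top coefficient of `q` is 1, the
resulting square matrix is triangular with unit diagonal. -/
theorem tanMap_surjective (x : MA g) : Function.Surjective (tanMap x) := by
  let J : (Fin (g + 1) → ℂ) →ₗ[ℂ] MA g :=
    { toFun := fun s j => ![0, s j, 0]
      map_add' := fun s t => by ext j e; fin_cases e <;> simp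
      map_smul' := fun c s => by ext j e; fin_cases e <;> simp }
  have hinj : Function.Injective (tanMap x ∘ₗ J) := by
    rw [← LinearMap.ker_eq_bot, LinearMap.ker_eq_bot']
    intro s hs
    by_contra hne
    -- With `k` the largest index in the support of `s`, the equation for `H_{g+1+k}` reduces to `s
    -- k = 0`: smaller indices meet vanishing coefficients of `X`, larger ones vanishing `s j`.
    obtain ⟨k, hk, hmax⟩ : ∃ k, s k ≠ 0 ∧ ∀ j, k < j → s j = 0 := by
      obtain ⟨k0, hk0⟩ := Function.ne_iff.1 hne
      have hS : (Finset.univ.filter fun j => s j ≠ 0).Nonempty := ⟨k0, by simpa using hk0⟩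
      refine ⟨_, (Finset.mem_filter.1 (Finset.max'_mem _ hS)).2, fun j hj => ?_⟩
      by_contra h
      exact absurd (Finset.le_max' _ j (by simpa using h)) (not_le.2 hj)
    refine hk ?_
    have h := congrFun hs k
    have h' : fderiv ℂ (ham (g + 1 + k)) x (J s) = 0 := h
    rw [← pairing_grad, grad_ham, pairing_eq, Finset.sum_eq_single k] at h'
    · simpa [J, kil, hamGrad, coef_top, aVec] using h'
    · intro j _ hj
      rcases lt_or_gt_of_ne hj with h | h
      · have h'' : (j : ℕ) < k := h
        rw [hamGrad, if_pos (by omega), coef_of_lt x (by omega), ← kilHom_apply, map_zero]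
      · simp [J, kil, hmax j h]
    · simp
  have hsurj := LinearMap.injective_iff_surjective.1 hinj
  exact Function.Surjective.of_comp hsurj

theorem finrank_MA : Module.finrank ℂ (MA g) = 3 * g + 3 := by
  rw [Module.finrank_pi_fintype]; simp; ring

theorem finrank_ker_tanMap (x : MA g) : Module.finrank ℂ (LinearMap.ker (tanMap x)) = 2 * g + 2 := by
  have h := LinearMap.finrank_range_add_finrank_ker (tanMap x)
  rw [LinearMap.range_eq_top.2 (tanMap_surjective x), finrank_top, finrank_MA] at h
  simp at h
  omega

/-- The image lies in the kernel of the `g + 1` differentials because those `H_i` are Casimirs of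
`P0`. Equality follows by dimension: a covector in the kernel of `P0` is determined by its `g + 1`
entries of index 2, so the rank is at least `2g + 2`. -/
theorem range_P0 (x : MA g) : LinearMap.range (penHom 0 1 x) = LinearMap.ker (tanMap x) := by
  refine Submodule.eq_of_le_of_finrank_le ?_ ?_
  · rintro _ ⟨w, rfl⟩
    rw [mem_ker_tanMap, penHom_apply, ← P0_eq_pen]
    exact P0_mem_tangentS x w
  · have h := LinearMap.finrank_range_add_finrank_ker (penHom 0 1 x)
    rw [finrank_MA] at h
    have hk : Module.finrank ℂ (LinearMap.ker (penHom 0 1 x)) ≤ g + 1 := by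
      let K : LinearMap.ker (penHom 0 1 x) →ₗ[ℂ] (Fin (g + 1) → ℂ) :=
        { toFun := fun w j => w.1 j 2, map_add' := fun _ _ => rfl, map_smul' := fun _ _ => rfl }
      have hK : Function.Injective K := by
        rw [← LinearMap.ker_eq_bot, LinearMap.ker_eq_bot']
        rintro ⟨w, hw⟩ hs
        have hs' : ∀ j, w j 2 = 0 := fun j => congrFun hs j
        rw [LinearMap.mem_ker, penHom_apply, ← P0_eq_pen] at hw
        -- Row `g - n` involves `w_n` only through `[A, w_n]`, and otherwise only the `w_j` with `j
        -- < n`.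
        have : ∀ n (hn : n < g + 1), w ⟨n, hn⟩ = 0 := by
          intro n
          induction n using Nat.strong_induction_on with
          | _ n ih =>
            intro hn
            have h1 := congrFun hw ⟨g - n, by omega⟩
            rw [P0, Finset.sum_eq_single ⟨n, hn⟩] at h1
            · simp only [show g - n + n + 1 = g + 1 by omega, coef_top] at h1
              rw [eq_smul_of_lie_aVec h1, hs', zero_smul]
            · intro j _ hj
              have hj' : (j : ℕ) ≠ n := fun h => hj (Fin.ext h)
              rcases lt_or_gt_of_ne hj' with h | h
              · rw [show w j = 0 from ih j h j.2, lie_zero]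
              · rw [coef_of_lt x (by simp; omega), zero_lie]
            · simp
        refine Subtype.ext (funext fun j => this j j.2)
      simpa using LinearMap.finrank_le_finrank_of_injective hK
    rw [finrank_ker_tanMap]
    omega

/-! ### Orders of Laurent series -/

/-- The series `a` is `O(z ^ (-n))`. -/
def Dec (n : ℤ) (a : Lau) : Prop := ∀ m < n, a.coeff m = 0

theorem Dec.mono {m n : ℤ} {a : Lau} (h : Dec n a) (hmn : m ≤ n) : Dec m a :=
  fun k hk => h k (by omega)

theorem Dec.add {n : ℤ} {a b : Lau} (ha : Dec n a) (hb : Dec n b) : Dec n (a + b) :=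
  fun k hk => by rw [HahnSeries.coeff_add, ha k hk, hb k hk, add_zero]

theorem Dec.sub {n : ℤ} {a b : Lau} (ha : Dec n a) (hb : Dec n b) : Dec n (a - b) :=
  fun k hk => by rw [HahnSeries.coeff_sub, ha k hk, hb k hk, sub_zero]

theorem dec_zero (n : ℤ) : Dec n 0 := fun _ _ => HahnSeries.coeff_zero

theorem dec_iff_le_orderTop {n : ℤ} {a : Lau} : Dec n a ↔ (n : WithTop ℤ) ≤ a.orderTop := by
  rw [HahnSeries.le_orderTop_iff_forall]
  simp only [Dec, WithTop.coe_lt_coe]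

theorem Dec.mul {m n : ℤ} {a b : Lau} (ha : Dec m a) (hb : Dec n b) : Dec (m + n) (a * b) := by
  rw [dec_iff_le_orderTop] at *
  rw [HahnSeries.orderTop_mul, WithTop.coe_add]
  exact add_le_add ha hb

theorem coeff_single_mul' (m n : ℤ) (c : ℂ) (a : Lau) :
    (HahnSeries.single m c * a).coeff n = c * a.coeff (n - m) := by
  rw [HahnSeries.coeff_single_mul]

theorem Dec.coeff_mul {m n : ℤ} {a b : Lau} (ha : Dec m a) (hb : Dec n b) :
    (a * b).coeff (m + n) = a.coeff m * b.coeff n := by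
  have h1 : Dec (m + 1) (a - HahnSeries.single m (a.coeff m)) := by
    intro k hk
    rw [HahnSeries.coeff_sub]
    rcases eq_or_ne k m with rfl | hne
    · rw [HahnSeries.coeff_single_same, sub_self]
    · rw [HahnSeries.coeff_single_of_ne hne, ha k (by omega), sub_zero]
  have h2 := (h1.mul hb) (m + n) (by omega)
  rw [sub_mul, HahnSeries.coeff_sub, coeff_single_mul', sub_eq_zero] at h2
  rw [h2, add_sub_cancel_left]

/-- Division by a series of exact order `m`; it turns estimates on products such as `(w + w')(h -
h')` into estimates on a factor. -/
theorem Dec.of_mul {m n : ℤ} {a b : Lau} (ha : Dec m a) (hm : a.coeff m ≠ 0)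
    (hab : Dec (m + n) (a * b)) : Dec n b := by
  have ho : a.orderTop = m :=
    le_antisymm (HahnSeries.orderTop_le_of_coeff_ne_zero hm) (dec_iff_le_orderTop.1 ha)
  rw [dec_iff_le_orderTop] at *
  rw [HahnSeries.orderTop_mul, ho, WithTop.coe_add] at hab
  exact (WithTop.add_le_add_iff_left WithTop.coe_ne_top).1 hab

theorem z_pow (k : ℕ) : z ^ k = HahnSeries.single (-(k : ℤ)) (1 : ℂ) := by
  rw [z, HahnSeries.single_pow]; simp

theorem coeff_z_pow (k : ℕ) (n : ℤ) : (z ^ k).coeff n = if n = -k then 1 else 0 := by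
  rw [z_pow, HahnSeries.coeff_single]
  split_ifs <;> rfl

theorem dec_z_pow (k : ℕ) : Dec (-k) (z ^ k) := fun n hn => by
  rw [coeff_z_pow, if_neg (by omega)]

theorem coeff_z_pow_mul (k : ℕ) (a : Lau) (n : ℤ) : (z ^ k * a).coeff n = a.coeff (n + k) := by
  rw [z_pow, coeff_single_mul', one_mul, sub_neg_eq_add]

theorem coeff_con (c : ℂ) (n : ℤ) : (con c).coeff n = if n = 0 then c else 0 := by
  simp [con, HahnSeries.C_apply, HahnSeries.coeff_single]

theorem coeff_con_mul (c : ℂ) (a : Lau) (n : ℤ) : (con c * a).coeff n = c * a.coeff n := by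
  rw [con, HahnSeries.C_mul_eq_smul, HahnSeries.coeff_smul, smul_eq_mul]

theorem dec_con (c : ℂ) : Dec 0 (con c) := fun n hn => by rw [coeff_con, if_neg (by omega)]

theorem Dec.con_mul {n : ℤ} {a : Lau} (c : ℂ) (ha : Dec n a) : Dec n (con c * a) :=
  fun k hk => by rw [coeff_con_mul, ha k hk, mul_zero]

theorem atZ2_monomial (k : ℕ) (c : ℂ) : atZ2 (monomial k c) = con c * z ^ (2 * k) := by
  simp [pow_mul]

theorem coeff_atZ2_even (P : ℂ[X]) (k : ℕ) : (atZ2 P).coeff (-(2 * k : ℤ)) = P.coeff k := by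
  induction P using Polynomial.induction_on' with
  | add p q hp hq => rw [map_add, HahnSeries.coeff_add, hp, hq, coeff_add]
  | monomial n c =>
    rw [atZ2_monomial, coeff_con_mul, coeff_z_pow, coeff_monomial]
    by_cases h : n = k
    · subst h; simp
    · rw [if_neg (by push_cast; omega), if_neg h, mul_zero]

theorem coeff_atZ2_of_ne (P : ℂ[X]) (n : ℤ) (hn : ∀ k : ℕ, n ≠ -(2 * k)) : (atZ2 P).coeff n = 0 := by
  induction P using Polynomial.induction_on' with
  | add p q hp hq => rw [map_add, HahnSeries.coeff_add, hp, hq, add_zero]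
  | monomial k c =>
    have := hn k
    rw [atZ2_monomial, coeff_con_mul, coeff_z_pow, if_neg (by push_cast; omega), mul_zero]

theorem dec_atZ2 (P : ℂ[X]) (d : ℤ) (h : ∀ k : ℕ, d < k → P.coeff k = 0) :
    Dec (-(2 * d)) (atZ2 P) := by
  intro n hn
  by_cases hk : ∃ k : ℕ, n = -(2 * k)
  · obtain ⟨k, rfl⟩ := hk
    rw [coeff_atZ2_even, h k (by omega)]
  · push Not at hk
    exact coeff_atZ2_of_ne P n hk

/-- Polynomials in `z²` meet `O(1/z)` only in zero; this repeatedly turns asymptotic equalities into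
exact ones. -/
theorem eq_zero_of_dec_atZ2 {P : ℂ[X]} (h : Dec 1 (atZ2 P)) : P = 0 := by
  ext k
  rw [← coeff_atZ2_even, h _ (by omega), coeff_zero]

/-! ### Properties of the currents and of the Lax matrices -/

theorem cs2Space.dec {h : Lau} (hh : h ∈ cs2Space) : Dec 1 (h - z) := fun n hn => hh n (by omega)

theorem dec_cur {h : Lau} (hh : h ∈ cs2Space) {k : ℕ} (hk : 1 ≤ k) : Dec 1 (cur h k - z ^ k) := by
  have e : cur h 1 = h := by simp [cur]
  have h1 := (mem_cs2Set_iff (cur h)).2 ⟨by rwa [e], by rw [e]⟩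
  exact fun n hn => h1.1.2 k hk n (by omega)

theorem cs2Space.dec_neg_one {h : Lau} (hh : h ∈ cs2Space) : Dec (-1) h := by
  have := (dec_z_pow 1).add ((cs2Space.dec hh).mono (show (-1 : ℤ) ≤ 1 by norm_num))
  simpa using this

theorem cs2Space.coeff_neg_one {h : Lau} (hh : h ∈ cs2Space) : h.coeff (-1) = 1 := by
  have := cs2Space.dec hh (-1) (by norm_num)
  rw [HahnSeries.coeff_sub, sub_eq_zero] at this
  rw [this, z, HahnSeries.coeff_single_same]

theorem dec_cur_neg {h : Lau} (hh : h ∈ cs2Space) {k : ℕ} (hk : 1 ≤ k) :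
    Dec (-k) (cur h k) ∧ (cur h k).coeff (-k) = 1 := by
  have h1 := dec_cur hh hk
  constructor
  · have := (dec_z_pow k).add (h1.mono (show (-k : ℤ) ≤ 1 by omega))
    simpa using this
  · have := h1 (-k) (by omega)
    rw [HahnSeries.coeff_sub, coeff_z_pow, if_pos rfl, sub_eq_zero] at this
    exact this

/-- With `h = z + v`, `cur h j = z^j + u` and `u, v = O(1/z)`, the part of `h * cur h j` with
nonnegative powers is `z^(j+1) + ∑ h_l z^(j-l) + u_1`. The remaining terms of the field have exactly
this nonnegative part. -/
theorem dec_cs2Field {h : Lau} (hh : h ∈ cs2Space) {j : ℕ} (hj : 1 ≤ j) : Dec 1 (cs2Field h j) := by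
  have hu := dec_cur hh hj
  have hv := cs2Space.dec hh
  have c1 : cur h 1 = h := by simp [cur]
  have c0 : cur h 0 = 1 := by simp [cur]
  have hs : Dec 1 (∑ l ∈ Finset.Icc 1 j, con (h.coeff l) * cur h (j - l)
      - ∑ l ∈ Finset.Icc 1 j, con (h.coeff l) * z ^ (j - l)) := by
    rw [← Finset.sum_sub_distrib]
    refine Finset.sum_induction _ (Dec 1) (fun _ _ => Dec.add) (dec_zero 1) fun l hl => ?_
    rw [← mul_sub]
    refine Dec.con_mul _ ?_
    rcases Nat.eq_zero_or_pos (j - l) with h0 | h0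
    · rw [h0, c0, pow_zero, sub_self]; exact dec_zero 1
    · exact dec_cur hh h0
  have ht : Dec 1 (∑ l ∈ Finset.Icc 1 j, con (h.coeff l) * z ^ (j - l) - z ^ j * (h - z)) := by
    intro n hn
    rw [HahnSeries.coeff_sub, HahnSeries.coeff_sum, coeff_z_pow_mul]
    simp only [coeff_con_mul, coeff_z_pow]
    by_cases h1 : n + j ≤ 0
    · rw [hv _ (by omega), sub_zero]
      refine Finset.sum_eq_zero fun l hl => ?_
      rw [Finset.mem_Icc] at hl
      rw [if_neg (by omega), mul_zero]
    · obtain ⟨l, hl⟩ : ∃ l : ℕ, n + j = l := ⟨(n + j).toNat, by omega⟩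
      rw [Finset.sum_eq_single l]
      · rw [if_pos (by omega), hl, HahnSeries.coeff_sub, z, HahnSeries.coeff_single_of_ne (by omega)]
        ring
      · intro l' hl' hne
        rw [Finset.mem_Icc] at hl'
        rw [if_neg (by omega), mul_zero]
      · intro hl'
        rw [Finset.mem_Icc] at hl'
        omega
  have hw : Dec 1 ((cur h j - z ^ j) * z - con ((cur h j).coeff 1)) := by
    intro n hn
    have e : ((cur h j - z ^ j) * z).coeff n = (cur h j - z ^ j).coeff (n + 1) := by
      have := coeff_z_pow_mul 1 (cur h j - z ^ j) n
      rw [mul_comm]; simpa using this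
    rw [HahnSeries.coeff_sub, e, coeff_con]
    rcases eq_or_ne n 0 with rfl | h0
    · rw [if_pos rfl, HahnSeries.coeff_sub, coeff_z_pow, if_neg (by omega)]; simp
    · rw [if_neg h0, hu _ (by omega), sub_zero]
  have hx : Dec 1 ((cur h j - z ^ j) * (h - z)) := (hu.mul hv).mono (by norm_num)
  have e : cs2Field h j = (cur h (j + 1) - z ^ (j + 1)) + (∑ l ∈ Finset.Icc 1 j,
      con (h.coeff l) * cur h (j - l) - ∑ l ∈ Finset.Icc 1 j, con (h.coeff l) * z ^ (j - l))
      + (∑ l ∈ Finset.Icc 1 j, con (h.coeff l) * z ^ (j - l) - z ^ j * (h - z))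
      - ((cur h j - z ^ j) * z - con ((cur h j).coeff 1)) - (cur h j - z ^ j) * (h - z) := by
    rw [cs2Field, csField, c1]
    simp only [Finset.Icc_self, Finset.sum_singleton, Nat.sub_self, c0, Nat.cast_one]
    ring
  rw [e]
  exact ((((dec_cur hh (by omega)).add hs).add ht).sub hw).sub hx

theorem coeff_pPoly_of_lt (h : Lau) (k n : ℕ) (hn : k < 2 * n) : (pPoly h k).coeff n = 0 := by
  induction k using Nat.strong_induction_on generalizing n with
  | _ k ih =>
    match k, ih with
    | 0, _ => rw [pPoly, coeff_one, if_neg (by omega)]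
    | 1, _ => simp [pPoly]
    | k + 2, ih =>
      obtain ⟨n, rfl⟩ : ∃ m, n = m + 1 := ⟨n - 1, by omega⟩
      rw [pPoly, coeff_sub, coeff_X_mul, ih k (by omega) n (by omega), coeff_C_succ, sub_zero]

theorem coeff_pPoly_even (h : Lau) (n : ℕ) : (pPoly h (2 * n)).coeff n = 1 := by
  induction n with
  | zero => simp [pPoly]
  | succ n ih =>
    rw [show 2 * (n + 1) = 2 * n + 2 by ring, pPoly, coeff_sub, coeff_X_mul, ih, coeff_C_succ,
      sub_zero]

/-- With `n = g` this places the Lax matrix on the slice `p_g = 0`. -/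
theorem coeff_pPoly_odd (h : Lau) (n : ℕ) : (pPoly h (2 * n + 1)).coeff n = 0 := by
  induction n with
  | zero => simp [pPoly]
  | succ n ih =>
    rw [show 2 * (n + 1) + 1 = 2 * n + 1 + 2 by ring, pPoly, coeff_sub, coeff_X_mul, ih,
      coeff_C_succ, sub_zero]

theorem coeff_qPoly_of_lt (h : Lau) (k n : ℕ) (hn : k < 2 * n + 1) : (qPoly h k).coeff n = 0 := by
  induction k using Nat.strong_induction_on generalizing n with
  | _ k ih =>
    match k, ih with
    | 0, _ => simp [qPoly]
    | 1, _ => rw [qPoly, coeff_one, if_neg (by omega)]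
    | k + 2, ih =>
      obtain ⟨n, rfl⟩ : ∃ m, n = m + 1 := ⟨n - 1, by omega⟩
      rw [qPoly, coeff_sub, coeff_X_mul, ih k (by omega) n (by omega), coeff_C_succ, sub_zero]

theorem lax_00 (h : Lau) (j : ℕ) : lax h j 0 0 = pPoly h j := rfl
theorem lax_01 (h : Lau) (j : ℕ) : lax h j 0 1 = qPoly h j := rfl
theorem lax_10 (h : Lau) (j : ℕ) : lax h j 1 0 = pPoly h (j + 1)
    + ∑ l ∈ Finset.Icc 1 j, C (h.coeff (l : ℤ)) * pPoly h (j - l) + C ((cur h j).coeff 1) := rfl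

theorem coeff_lax_10 (h : Lau) (k n : ℕ) (hn : k < n) :
    (lax h (2 * k + 1) 1 0).coeff n = (pPoly h (2 * k + 2)).coeff n := by
  rw [lax_10, coeff_add, coeff_add, coeff_C_of_ne_zero (by omega), add_zero, finsetSum_coeff,
    Finset.sum_eq_zero, add_zero]
  intro l hl
  rw [Finset.mem_Icc] at hl
  rw [coeff_C_mul, coeff_pPoly_of_lt _ _ _ (by omega), mul_zero]

theorem dec_lax_01 (h : Lau) (k : ℕ) : Dec (-(2 * k)) (atZ2 (lax h (2 * k + 1) 0 1)) :=
  dec_atZ2 _ k fun n hn => by rw [lax_01, coeff_qPoly_of_lt _ _ _ (by omega)]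

/-- Elimination of `h` between the two rows of the Lax relation: a characteristic equation for the
current, with the vector field as an extra term. -/
theorem lax_quadratic (h : Lau) (j : ℕ) :
    atZ2 (lax h j 0 1) * cs2Field h j + cur h j ^ 2 - atZ2 (lax h j 0 0 + lax h j 1 1) * cur h j
      + atZ2 (lax h j 0 0 * lax h j 1 1 - lax h j 0 1 * lax h j 1 0) = 0 := by
  obtain ⟨h1, h2⟩ := lax_spec h j
  simp only [map_add, map_mul, map_sub]
  linear_combination (atZ2 (lax h j 0 1)) * h2 + (cur h j - atZ2 (lax h j 1 1)) * h1

theorem coeff_cur_sq {h : Lau} (hh : h ∈ cs2Space) {j : ℕ} (hj : 1 ≤ j) {n : ℤ} (hn : n < 1 - j) :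
    (cur h j ^ 2).coeff n = if n = -(2 * j) then 1 else 0 := by
  have hu := dec_cur hh hj
  have e : cur h j ^ 2 = z ^ (2 * j) + z ^ j * (cur h j - z ^ j)
      + (cur h j - z ^ j) * cur h j := by ring
  rw [e, HahnSeries.coeff_add, HahnSeries.coeff_add, ((dec_z_pow j).mul hu) n (by omega),
    (hu.mul (dec_cur_neg hh hj).1) n (by omega), coeff_z_pow]
  push_cast
  rw [add_zero, add_zero]

/-- A nonzero trace of degree `e` would give the product of trace and current a leading term of odd
exponent `2e + j`. In `lax_quadratic` nothing can cancel it: the determinant has only even powers,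
the square of the current is `z^(2j) + O(z^(j-1))`, and the term with the vector field is
`O(z^(2k-1))`. -/
theorem lax_trace {h : Lau} (hh : h ∈ cs2Space) (k : ℕ) :
    lax h (2 * k + 1) 1 1 = -lax h (2 * k + 1) 0 0 := by
  set j := 2 * k + 1 with hj
  rw [eq_neg_iff_add_eq_zero, add_comm]
  by_contra hT
  set T := lax h j 0 0 + lax h j 1 1 with hTd
  set e := T.natDegree
  have h1 : Dec (-(2 * e)) (atZ2 T) := dec_atZ2 T e fun n hn =>
    coeff_eq_zero_of_natDegree_lt (by omega)
  obtain ⟨h2, h3⟩ := dec_cur_neg hh (show 1 ≤ j by omega)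
  have h4 := h1.coeff_mul h2
  rw [coeff_atZ2_even, h3, mul_one] at h4
  have h5 : T.coeff e ≠ 0 := by
    rw [coeff_natDegree]; exact leadingCoeff_ne_zero.2 hT
  refine h5 (h4.symm.trans ?_)
  have h6 : atZ2 T * cur h j = atZ2 (lax h j 0 1) * cs2Field h j + cur h j ^ 2
      + atZ2 (lax h j 0 0 * lax h j 1 1 - lax h j 0 1 * lax h j 1 0) := by
    linear_combination -(lax_quadratic h j)
  rw [h6, HahnSeries.coeff_add, HahnSeries.coeff_add, coeff_atZ2_of_ne _ _ (by omega),
    ((dec_lax_01 h k).mul (dec_cs2Field hh (show 1 ≤ j by omega))) _ (by omega),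
    coeff_cur_sq hh (by omega) (by omega), if_neg (by omega)]
  simp

/-! ### The point of `MA g` given by the Lax matrix -/

/-- The point of `MA g` with `X(λ) = V⁽²ᵍ⁺¹⁾`. -/
def laxPt (g : ℕ) (h : Lau) : MA g := fun m =>
  ![(lax h (2 * g + 1) 0 0).coeff m, (lax h (2 * g + 1) 0 1).coeff m,
    (lax h (2 * g + 1) 1 0).coeff m]

theorem ent_laxPt (h : Lau) : ent (laxPt g h) 0 = lax h (2 * g + 1) 0 0 ∧
    ent (laxPt g h) 1 = lax h (2 * g + 1) 0 1 ∧ ent (laxPt g h) 2 = lax h (2 * g + 1) 1 0 := by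
  refine ⟨?_, ?_, ?_⟩ <;> ext n <;> rw [coeff_ent, coef] <;> split_ifs with h1 h2 <;>
    first | rfl | skip
  · rw [lax_00, coeff_pPoly_of_lt _ _ _ (by omega)]; simp [aVec]
  · rw [lax_00, coeff_pPoly_of_lt _ _ _ (by omega)]; rfl
  · rw [lax_01, coeff_qPoly_of_lt _ _ _ (by omega)]; simp [aVec]
  · rw [lax_01, coeff_qPoly_of_lt _ _ _ (by omega)]; rfl
  · rw [coeff_lax_10 _ _ _ (by omega), h2, show 2 * g + 2 = 2 * (g + 1) by ring, coeff_pPoly_even]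
    simp [aVec]
  · rw [coeff_lax_10 _ _ _ (by omega), coeff_pPoly_of_lt _ _ _ (by omega)]; rfl

theorem toPoly_laxPt {h : Lau} (hh : h ∈ cs2Space) :
    toPoly (laxPt g h) = matPolyEquiv (lax h (2 * g + 1)) := by
  obtain ⟨h0, h1, h2⟩ := ent_laxPt (g := g) h
  rw [toPoly_eq, h0, h1, h2, ← lax_trace hh]
  congr 1

/-- For zero trace `lax_quadratic` gives `p² + r q` as the square of the current plus `r ∂h`, that
is `z^(4g+2) + O(z^(2g))`. Stationarity plays no role here. -/
theorem ham_laxPt {h : Lau} (hh : h ∈ cs2Space) {i : ℕ} (hi : g + 1 ≤ i) :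
    ham i (laxPt g h) = if i = 2 * g + 1 then 1 else 0 := by
  obtain ⟨h0, h1, h2⟩ := ent_laxPt (g := g) h
  rw [ham_eq_coeff, h0, h1, h2, ← coeff_atZ2_even]
  have hq := lax_quadratic h (2 * g + 1)
  rw [lax_trace hh, add_neg_cancel, map_zero, zero_mul, sub_zero] at hq
  have e : atZ2 (lax h (2 * g + 1) 0 0 ^ 2 + lax h (2 * g + 1) 0 1 * lax h (2 * g + 1) 1 0)
      = atZ2 (lax h (2 * g + 1) 0 1) * cs2Field h (2 * g + 1) + cur h (2 * g + 1) ^ 2 := by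
    simp only [map_sub, map_mul, map_add, map_pow, map_neg] at hq ⊢
    linear_combination -hq
  rw [e, HahnSeries.coeff_add,
    ((dec_lax_01 h g).mul (dec_cs2Field hh (show 1 ≤ 2 * g + 1 by omega))) _ (by omega),
    coeff_cur_sq hh (by omega) (by push_cast; omega), zero_add]
  split_ifs <;> first | rfl | omega

theorem laxPt_mem {h : Lau} (hh : h ∈ cs2Space) : laxPt g h ∈ leafS g :=
  ⟨by rw [ham_laxPt hh (by omega), if_pos rfl],
    fun i hi hi' => by rw [ham_laxPt hh hi, if_neg (by omega)]⟩

theorem laxPt_last (h : Lau) : laxPt g h (Fin.last g) 0 = 0 := by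
  simp [laxPt, lax_00, coeff_pPoly_odd]

/-- The equation satisfied by `h` in terms of its Lax matrix. -/
theorem lax_equation {h : Lau} (hh : h ∈ cs2Space) :
    atZ2 (ent (laxPt g h) 1) * h ^ 2 + 2 * atZ2 (ent (laxPt g h) 0) * h
      = atZ2 (ent (laxPt g h) 2) - cs2Field h (2 * g + 1) := by
  obtain ⟨h0, h1, h2⟩ := ent_laxPt (g := g) h
  obtain ⟨s1, s2⟩ := lax_spec h (2 * g + 1)
  rw [lax_trace hh, map_neg] at s2
  rw [h0, h1, h2]
  linear_combination s2 - h * s1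

theorem cur_eq_ent (h : Lau) : cur h (2 * g + 1)
    = atZ2 (ent (laxPt g h) 0) + atZ2 (ent (laxPt g h) 1) * h := by
  obtain ⟨h0, h1, -⟩ := ent_laxPt (g := g) h
  rw [h0, h1]
  exact (lax_spec h (2 * g + 1)).1

/-- Difference of the two quadratic equations with common `p`, `r`, `q`; the factor `2p + r(h + h')`
is the sum of the two currents. -/
theorem sub_mul_of_laxPt_eq {h h' : Lau} (hh : h ∈ cs2Space) (hh' : h' ∈ cs2Space)
    (e : laxPt g h = laxPt g h') : (cur h (2 * g + 1) + cur h' (2 * g + 1)) * (h - h')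
      = cs2Field h' (2 * g + 1) - cs2Field h (2 * g + 1) := by
  have h1 := lax_equation (g := g) hh
  have h2 := lax_equation (g := g) hh'
  rw [cur_eq_ent h, cur_eq_ent h']
  rw [e] at h1 ⊢
  linear_combination h1 - h2

theorem dec_cur_add {h h' : Lau} (hh : h ∈ cs2Space) (hh' : h' ∈ cs2Space) :
    Dec (-(2 * g + 1)) (cur h (2 * g + 1) + cur h' (2 * g + 1)) ∧
      (cur h (2 * g + 1) + cur h' (2 * g + 1)).coeff (-(2 * g + 1)) = 2 := by
  obtain ⟨h1, h2⟩ := dec_cur_neg hh (show 1 ≤ 2 * g + 1 by omega)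
  obtain ⟨h3, h4⟩ := dec_cur_neg hh' (show 1 ≤ 2 * g + 1 by omega)
  push_cast at h1 h2 h3 h4
  refine ⟨h1.add h3, ?_⟩
  rw [HahnSeries.coeff_add, h2, h4]
  norm_num

/-- The sum of the currents has exact order `z^(2g+1)` and the right-hand side is `O(1/z)`. Hence
the Lax matrix determines `h_1, …, h_{2g+1}` even for non-stationary `h`. -/
theorem dec_sub_of_laxPt_eq {h h' : Lau} (hh : h ∈ cs2Space) (hh' : h' ∈ cs2Space)
    (e : laxPt g h = laxPt g h') : Dec (2 * g + 2) (h - h') := by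
  obtain ⟨h1, h2⟩ := dec_cur_add (g := g) hh hh'
  refine h1.of_mul (by rw [h2]; norm_num) ?_
  rw [sub_mul_of_laxPt_eq hh hh' e]
  exact ((dec_cs2Field hh' (by omega)).sub (dec_cs2Field hh (by omega))).mono (by omega)

theorem eq_of_laxPt_eq {h h' : Lau} (hh : h ∈ kdvSpace g) (hh' : h' ∈ kdvSpace g)
    (e : laxPt g h = laxPt g h') : h = h' := by
  have h1 := sub_mul_of_laxPt_eq hh.1 hh'.1 e
  rw [hh.2, hh'.2, sub_zero, mul_eq_zero] at h1
  rcases h1 with h1 | h1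
  · have := (dec_cur_add (g := g) hh.1 hh'.1).2
    rw [h1] at this
    simp at this
  · exact sub_eq_zero.1 h1

/-- Each step of the recursion multiplies by `z²` and so loses two orders; the correction
coefficients agree for as long as the bound still covers the indices 1 and 2. -/
theorem dec_cur_sub {h h' : Lau} (hh : h ∈ cs2Space) {N : ℕ} (hd : Dec (N + 1) (h - h')) (k : ℕ) :
    Dec (N + 2 - k) (cur h k - cur h' k) := by
  induction k using Nat.strong_induction_on with
  | _ k ih =>
    match k, ih with
    | 0, _ => simp [cur]; exact dec_zero _
    | 1, _ => simp only [cur]; exact hd.mono (by push_cast; omega)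
    | k + 2, ih =>
      have h0 := ih k (by omega)
      have e : cur h (k + 2) - cur h' (k + 2) = z ^ 2 * (cur h k - cur h' k)
          - con ((cur h k - cur h' k).coeff 1) * h - con ((cur h' k).coeff 1) * (h - h')
          - con ((cur h k - cur h' k).coeff 2) := by
        rw [cur, cur, HahnSeries.coeff_sub, HahnSeries.coeff_sub, map_sub, map_sub]
        ring
      rw [e]
      refine Dec.sub (Dec.sub (Dec.sub ?_ ?_) ?_) ?_
      · exact ((dec_z_pow 2).mul h0).mono (by push_cast; omega)
      · by_cases hk : k ≤ N
        · rw [h0 1 (by omega), map_zero, zero_mul]; exact dec_zero _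
        · exact (Dec.con_mul _ (cs2Space.dec_neg_one hh)).mono (by push_cast; omega)
      · exact (Dec.con_mul _ hd).mono (by push_cast; omega)
      · by_cases hk : k < N
        · rw [h0 2 (by omega), map_zero]; exact dec_zero _
        · exact (dec_con _).mono (by push_cast; omega)

theorem pPoly_congr {h h' : Lau} (hh : h ∈ cs2Space) {N : ℕ} (hd : Dec (N + 1) (h - h')) (k : ℕ)
    (hk : k ≤ N + 1) : pPoly h k = pPoly h' k := by
  induction k using Nat.strong_induction_on with
  | _ k ih =>
    match k, ih with
    | 0, _ => rfl
    | 1, _ => rfl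
    | k + 2, ih =>
      have := dec_cur_sub hh hd k 2 (by omega)
      rw [HahnSeries.coeff_sub, sub_eq_zero] at this
      rw [pPoly, pPoly, ih k (by omega) (by omega), this]

theorem qPoly_congr {h h' : Lau} (hh : h ∈ cs2Space) {N : ℕ} (hd : Dec (N + 1) (h - h')) (k : ℕ)
    (hk : k ≤ N + 2) : qPoly h k = qPoly h' k := by
  induction k using Nat.strong_induction_on with
  | _ k ih =>
    match k, ih with
    | 0, _ => rfl
    | 1, _ => rfl
    | k + 2, ih =>
      have := dec_cur_sub hh hd k 1 (by omega)
      rw [HahnSeries.coeff_sub, sub_eq_zero] at this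
      rw [qPoly, qPoly, ih k (by omega) (by omega), this]

theorem laxPt_congr {h h' : Lau} (hh : h ∈ cs2Space) (hd : Dec (2 * g + 2) (h - h')) :
    laxPt g h = laxPt g h' := by
  have hd' : Dec ((2 * g + 1 : ℕ) + 1) (h - h') := hd.mono (by push_cast; omega)
  have h1 : lax h (2 * g + 1) 1 0 = lax h' (2 * g + 1) 1 0 := by
    have hc := dec_cur_sub hh hd' (2 * g + 1) 1 (by push_cast; omega)
    rw [HahnSeries.coeff_sub, sub_eq_zero] at hc
    rw [lax_10, lax_10, pPoly_congr hh hd' _ (by omega), hc]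
    congr 2
    refine Finset.sum_congr rfl fun l hl => ?_
    rw [Finset.mem_Icc] at hl
    have hl' := hd l (by omega)
    rw [HahnSeries.coeff_sub, sub_eq_zero] at hl'
    rw [pPoly_congr hh hd' _ (by omega), hl']
  unfold laxPt
  rw [h1, lax_00, lax_00, lax_01, lax_01, pPoly_congr hh hd' _ (by omega),
    qPoly_congr hh hd' _ (by omega)]

/-! ### Reconstruction of `h` from a point of the slice -/

/-- The leading power of `Q h` is odd whereas `P` has only even powers, so they cannot cancel. This
gives uniqueness of the first row of a Lax matrix. -/
theorem eq_zero_of_dec_add {h : Lau} (hh : h ∈ cs2Space) {P Q : ℂ[X]}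
    (hd : Dec 1 (atZ2 P + atZ2 Q * h)) : P = 0 ∧ Q = 0 := by
  have hQ : Q = 0 := by
    by_contra hQ
    have h1 : Dec (-(2 * Q.natDegree)) (atZ2 Q) := dec_atZ2 Q _ fun n hn =>
      coeff_eq_zero_of_natDegree_lt (by omega)
    have h2 := h1.coeff_mul (cs2Space.dec_neg_one hh)
    have h3 := hd (-(2 * Q.natDegree) + -1) (by omega)
    rw [HahnSeries.coeff_add, h2, coeff_atZ2_even, cs2Space.coeff_neg_one hh,
      coeff_atZ2_of_ne _ _ (by omega), zero_add, mul_one, coeff_natDegree] at h3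
    exact hQ (leadingCoeff_eq_zero.1 h3)
  refine ⟨eq_zero_of_dec_atZ2 ?_, hQ⟩
  rwa [hQ, map_zero, zero_mul, add_zero] at hd

/-- By degrees, the only surviving product in `H_{2g+1}` is `r_g q_{g+1}`, and `q_{g+1} = 1`. -/
theorem leafS_ent_one {x : MA g} (hx : x ∈ leafS g) : x (Fin.last g) 1 = 1 := by
  have h := hx.1
  rw [ham_eq_sum, Finset.sum_eq_single ((g, g + 1) : ℕ × ℕ)] at h
  · have e : coef x g = x (Fin.last g) := coef_fin x (Fin.last g)
    rw [coef_top, e] at h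
    simpa [aVec] using h
  · rintro ⟨a, b⟩ hab hne
    rw [Finset.HasAntidiagonal.mem_antidiagonal] at hab
    simp only at hab
    rcases lt_trichotomy a g with h1 | h1 | h1
    · rw [coef_of_lt x (show g + 1 < b by omega)]; simp
    · exact absurd (by rw [h1, show b = g + 1 by omega]) hne
    · rcases (show g + 1 ≤ a by omega).eq_or_lt with h2 | h2
      · rw [← h2, coef_top]; simp [aVec]
      · rw [coef_of_lt x h2]; simp
  · intro hn
    exact absurd (Finset.HasAntidiagonal.mem_antidiagonal.2 (show g + (g + 1) = 2 * g + 1 by omega)) hn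

theorem mem_kdvSpace_of_equation {x : MA g} (hx : x ∈ leafS g) (hx0 : x (Fin.last g) 0 = 0) {h : Lau}
    (hh : h ∈ cs2Space) (he : atZ2 (ent x 1) * h ^ 2 + 2 * atZ2 (ent x 0) * h = atZ2 (ent x 2)) :
    h ∈ kdvSpace g ∧ laxPt g h = x := by
  have hr : ∀ n : ℕ, g < n → (ent x 1).coeff n = 0 := fun n hn => by
    rw [coeff_ent]
    rcases (show g + 1 ≤ n by omega).eq_or_lt with h2 | h2
    · rw [← h2, coef_top]; simp [aVec]
    · rw [coef_of_lt x h2]; simp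
  have hp : ∀ n : ℕ, (g : ℤ) - 1 < n → (ent x 0).coeff n = 0 := fun n hn => by
    rw [coeff_ent]
    rcases (show g ≤ n by omega).eq_or_lt with h2 | h2
    · rw [← h2, ← hx0]; exact congrFun (coef_fin x (Fin.last g)) 0
    · rcases (show g + 1 ≤ n by omega).eq_or_lt with h2 | h2
      · rw [← h2, coef_top]; simp [aVec]
      · rw [coef_of_lt x h2]; simp
  have hR : Dec (-(2 * g)) (atZ2 (ent x 1)) := dec_atZ2 _ g fun n hn => hr n (by omega)
  have hP : Dec (-(2 * (g - 1))) (atZ2 (ent x 0)) := dec_atZ2 _ (g - 1) hp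
  have hRg : (ent x 1).coeff g = 1 := by
    rw [coeff_ent, ← leafS_ent_one hx]; exact congrFun (coef_fin x (Fin.last g)) 1
  set w := atZ2 (ent x 0) + atZ2 (ent x 1) * h with hw
  have hRh := hR.mul (cs2Space.dec_neg_one hh)
  have hRh1 := hR.coeff_mul (cs2Space.dec_neg_one hh)
  rw [coeff_atZ2_even, hRg, cs2Space.coeff_neg_one hh, one_mul] at hRh1
  have hwd : Dec (-(2 * g) + -1) w := (hP.mono (by omega)).add hRh
  have hw1 : w.coeff (-(2 * g) + -1) = 1 := by
    rw [hw, HahnSeries.coeff_add, hRh1, hP _ (by omega), zero_add]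
  have hz := dec_z_pow (2 * g + 1)
  have hz1 := coeff_z_pow (2 * g + 1) (-(2 * g) + -1)
  rw [if_pos (by push_cast; ring)] at hz1
  have hsum : Dec (-(2 * g) + -1) (w + z ^ (2 * g + 1)) := hwd.add (hz.mono (by push_cast; omega))
  -- The equation gives `w² = p² + r q`, which is `λ^(2g+1) + O(λ^g)` on `leafS g`. Dividing the
  -- difference of squares by `w + z^(2g+1)`, of exact order `z^(2g+1)`, leaves `O(1/z)`.
  have hdiff : Dec 1 (w - z ^ (2 * g + 1)) := by
    refine hsum.of_mul (by rw [HahnSeries.coeff_add, hw1, hz1]; norm_num) ?_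
    have e : (w + z ^ (2 * g + 1)) * (w - z ^ (2 * g + 1))
        = atZ2 (ent x 0 ^ 2 + ent x 1 * ent x 2 - X ^ (2 * g + 1)) := by
      have e1 : atZ2 (X ^ (2 * g + 1)) = z ^ (2 * g + 1) * z ^ (2 * g + 1) := by
        simp [← pow_mul]; ring
      rw [map_sub, map_add, map_pow, map_mul, e1, hw]
      linear_combination (atZ2 (ent x 1)) * he
    rw [e]
    refine (dec_atZ2 _ g fun n hn => ?_).mono (by omega)
    rw [coeff_sub, ← ham_eq_coeff, coeff_X_pow]
    rcases lt_trichotomy n (2 * g + 1) with h1 | h1 | h1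
    · rw [hx.2 n (by omega) (by omega), if_neg (by omega), sub_zero]
    · rw [h1, hx.1, if_pos rfl, sub_self]
    · rw [if_neg (by omega), sub_zero, ham_eq_sum]
      refine Finset.sum_eq_zero fun p hp' => ?_
      have hp'' := Finset.HasAntidiagonal.mem_antidiagonal.1 hp'
      have h0 : coef x p.1 0 * coef x p.2 0 = 0 := by
        rw [← coeff_ent, ← coeff_ent]
        rcases lt_or_ge (g : ℤ) p.1 with h2 | h2
        · rw [hp _ (by omega), zero_mul]
        · rw [hp p.2 (by omega), mul_zero]
      have h1' : coef x p.1 1 * coef x p.2 2 = 0 := by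
        rcases lt_or_ge g p.1 with h2 | h2
        · rw [← coeff_ent, hr _ h2, zero_mul]
        · rw [coef_of_lt x (show g + 1 < p.2 by omega)]; simp
      rw [h0, h1', add_zero]
  have hcur := dec_cur hh (show 1 ≤ 2 * g + 1 by omega)
  -- Both `w` and the current are `z^(2g+1) + O(1/z)`, so their representations through `1` and `h`
  -- coincide.
  have h3 : Dec 1 (atZ2 (ent x 0 - ent (laxPt g h) 0) + atZ2 (ent x 1 - ent (laxPt g h) 1) * h) := by
    have e : atZ2 (ent x 0 - ent (laxPt g h) 0) + atZ2 (ent x 1 - ent (laxPt g h) 1) * h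
        = (w - z ^ (2 * g + 1)) - (cur h (2 * g + 1) - z ^ (2 * g + 1)) := by
      rw [cur_eq_ent (g := g), hw, map_sub, map_sub]
      ring
    rw [e]
    exact hdiff.sub hcur
  obtain ⟨h4, h5⟩ := eq_zero_of_dec_add hh h3
  rw [sub_eq_zero] at h4 h5
  have h6 := lax_equation (g := g) hh
  rw [← h4, ← h5, he] at h6
  -- The field is `O(1/z)` and also a polynomial in `z²`, hence zero; this yields stationarity and
  -- the last entry at once.
  have h7 : cs2Field h (2 * g + 1) = atZ2 (ent (laxPt g h) 2 - ent x 2) := by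
    rw [map_sub]; linear_combination h6
  have h8 := eq_zero_of_dec_atZ2 (h7 ▸ dec_cs2Field hh (show 1 ≤ 2 * g + 1 by omega))
  refine ⟨⟨hh, by rw [h7, h8, map_zero]⟩, ?_⟩
  rw [sub_eq_zero] at h8
  ext m e
  rw [← coef_fin (laxPt g h), ← coef_fin x, ← coeff_ent, ← coeff_ent]
  fin_cases e
  · exact congrArg (fun P => P.coeff (m : ℕ)) h4.symm
  · exact congrArg (fun P => P.coeff (m : ℕ)) h5.symm
  · exact congrArg (fun P => P.coeff (m : ℕ)) h8

/-! ### A fixed point theorem for formal power series -/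

theorem PowerSeries_eq_of_forall_dvd {R : Type*} [CommRing R] {k k' : PowerSeries R}
    (h : ∀ n : ℕ, PowerSeries.X ^ n ∣ k - k') : k = k' := by
  rw [← sub_eq_zero]
  ext n
  exact PowerSeries.X_pow_dvd_iff.1 (h (n + 1)) n (Nat.lt_succ_self n)

/-- Existence of a solution of `2 k = d + X (u k² + v k)` in formal power series. -/
theorem exists_powerSeries_solution {R : Type*} [CommRing R] [Algebra ℂ R] (d u v : PowerSeries R) :
    ∃ k : PowerSeries R, 2 * k = d + PowerSeries.X * (u * k ^ 2 + v * k) := by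
  set c : PowerSeries R := PowerSeries.C (algebraMap ℂ R (1 / 2)) with hc
  have hc2 : 2 * c = 1 := by
    have h2 : (2 : PowerSeries R) = PowerSeries.C (algebraMap ℂ R 2) := by
      rw [map_ofNat, map_ofNat]
    rw [hc, h2, ← map_mul, ← map_mul]
    norm_num
  -- `T` is a contraction for the `X`-adic topology: the factor `X` gains one order at each
  -- application.
  set T : PowerSeries R → PowerSeries R := fun k => c * (d + PowerSeries.X * (u * k ^ 2 + v * k))
  have hT : ∀ (k k' : PowerSeries R) (n : ℕ), PowerSeries.X ^ n ∣ k - k' →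
      PowerSeries.X ^ (n + 1) ∣ T k - T k' := by
    rintro k k' n ⟨q, hq⟩
    refine ⟨c * (u * (k + k') + v) * q, ?_⟩
    simp only [T]
    linear_combination c * PowerSeries.X * (u * (k + k') + v) * hq
  set S : ℕ → PowerSeries R := fun n => T^[n] 0 with hS
  have hS1 : ∀ n, S (n + 1) = T (S n) := fun n => Function.iterate_succ_apply' T n 0
  have h1 : ∀ n, PowerSeries.X ^ n ∣ S (n + 1) - S n := by
    intro n
    induction n with
    | zero => simp
    | succ n ih => rw [hS1 (n + 1), hS1 n]; rw [hS1 n] at ih; exact hT _ _ n ih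
  have h2 : ∀ n m, PowerSeries.X ^ n ∣ S (n + m) - S n := by
    intro n m
    induction m with
    | zero => simp
    | succ m ih =>
      have := (pow_dvd_pow (PowerSeries.X : PowerSeries R) (show n ≤ n + m by omega)).trans (h1 (n + m))
      have h3 := dvd_add this ih
      rwa [sub_add_sub_cancel] at h3
  -- The coefficient of index `n` no longer changes from the iterate `n + 1` onwards.
  set k : PowerSeries R := PowerSeries.mk fun n => PowerSeries.coeff n (S (n + 1)) with hk
  have h3 : ∀ n, PowerSeries.X ^ n ∣ k - S n := by
    intro n
    rw [PowerSeries.X_pow_dvd_iff]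
    intro i hi
    obtain ⟨m, rfl⟩ : ∃ m, n = i + 1 + m := ⟨n - (i + 1), by omega⟩
    have := PowerSeries.X_pow_dvd_iff.1 (h2 (i + 1) m) i (Nat.lt_succ_self i)
    rw [map_sub, sub_eq_zero] at this ⊢
    rw [this, hk, PowerSeries.coeff_mk]
  have h4 : T k = k := by
    refine PowerSeries_eq_of_forall_dvd fun n => ?_
    have h5 := (hT _ _ n (h3 n)).trans (dvd_refl _)
    rw [← hS1] at h5
    have h6 := dvd_sub h5 (h3 (n + 1))
    rw [sub_sub_sub_cancel_right] at h6
    exact (pow_dvd_pow _ (Nat.le_succ n)).trans h6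
  refine ⟨k, ?_⟩
  have h5 : 2 * k = 2 * T k := by rw [h4]
  rw [h5]
  simp only [T]
  linear_combination (d + PowerSeries.X * (u * k ^ 2 + v * k)) * hc2

/-! ### The coefficients of the equation for `h` -/

section Series

variable {R : Type*} [CommRing R]

/-- The power series of `r(λ) / λ ^ g - 1`, divided by `z⁻¹`. -/
def serR (g : ℕ) (s : ℕ → Fin 3 → R) : PowerSeries R :=
  ∑ i ∈ Finset.range g, PowerSeries.C (s i 1) * PowerSeries.X ^ (2 * (g - i) - 1)

/-- The power series of `p(λ) / λ ^ g`. -/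
def serP (g : ℕ) (s : ℕ → Fin 3 → R) : PowerSeries R :=
  ∑ i ∈ Finset.range g, PowerSeries.C (s i 0) * PowerSeries.X ^ (2 * (g - i))

/-- The power series of `q(λ) / λ ^ g - r(λ) / λ ^ (g - 1)`. -/
def serQ (g : ℕ) (s : ℕ → Fin 3 → R) : PowerSeries R :=
  ∑ i ∈ Finset.range (g + 1), PowerSeries.C (s i 2) * PowerSeries.X ^ (2 * (g - i))
    - ∑ i ∈ Finset.range g, PowerSeries.C (s i 1) * PowerSeries.X ^ (2 * (g - 1 - i))

theorem map_ser {R' : Type*} [CommRing R'] (f : R →+* R') (s : ℕ → Fin 3 → R) :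
    PowerSeries.map f (serR g s) = serR g (fun i e => f (s i e)) ∧
    PowerSeries.map f (serP g s) = serP g (fun i e => f (s i e)) ∧
    PowerSeries.map f (serQ g s) = serQ g (fun i e => f (s i e)) := by
  refine ⟨?_, ?_, ?_⟩ <;> simp [serR, serP, serQ]

theorem constantCoeff_serP (s : ℕ → Fin 3 → R) : PowerSeries.constantCoeff (serP g s) = 0 := by
  rw [serP, map_sum]
  refine Finset.sum_eq_zero fun i hi => ?_
  rw [Finset.mem_range] at hi
  rw [map_mul, map_pow, PowerSeries.constantCoeff_X, zero_pow (by omega), mul_zero]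

end Series

/-- The inclusion of the power series in `z⁻¹`. -/
abbrev hat : PowerSeries ℂ →+* Lau := HahnSeries.ofPowerSeries ℤ ℂ

theorem hat_X_mul_z : hat PowerSeries.X * z = 1 := by
  rw [HahnSeries.ofPowerSeries_X, z, HahnSeries.single_mul_single]
  simp

theorem hat_C (c : ℂ) : hat (PowerSeries.C c) = con c := HahnSeries.ofPowerSeries_C c

theorem coeff_hat (K : PowerSeries ℂ) (n : ℕ) : (hat K).coeff n = PowerSeries.coeff n K :=
  HahnSeries.ofPowerSeries_apply_coeff K n

theorem coeff_hat_neg (K : PowerSeries ℂ) {n : ℤ} (hn : n < 0) : (hat K).coeff n = 0 := by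
  rw [HahnSeries.ofPowerSeries_apply]
  refine HahnSeries.embDomain_of_notMem_range ?_
  rintro ⟨m, hm⟩
  simp at hm
  omega

theorem z_pow_mul_hat_X_pow {m n : ℕ} (h : n ≤ m) :
    z ^ m * hat (PowerSeries.X ^ n) = z ^ (m - n) := by
  obtain ⟨k, rfl⟩ := Nat.exists_eq_add_of_le h
  rw [map_pow, pow_add, mul_right_comm, ← mul_pow, mul_comm z, hat_X_mul_z, one_pow, one_mul,
    Nat.add_sub_cancel_left]

theorem hat_serR (s : ℕ → Fin 3 → ℂ) : z ^ (2 * g) * hat (PowerSeries.X * serR g s)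
    = ∑ i ∈ Finset.range g, con (s i 1) * z ^ (2 * i) := by
  rw [serR, Finset.mul_sum, map_sum, Finset.mul_sum]
  refine Finset.sum_congr rfl fun i hi => ?_
  rw [Finset.mem_range] at hi
  rw [mul_left_comm, ← pow_succ', map_mul, hat_C, mul_left_comm, z_pow_mul_hat_X_pow (by omega),
    show 2 * g - (2 * (g - i) - 1 + 1) = 2 * i by omega]

theorem hat_serP (s : ℕ → Fin 3 → ℂ) : z ^ (2 * g) * hat (serP g s)
    = ∑ i ∈ Finset.range g, con (s i 0) * z ^ (2 * i) := by
  rw [serP, map_sum, Finset.mul_sum]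
  refine Finset.sum_congr rfl fun i hi => ?_
  rw [Finset.mem_range] at hi
  rw [map_mul, hat_C, mul_left_comm, z_pow_mul_hat_X_pow (by omega),
    show 2 * g - (2 * (g - i)) = 2 * i by omega]

theorem hat_serQ (s : ℕ → Fin 3 → ℂ) : z ^ (2 * g) * hat (serQ g s)
    = ∑ i ∈ Finset.range (g + 1), con (s i 2) * z ^ (2 * i)
      - z ^ 2 * ∑ i ∈ Finset.range g, con (s i 1) * z ^ (2 * i) := by
  rw [serQ, map_sub, mul_sub, map_sum, map_sum, Finset.mul_sum, Finset.mul_sum, Finset.mul_sum]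
  congr 1
  · refine Finset.sum_congr rfl fun i hi => ?_
    rw [Finset.mem_range] at hi
    rw [map_mul, hat_C, mul_left_comm, z_pow_mul_hat_X_pow (by omega),
      show 2 * g - (2 * (g - i)) = 2 * i by omega]
  · refine Finset.sum_congr rfl fun i hi => ?_
    rw [Finset.mem_range] at hi
    rw [map_mul, hat_C, mul_left_comm, z_pow_mul_hat_X_pow (by omega),
      show 2 * g - (2 * (g - 1 - i)) = 2 + 2 * i by omega, pow_add, mul_left_comm]

/-! ### The series `h` as a function on `MA g` -/

variable (g) in
/-- The algebra of entire functions on `MA g`. -/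
def entAlg : Subalgebra ℂ (MA g → ℂ) where
  carrier := {f | Differentiable ℂ f}
  mul_mem' := fun ha hb => Differentiable.mul ha hb
  add_mem' := fun ha hb => Differentiable.add ha hb
  algebraMap_mem' c := differentiable_const c

/-- Evaluation of entire functions. -/
def evalEnt (x : MA g) : entAlg g →+* ℂ := (Pi.evalRingHom (fun _ => ℂ) x).comp (entAlg g).val.toRingHom

theorem evalEnt_apply (x : MA g) (f : entAlg g) : evalEnt x f = f.1 x := rfl

/-- The representative with `p_g = 0` of a gauge orbit. -/
def red (x : MA g) : MA g := gauge (x (Fin.last g) 0) x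

theorem coef_red (x : MA g) (k : ℕ) : coef (red x) k = gau (coef x g 0) (coef x k) := by
  rw [red, coef_gauge, ← coef_fin x (Fin.last g), Fin.val_last]

/-- The entries of `red x` as entire functions. -/
def redCoef (i : ℕ) (e : Fin 3) : entAlg g :=
  ⟨fun x => coef (red x) i e, by
    have h := fun k e => differentiable_coef (g := g) k e
    simp only [coef_red]
    fin_cases e
    · exact (h i 0).sub ((h g 0).mul (h i 1))
    · exact h i 1
    · exact ((h i 2).add (((h g 0).const_mul 2).mul (h i 0))).sub (((h g 0).pow 2).mul (h i 1))⟩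

/-- This is `r h² + 2 p h = q` on the slice with `h = z + k`, divided by `z^(2g+1)` and written in
`X = 1/z`. The `z²` terms cancel because `serQ` already has `z² r` subtracted from `q`. -/
theorem exists_serK (g : ℕ) : ∃ k : PowerSeries (entAlg g), 2 * k =
    (PowerSeries.X * serQ g redCoef - 2 * serP g redCoef) + PowerSeries.X *
      (-(1 + PowerSeries.X * serR g redCoef) * k ^ 2
        + (-2 * serP g redCoef - 2 * serR g redCoef) * k) :=
  exists_powerSeries_solution _ _ _

variable (g) in
/-- The power series `h - z`, with entire coefficients. -/
def serK : PowerSeries (entAlg g) := (exists_serK g).choose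

theorem serK_spec (g : ℕ) : 2 * serK g =
    (PowerSeries.X * serQ g redCoef - 2 * serP g redCoef) + PowerSeries.X *
      (-(1 + PowerSeries.X * serR g redCoef) * serK g ^ 2
        + (-2 * serP g redCoef - 2 * serR g redCoef) * serK g) :=
  (exists_serK g).choose_spec

/-- The power series `h - z` at a point. -/
def serKAt (x : MA g) : PowerSeries ℂ := PowerSeries.map (evalEnt x) (serK g)

/-- The series `h` of a point of `leafS g`. -/
def hSer (x : MA g) : Lau := z + hat (serKAt x)

theorem serKAt_spec (x : MA g) : 2 * serKAt x =
    (PowerSeries.X * serQ g (coef (red x)) - 2 * serP g (coef (red x))) + PowerSeries.X *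
      (-(1 + PowerSeries.X * serR g (coef (red x))) * serKAt x ^ 2
        + (-2 * serP g (coef (red x)) - 2 * serR g (coef (red x))) * serKAt x) := by
  have h := congrArg (PowerSeries.map (evalEnt x)) (serK_spec g)
  obtain ⟨h1, h2, h3⟩ := map_ser (g := g) (evalEnt x) redCoef
  simp only [map_add, map_mul, map_sub, map_pow, map_neg, map_one, map_ofNat, PowerSeries.map_X,
    h1, h2, h3] at h
  exact h

theorem hSer_mem (x : MA g) : hSer x ∈ cs2Space := by
  intro n hn
  rw [hSer, add_sub_cancel_left]
  rcases hn.eq_or_lt with rfl | hn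
  · rw [show (0 : ℤ) = ((0 : ℕ) : ℤ) from rfl, coeff_hat, PowerSeries.coeff_zero_eq_constantCoeff]
    have h := congrArg PowerSeries.constantCoeff (serKAt_spec x)
    simp only [map_add, map_mul, map_sub, PowerSeries.constantCoeff_X, constantCoeff_serP, zero_mul,
      mul_zero, sub_zero, add_zero, map_ofNat] at h
    exact (mul_eq_zero.1 h).resolve_left two_ne_zero
  · exact coeff_hat_neg _ hn

theorem red_mem {x : MA g} (hx : x ∈ leafS g) : red x ∈ leafS g :=
  ⟨by rw [red, ham_gauge, hx.1], fun i hi hi' => by rw [red, ham_gauge, hx.2 i hi hi']⟩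

theorem red_last {x : MA g} (hx : x ∈ leafS g) : red x (Fin.last g) 0 = 0 := by
  simp [red, gauge, gau, leafS_ent_one hx]

theorem atZ2_ent (y : MA g) (e : Fin 3) :
    atZ2 (ent y e) = ∑ i ∈ Finset.range (g + 2), con (coef y i e) * z ^ (2 * i) := by
  rw [ent, map_sum]
  exact Finset.sum_congr rfl fun i _ => atZ2_monomial _ _

theorem atZ2_ent_slice {y : MA g} (h1 : y (Fin.last g) 1 = 1) (h0 : y (Fin.last g) 0 = 0) :
    atZ2 (ent y 0) = z ^ (2 * g) * hat (serP g (coef y)) ∧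
    atZ2 (ent y 1) = z ^ (2 * g) * (1 + hat (PowerSeries.X * serR g (coef y))) ∧
    atZ2 (ent y 2) = z ^ (2 * g) * hat (serQ g (coef y)) + z ^ 2 * atZ2 (ent y 1) := by
  have hg : ∀ e, coef y g e = y (Fin.last g) e := fun e => congrFun (coef_fin y (Fin.last g)) e
  have e1 : atZ2 (ent y 1) = z ^ (2 * g) * (1 + hat (PowerSeries.X * serR g (coef y))) := by
    rw [mul_add, mul_one, hat_serR, atZ2_ent, Finset.sum_range_succ, Finset.sum_range_succ, hg, h1,
      coef_top]
    simp [aVec, add_comm]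
  refine ⟨?_, e1, ?_⟩
  · rw [hat_serP, atZ2_ent, Finset.sum_range_succ, Finset.sum_range_succ, hg, h0, coef_top]
    simp [aVec]
  · rw [e1, mul_add, hat_serQ, hat_serR, atZ2_ent, Finset.sum_range_succ, coef_top]
    simp only [aVec, Matrix.cons_val, map_one]
    ring

theorem hSer_spec {x : MA g} (hx : x ∈ leafS g) : hSer x ∈ kdvSpace g ∧ laxPt g (hSer x) = red x := by
  refine mem_kdvSpace_of_equation (red_mem hx) (red_last hx) (hSer_mem x) ?_
  obtain ⟨h0, h1, h2⟩ := atZ2_ent_slice (leafS_ent_one (red_mem hx)) (red_last hx)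
  have h := congrArg hat (serKAt_spec x)
  have hz := hat_X_mul_z
  simp only [map_add, map_mul, map_sub, map_pow, map_neg, map_one, map_ofNat] at h h0 h1 h2
  rw [h2, h1, h0, hSer]
  generalize hat (serKAt x) = k at *
  generalize hat (serP g (coef (red x))) = p at *
  generalize hat (serQ g (coef (red x))) = q at *
  generalize hat (serR g (coef (red x))) = r at *
  generalize hat PowerSeries.X = ζ at *
  linear_combination z ^ (2 * g) * z * h + z ^ (2 * g) * (2 * r * k + q
    + (-(1 + ζ * r) * k ^ 2 + (-2 * p - 2 * r) * k)) * hz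

/-! ### The global coordinates -/

/-- The series with prescribed first coefficients and vanishing others. -/
def hTr {N : ℕ} (c : Fin N → ℂ) : Lau := z + ∑ l : Fin N, HahnSeries.single ((l : ℤ) + 1) (c l)

theorem coeff_hTr {N : ℕ} (c : Fin N → ℂ) (n : ℤ) :
    (hTr c).coeff n = z.coeff n + ∑ l : Fin N, if n = (l : ℤ) + 1 then c l else 0 := by
  rw [hTr, HahnSeries.coeff_add, HahnSeries.coeff_sum]
  simp only [HahnSeries.coeff_single]
  congr 1
  refine Finset.sum_congr rfl fun l _ => ?_
  split_ifs <;> rfl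

theorem hTr_mem {N : ℕ} (c : Fin N → ℂ) : hTr c ∈ cs2Space := by
  intro n hn
  rw [HahnSeries.coeff_sub, coeff_hTr, add_sub_cancel_left]
  exact Finset.sum_eq_zero fun l _ => if_neg (by omega)

theorem coeff_z_of_pos {n : ℤ} (hn : 0 ≤ n) : z.coeff n = 0 := by
  rw [z, HahnSeries.coeff_single_of_ne (by omega)]

theorem coords_hTr {N : ℕ} (c : Fin N → ℂ) : coords N (hTr c) = c := by
  funext l
  rw [coords, coeff_hTr, coeff_z_of_pos (by omega), zero_add, Finset.sum_eq_single l]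
  · simp
  · intro m _ hm
    rw [if_neg]
    intro h
    exact hm (Fin.ext (by omega))
  · simp

theorem dec_sub_iff_coords {h h' : Lau} (hh : h ∈ cs2Space) (hh' : h' ∈ cs2Space) (N : ℕ) :
    Dec (N + 1) (h - h') ↔ coords N h = coords N h' := by
  constructor
  · intro hd
    funext l
    have := hd (l + 1) (by omega)
    rwa [HahnSeries.coeff_sub, sub_eq_zero] at this
  · intro hc n hn
    rcases le_or_gt n 0 with h0 | h0
    · have e : h - h' = (h - z) - (h' - z) := by ring
      rw [e, HahnSeries.coeff_sub, hh n h0, hh' n h0, sub_zero]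
    · have := congrFun hc ⟨(n - 1).toNat, by omega⟩
      simp only [coords] at this
      rw [show (((n - 1).toNat : ℕ) : ℤ) + 1 = n by omega] at this
      rw [HahnSeries.coeff_sub, this, sub_self]

/-! ### Holomorphic dependence of the Lax matrix on `h_1, …, h_N` -/

theorem differentiable_coeff_hTr {N : ℕ} (n : ℤ) :
    Differentiable ℂ (fun c : Fin N → ℂ => (hTr c).coeff n) := by
  simp only [coeff_hTr]
  refine (differentiable_const _).add (Differentiable.fun_sum fun l _ => ?_)
  split_ifs
  · exact differentiable_apply l
  · exact differentiable_const _

theorem differentiable_coeff_cur {N : ℕ} (k : ℕ) (n : ℤ) :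
    Differentiable ℂ (fun c : Fin N → ℂ => (cur (hTr c) k).coeff n) := by
  induction k using Nat.strong_induction_on generalizing n with
  | _ k ih =>
    match k, ih with
    | 0, _ => simp only [cur]; exact differentiable_const _
    | 1, _ => simp only [cur]; exact differentiable_coeff_hTr n
    | k + 2, ih =>
      simp only [cur, HahnSeries.coeff_sub, coeff_z_pow_mul, coeff_con_mul, coeff_con]
      refine ((ih k (by omega) _).sub ((ih k (by omega) _).mul (differentiable_coeff_hTr n))).sub ?_
      split_ifs
      · exact ih k (by omega) _
      · exact differentiable_const _

theorem differentiable_coeff_C {E : Type*} [NormedAddCommGroup E] [NormedSpace ℂ E] {f : E → ℂ}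
    (hf : Differentiable ℂ f) (n : ℕ) : Differentiable ℂ (fun x => (C (f x)).coeff n) := by
  simp only [coeff_C]
  split_ifs
  · exact hf
  · exact differentiable_const _

theorem differentiable_coeff_pPoly {N : ℕ} (k n : ℕ) :
    Differentiable ℂ (fun c : Fin N → ℂ => (pPoly (hTr c) k).coeff n) := by
  induction k using Nat.strong_induction_on generalizing n with
  | _ k ih =>
    match k, ih with
    | 0, _ => simp only [pPoly]; exact differentiable_const _
    | 1, _ => simp only [pPoly]; exact differentiable_const _
    | k + 2, ih =>
      simp only [pPoly, coeff_sub]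
      refine Differentiable.sub ?_ (differentiable_coeff_C (differentiable_coeff_cur k 2) n)
      cases n with
      | zero => simp only [mul_coeff_zero, coeff_X_zero, zero_mul]; exact differentiable_const _
      | succ n => simp only [coeff_X_mul]; exact ih k (by omega) n

theorem differentiable_coeff_qPoly {N : ℕ} (k n : ℕ) :
    Differentiable ℂ (fun c : Fin N → ℂ => (qPoly (hTr c) k).coeff n) := by
  induction k using Nat.strong_induction_on generalizing n with
  | _ k ih =>
    match k, ih with
    | 0, _ => simp only [qPoly]; exact differentiable_const _
    | 1, _ => simp only [qPoly]; exact differentiable_const _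
    | k + 2, ih =>
      simp only [qPoly, coeff_sub]
      refine Differentiable.sub ?_ (differentiable_coeff_C (differentiable_coeff_cur k 1) n)
      cases n with
      | zero => simp only [mul_coeff_zero, coeff_X_zero, zero_mul]; exact differentiable_const _
      | succ n => simp only [coeff_X_mul]; exact ih k (by omega) n

/-- The point of the slice `p_g = 0` of `leafS g` with given coordinates `h_1, …, h_{2g+1}`. -/
def slicePt (c : Fin (2 * g + 1) → ℂ) : MA g := laxPt g (hTr c)

theorem differentiable_slicePt : Differentiable ℂ (slicePt (g := g)) := by
  refine differentiable_pi.2 fun m => differentiable_pi.2 fun e => ?_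
  fin_cases e
  · exact differentiable_coeff_pPoly _ _
  · exact differentiable_coeff_qPoly _ _
  · change Differentiable ℂ fun c : Fin (2 * g + 1) → ℂ => (lax (hTr c) (2 * g + 1) 1 0).coeff m
    simp only [lax_10, coeff_add, finsetSum_coeff, coeff_C_mul]
    refine ((differentiable_coeff_pPoly _ _).add (Differentiable.fun_sum fun l _ => ?_)).add
      (differentiable_coeff_C (differentiable_coeff_cur _ _) _)
    exact (differentiable_coeff_hTr _).mul (differentiable_coeff_pPoly _ _)

theorem slicePt_mem (c : Fin (2 * g + 1) → ℂ) : slicePt c ∈ leafS g := laxPt_mem (hTr_mem c)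

theorem red_of_last {x : MA g} (h : x (Fin.last g) 0 = 0) : red x = x := by
  rw [red, h, gauge_zero]

theorem slicePt_coords {h : Lau} (hh : h ∈ cs2Space) :
    slicePt (coords (2 * g + 1) h) = laxPt g h := by
  refine laxPt_congr (hTr_mem _) ?_
  have := (dec_sub_iff_coords (hTr_mem (coords (2 * g + 1) h)) hh (2 * g + 1)).2 (coords_hTr _)
  exact this.mono (by push_cast; omega)

/-- The coordinates `h_1, …, h_N` as functions on `MA g`. -/
def coordMap (N : ℕ) (x : MA g) : Fin N → ℂ := coords N (hSer x)

theorem coordMap_apply (N : ℕ) (x : MA g) (l : Fin N) :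
    coordMap N x l = (PowerSeries.coeff (l + 1) (serK g)).1 x := by
  rw [coordMap, coords, hSer, HahnSeries.coeff_add, coeff_z_of_pos (by omega), zero_add,
    show (l : ℤ) + 1 = ((l + 1 : ℕ) : ℤ) by push_cast; rfl, coeff_hat, serKAt, PowerSeries.coeff_map,
    evalEnt_apply]

theorem differentiable_coordMap (N : ℕ) : Differentiable ℂ (coordMap (g := g) N) := by
  refine differentiable_pi.2 fun l => ?_
  simp only [coordMap_apply]
  exact (PowerSeries.coeff (l + 1) (serK g)).2

theorem slicePt_coordMap {x : MA g} (hx : x ∈ leafS g) : slicePt (coordMap (2 * g + 1) x) = red x := by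
  rw [coordMap, slicePt_coords (hSer_mem x), (hSer_spec hx).2]

theorem hSer_eq {h : Lau} (hh : h ∈ kdvSpace g) : hSer (laxPt g h) = h := by
  obtain ⟨h1, h2⟩ := hSer_spec (laxPt_mem (g := g) hh.1)
  rw [red_of_last (laxPt_last h)] at h2
  exact eq_of_laxPt_eq h1 hh h2

/-- The truncated series `hTr c` need not be stationary, but its Lax matrix lies on the slice. The
stationary series rebuilt from that matrix shares its first `2g + 1` coefficients by
`dec_sub_of_laxPt_eq`. -/
theorem coordMap_slicePt (c : Fin (2 * g + 1) → ℂ) : coordMap (2 * g + 1) (slicePt c) = c := by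
  obtain ⟨h1, h2⟩ := hSer_spec (slicePt_mem c)
  rw [red_of_last (show slicePt c (Fin.last g) 0 = 0 from laxPt_last _)] at h2
  have h3 := dec_sub_of_laxPt_eq h1.1 (hTr_mem c) h2
  rw [coordMap, (dec_sub_iff_coords h1.1 (hTr_mem c) _).1 (h3.mono (by push_cast; omega)), coords_hTr]

theorem gauge_mem {x : MA g} (hx : x ∈ leafS g) (t : ℂ) : gauge t x ∈ leafS g :=
  ⟨by rw [ham_gauge, hx.1], fun i hi hi' => by rw [ham_gauge, hx.2 i hi hi']⟩

/-- Since `r_g = 1` on `leafS g`, the gauge transformation lowers `p_g` by exactly `t`, and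
normalizing `p_g` to zero compensates for it. -/
theorem red_gauge {x : MA g} (hx : x ∈ leafS g) (t : ℂ) : red (gauge t x) = red x := by
  rw [red, red, gauge_add]
  congr 1
  simp [gauge, gau, leafS_ent_one hx]

theorem hSer_congr {x y : MA g} (hx : x ∈ leafS g) (hy : y ∈ leafS g) (h : red x = red y) :
    hSer x = hSer y := by
  obtain ⟨h1, h2⟩ := hSer_spec hx
  obtain ⟨h3, h4⟩ := hSer_spec hy
  exact eq_of_laxPt_eq h1 h3 (by rw [h2, h4, h])

theorem coords_injective :
    Function.Injective (fun h : kdvSpace g => coords (2 * g + 1) h) := by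
  intro h h' e
  refine Subtype.ext (eq_of_laxPt_eq h.2 h'.2 (laxPt_congr h.2.1 ?_))
  exact ((dec_sub_iff_coords h.2.1 h'.2.1 _).2 e).mono (by push_cast; omega)

theorem coords_surjective :
    Function.Surjective (fun h : kdvSpace g => coords (2 * g + 1) h) := fun c =>
  ⟨⟨hSer (slicePt c), (hSer_spec (slicePt_mem c)).1⟩, coordMap_slicePt c⟩

/-! ### The quotient -/

theorem differentiable_red : Differentiable ℂ (red (g := g)) := by
  refine differentiable_pi.2 fun m => differentiable_pi.2 fun e => ?_
  have := (redCoef (g := g) m e).2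
  have e' : (redCoef (g := g) m e).1 = fun x => red x m e := funext fun x => by
    rw [← coef_fin (red x)]; rfl
  rwa [e'] at this

theorem fderiv_red_gen {x : MA g} (hx : x ∈ leafS g) : fderiv ℂ red x (gen x) = 0 := by
  have h := ((differentiable_red (gauge 0 x)).hasFDerivAt).comp_hasDerivAt (0 : ℂ)
    (hasDerivAt_gauge x 0)
  rw [gauge_zero] at h
  rw [← h.deriv]
  have e : (red ∘ fun t => gauge t x) = fun _ => red x := funext fun t => red_gauge hx t
  rw [e, deriv_const]

/-- Along a curve tangent to `E` the velocity is a multiple of the generator, which the differential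
of `red` kills; so `red` is constant on it. -/
theorem red_eq_of_leafRel {x y : leafS g} (h : leafRel x y) : red (x : MA g) = red (y : MA g) := by
  obtain ⟨γ, h0, h1, hγ⟩ := h
  have hd : ∀ t, HasDerivAt (fun t => red (γ t)) 0 t := fun t => by
    obtain ⟨hm, v, hv, hv'⟩ := hγ t
    obtain ⟨a, rfl⟩ := (mem_distE_iff _ _).1 hv
    have h2 := ((differentiable_red (γ t)).hasFDerivAt.restrictScalars ℝ).comp_hasDerivAt t hv'
    rwa [ContinuousLinearMap.coe_restrictScalars', map_smul, fderiv_red_gen hm, smul_zero] at h2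
  have h3 := is_const_of_deriv_eq_zero (fun t => (hd t).differentiableAt) (fun t => (hd t).deriv) 0 1
  rwa [h0, h1] at h3

theorem leafRel_gauge (x : leafS g) (t : ℂ) : leafRel x ⟨gauge t x, gauge_mem x.2 t⟩ := by
  refine ⟨fun s => gauge (s * t) x, ?_, ?_, fun s =>
    ⟨gauge_mem x.2 _, t • gen (gauge (s * t) (x : MA g)), (mem_distE_iff _ _).2 ⟨t, rfl⟩, ?_⟩⟩
  · simp only [Complex.ofReal_zero, zero_mul, gauge_zero]
  · simp only [Complex.ofReal_one, one_mul]
  have h1 : HasDerivAt (fun s : ℝ => (s : ℂ) * t) t s := by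
    simpa using (Complex.ofRealCLM.hasDerivAt (x := s)).mul_const t
  exact (hasDerivAt_gauge (x : MA g) (s * t)).scomp s h1

/-- The normal form of a point of the quotient. -/
def redQ : Ntilde g → MA g :=
  Quot.lift (fun x : leafS g => red (x : MA g)) fun _ _ => red_eq_of_leafRel

theorem redQ_proj (x : leafS g) : redQ (proj x) = red (x : MA g) := rfl

/-- The classes are the gauge orbits: every point is joined to its normal form by a segment of the
gauge flow, and `red` separates the classes. -/
theorem proj_eq_iff (x y : leafS g) : proj x = proj y ↔ red (x : MA g) = red (y : MA g) := by
  have hp : ∀ x : leafS g, proj x = proj ⟨red (x : MA g), red_mem (x := (x : MA g)) x.2⟩ := fun x =>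
    Quot.sound (leafRel_gauge x ((x : MA g) (Fin.last g) 0))
  constructor
  · intro h
    rw [← redQ_proj, h, redQ_proj]
  · intro h
    rw [hp x, hp y]
    congr 1
    exact Subtype.ext h

theorem proj_surjective : Function.Surjective (proj (g := g)) := Quot.mk_surjective

variable (g) in
/-- The map from the phase space of KdV_{2g+1} to the quotient given by the Lax matrix. -/
def phi (h : kdvSpace g) : Ntilde g := proj ⟨laxPt g h, laxPt_mem h.2.1⟩

theorem phi_injective : Function.Injective (phi g) := by
  intro h h' e
  have := (proj_eq_iff _ _).1 e
  simp only [red_of_last (laxPt_last _)] at this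
  exact Subtype.ext (eq_of_laxPt_eq h.2 h'.2 this)

theorem phi_hSer (x : leafS g) : phi g ⟨hSer (x : MA g), (hSer_spec (x := (x : MA g)) x.2).1⟩ = proj x := by
  rw [phi, proj_eq_iff]
  simp only [(hSer_spec (x := (x : MA g)) x.2).2, red_of_last (red_last (x := (x : MA g)) x.2)]

theorem phi_surjective : Function.Surjective (phi g) := fun n => by
  obtain ⟨x, rfl⟩ := proj_surjective n
  exact ⟨_, phi_hSer x⟩

/-- Both `slicePt` and `coordMap` are entire on the ambient spaces, so prolongations are obtained by
composition and no extension theorem is needed. -/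
theorem mem_holFun_iff (f : Ntilde g → ℂ) : f ∈ holFun g ↔
    ∃ G : (Fin (2 * g + 1) → ℂ) → ℂ, Differentiable ℂ G ∧
      ∀ h : kdvSpace g, f (phi g h) = G (coords (2 * g + 1) h) := by
  constructor
  · rintro ⟨F, hF, hF'⟩
    refine ⟨fun c => F (slicePt c), hF.comp differentiable_slicePt, fun h => ?_⟩
    simp only [slicePt_coords h.2.1]
    exact (hF' ⟨laxPt g h, laxPt_mem h.2.1⟩).symm
  · rintro ⟨G, hG, hG'⟩
    refine ⟨fun x => G (coordMap (2 * g + 1) x), hG.comp (differentiable_coordMap _), fun x => ?_⟩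
    rw [← phi_hSer, hG']
    rfl

theorem prolongs_gauge {F : MA g → ℂ} {f : Ntilde g → ℂ} (hF : Prolongs F f) (t : ℂ) :
    Prolongs (fun x => F (gauge t x)) f :=
  ⟨hF.1.comp (differentiable_gauge t), fun x => by
    have h := (proj_eq_iff ⟨gauge t (x : MA g), gauge_mem x.2 t⟩ x).2 (red_gauge x.2 t)
    rw [← h]
    exact hF.2 ⟨gauge t (x : MA g), gauge_mem x.2 t⟩⟩

theorem Prolongs.fderiv_gen {F : MA g → ℂ} {f : Ntilde g → ℂ} (hF : Prolongs F f) {x : MA g}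
    (hx : x ∈ leafS g) : fderiv ℂ F x (gen x) = 0 := by
  have h := ((hF.1 (gauge 0 x)).hasFDerivAt).comp_hasDerivAt (0 : ℂ) (hasDerivAt_gauge x 0)
  rw [gauge_zero] at h
  rw [← h.deriv]
  have e : (F ∘ fun t => gauge t x) = fun _ => F x := funext fun t => by
    have h1 := (prolongs_gauge hF t).2 ⟨x, hx⟩
    have h2 := hF.2 ⟨x, hx⟩
    exact h1.trans h2.symm
  rw [e, deriv_const]

/-! ### The tangent space of `leafS g` -/

/-- A global parametrization of `leafS g`. -/
def param (q : (Fin (2 * g + 1) → ℂ) × ℂ) : MA g := gauge (-q.2) (slicePt q.1)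

/-- A holomorphic left inverse of `param`. -/
def paramInv (x : MA g) : (Fin (2 * g + 1) → ℂ) × ℂ := (coordMap (2 * g + 1) x, x (Fin.last g) 0)

theorem differentiable_param : Differentiable ℂ (param (g := g)) := by
  refine differentiable_pi.2 fun m => differentiable_pi.2 fun e => ?_
  have h0 : Differentiable ℂ fun q : (Fin (2 * g + 1) → ℂ) × ℂ => slicePt (g := g) q.1 :=
    differentiable_slicePt.comp differentiable_fst
  have h : ∀ e, Differentiable ℂ fun q : (Fin (2 * g + 1) → ℂ) × ℂ => slicePt (g := g) q.1 m e :=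
    fun e => differentiable_pi.1 (differentiable_pi.1 h0 m) e
  have ht : Differentiable ℂ fun q : (Fin (2 * g + 1) → ℂ) × ℂ => -q.2 := differentiable_snd.neg
  fin_cases e
  · exact (h 0).sub (ht.mul (h 1))
  · exact h 1
  · exact ((h 2).add ((ht.const_mul 2).mul (h 0))).sub ((ht.pow 2).mul (h 1))

theorem differentiable_paramInv : Differentiable ℂ (paramInv (g := g)) :=
  (differentiable_coordMap _).prodMk
    (differentiable_pi.1 (differentiable_pi.1 differentiable_id (Fin.last g)) 0)

theorem param_mem (q : (Fin (2 * g + 1) → ℂ) × ℂ) : param q ∈ leafS g := gauge_mem (slicePt_mem _) _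

theorem slicePt_last (c : Fin (2 * g + 1) → ℂ) : slicePt c (Fin.last g) 0 = 0 := laxPt_last _

theorem paramInv_param (q : (Fin (2 * g + 1) → ℂ) × ℂ) : paramInv (param q) = q := by
  refine Prod.ext ?_ ?_
  · rw [← coordMap_slicePt (g := g) q.1]
    exact congrArg (coords (2 * g + 1)) (hSer_congr (param_mem q) (slicePt_mem _) (red_gauge (slicePt_mem _) _))
  · change gauge (-q.2) (slicePt q.1) (Fin.last g) 0 = q.2
    simp [gauge, gau, leafS_ent_one (slicePt_mem _), slicePt_last]

theorem param_paramInv {x : MA g} (hx : x ∈ leafS g) : param (paramInv x) = x := by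
  rw [param, paramInv, slicePt_coordMap hx, red, gauge_neg_gauge]

theorem fderiv_paramInv_fderiv_param {x : MA g} (hx : x ∈ leafS g)
    (u : (Fin (2 * g + 1) → ℂ) × ℂ) :
    fderiv ℂ paramInv x (fderiv ℂ param (paramInv x) u) = u := by
  have h2 := (differentiable_paramInv (param (paramInv x))).hasFDerivAt.comp (paramInv x)
    (differentiable_param (paramInv x)).hasFDerivAt
  rw [show paramInv ∘ param = (id : (Fin (2 * g + 1) → ℂ) × ℂ → _) from
    funext paramInv_param, param_paramInv hx] at h2
  have h3 := h2.unique (hasFDerivAt_id _)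
  exact congrArg (fun T => T u) h3

theorem fderiv_param_mem {x : MA g} (hx : x ∈ leafS g) (u : (Fin (2 * g + 1) → ℂ) × ℂ) :
    fderiv ℂ param (paramInv x) u ∈ tangentS x := by
  intro i hi hi'
  have h2 := (differentiable_ham i (param (paramInv x))).hasFDerivAt.comp (paramInv x)
    (differentiable_param (paramInv x)).hasFDerivAt
  obtain ⟨k, hk⟩ : ∃ k : ℂ, ∀ y ∈ leafS g, ham i y = k := by
    rcases eq_or_lt_of_le hi' with rfl | h
    · exact ⟨1, fun y hy => hy.1⟩
    · exact ⟨0, fun y hy => hy.2 i hi (by omega)⟩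
  rw [show ham i ∘ param = fun _ : (Fin (2 * g + 1) → ℂ) × ℂ => k from
    funext fun q => hk _ (param_mem q), param_paramInv hx] at h2
  have h3 := h2.unique (hasFDerivAt_const k _)
  exact congrArg (fun T => T u) h3

/-- The differential of `param` is injective with values in the tangent space, and both have
dimension `2g + 2`; its left inverse is therefore two-sided there. -/
theorem fderiv_param_fderiv_paramInv {x v : MA g} (hx : x ∈ leafS g) (hv : v ∈ tangentS x) :
    fderiv ℂ param (paramInv x) (fderiv ℂ paramInv x v) = v := by
  have h4 : LinearMap.range (fderiv ℂ param (paramInv x) : ((Fin (2 * g + 1) → ℂ) × ℂ) →ₗ[ℂ] MA g)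
      = LinearMap.ker (tanMap x) := by
    refine Submodule.eq_of_le_of_finrank_le ?_ ?_
    · rintro _ ⟨u, rfl⟩
      rw [mem_ker_tanMap]
      exact fderiv_param_mem hx u
    · rw [finrank_ker_tanMap, LinearMap.finrank_range_of_inj]
      · simp
      · exact Function.LeftInverse.injective (g := fderiv ℂ paramInv x)
          (fderiv_paramInv_fderiv_param hx)
  rw [← mem_ker_tanMap, ← h4] at hv
  obtain ⟨u, rfl⟩ := hv
  exact congrArg _ (fderiv_paramInv_fderiv_param hx u)

/-- Tangent vectors are velocities of the parametrization, so the derivative sees only the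
restriction to `leafS g`. -/
theorem fderiv_eq_of_eqOn {F F' : MA g → ℂ} (hF : Differentiable ℂ F) (hF' : Differentiable ℂ F')
    (h : ∀ x ∈ leafS g, F x = F' x) {x v : MA g} (hx : x ∈ leafS g) (hv : v ∈ tangentS x) :
    fderiv ℂ F x v = fderiv ℂ F' x v := by
  have key : ∀ {F : MA g → ℂ}, Differentiable ℂ F → fderiv ℂ F x v
      = fderiv ℂ (F ∘ param) (paramInv x) (fderiv ℂ paramInv x v) := by
    intro F hF
    have h2 := (hF (param (paramInv x))).hasFDerivAt.comp _
      (differentiable_param (paramInv x)).hasFDerivAt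
    rw [h2.fderiv, ContinuousLinearMap.comp_apply, fderiv_param_fderiv_paramInv hx hv,
      param_paramInv hx]
  rw [key hF, key hF', show F ∘ param = F' ∘ param from funext fun q => h _ (param_mem q)]

/-! ### The reduced brackets -/

theorem redQ_mem (n : Ntilde g) : redQ n ∈ leafS g := by
  obtain ⟨x, rfl⟩ := proj_surjective n
  rw [redQ_proj]
  exact red_mem x.2

theorem proj_redQ (n : Ntilde g) : proj ⟨redQ n, redQ_mem n⟩ = n := by
  obtain ⟨x, rfl⟩ := proj_surjective n
  rw [proj_eq_iff]
  exact red_of_last (red_last x.2)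

theorem Prolongs.eq_redQ {F : MA g → ℂ} {f : Ntilde g → ℂ} (hF : Prolongs F f) (n : Ntilde g) :
    f n = F (redQ n) := by
  rw [hF.2 ⟨redQ n, redQ_mem n⟩, proj_redQ]

theorem Prolongs.ext {F F' : MA g → ℂ} {f f' : holFun g} (hF : Prolongs F f) (hF' : Prolongs F' f')
    (h : ∀ x ∈ leafS g, F x = F' x) : f = f' :=
  Subtype.ext (funext fun n => by rw [hF.eq_redQ, hF'.eq_redQ, h _ (redQ_mem n)])

theorem Prolongs.eqOn {F F' : MA g → ℂ} {f : Ntilde g → ℂ} (hF : Prolongs F f)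
    (hF' : Prolongs F' f) : ∀ x ∈ leafS g, F x = F' x := fun x hx => by
  rw [hF.2 ⟨x, hx⟩, hF'.2 ⟨x, hx⟩]

theorem Prolongs.pen_grad_mem {K : MA g → ℂ} {k : Ntilde g → ℂ} (hK : Prolongs K k) (a b : ℂ)
    {x : MA g} (hx : x ∈ leafS g) : pen a b x (grad (fderiv ℂ K x)) ∈ tangentS x :=
  pen_mem_tangentS a b (by rw [pairing_grad, hK.fderiv_gen hx])

/-- The Hamiltonian field of a prolongation is tangent to `leafS g`, so the first argument may be
changed; skewness then permits changing the second. -/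
theorem pbr_eq_of_prolongs (a b : ℂ) {F F' K K' : MA g → ℂ} {f k : Ntilde g → ℂ}
    (hF : Prolongs F f) (hF' : Prolongs F' f) (hK : Prolongs K k) (hK' : Prolongs K' k)
    {x : MA g} (hx : x ∈ leafS g) : pbr (pen a b) F K x = pbr (pen a b) F' K' x := by
  have key : ∀ {F F' K : MA g → ℂ} {f k : Ntilde g → ℂ}, Prolongs F f → Prolongs F' f →
      Prolongs K k → pbr (pen a b) F K x = pbr (pen a b) F' K x := fun hF hF' hK =>
    fderiv_eq_of_eqOn hF.1 hF'.1 (hF.eqOn hF') hx (hK.pen_grad_mem a b hx)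
  rw [key hF hF' hK, pbr_pen_skew, key hK hK' hF', ← pbr_pen_skew]

theorem pbr_red (a b : ℂ) {F K : MA g → ℂ} {f k : Ntilde g → ℂ} (hF : Prolongs F f)
    (hK : Prolongs K k) {x : MA g} (hx : x ∈ leafS g) :
    pbr (pen a b) F K (red x) = pbr (pen a b) F K x := by
  rw [red, ← pbr_comp_gauge a b hF.1 hK.1]
  exact pbr_eq_of_prolongs a b (prolongs_gauge hF _) hF (prolongs_gauge hK _) hK hx

/-- A holomorphic prolongation of a holomorphic function on the quotient. -/
def prol (f : holFun g) : MA g → ℂ := f.2.choose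

theorem prol_spec (f : holFun g) : Prolongs (prol f) f := f.2.choose_spec

/-- The reduced bracket of two functions. -/
def redBr (a b : ℂ) (f k : holFun g) : holFun g :=
  ⟨fun n => pbr (pen a b) (prol f) (prol k) (redQ n), pbr (pen a b) (prol f) (prol k),
    differentiable_pbr a b (prol_spec f).1 (prol_spec k).1, fun x => by
      change _ = pbr (pen a b) (prol f) (prol k) (redQ (proj x))
      rw [redQ_proj, pbr_red a b (prol_spec f) (prol_spec k) x.2]⟩

/-- Together with `Prolongs.ext` this transfers identities between brackets on `MA g` to the
quotient. -/
theorem prolongs_redBr (a b : ℂ) {f k : holFun g} {F K : MA g → ℂ} (hF : Prolongs F f)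
    (hK : Prolongs K k) : Prolongs (pbr (pen a b) F K) (redBr a b f k) :=
  ⟨differentiable_pbr a b hF.1 hK.1, fun x => by
    rw [pbr_eq_of_prolongs a b hF (prol_spec f) hK (prol_spec k) x.2,
      ← pbr_red a b (prol_spec f) (prol_spec k) x.2]
    rfl⟩

theorem Prolongs.add {F F' : MA g → ℂ} {f f' : holFun g} (hF : Prolongs F f)
    (hF' : Prolongs F' f') : Prolongs (fun x => F x + F' x) (f + f' : holFun g) :=
  ⟨hF.1.add hF'.1, fun x => by
    change F x + F' x = f.1 (proj x) + f'.1 (proj x)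
    rw [hF.2, hF'.2]⟩

theorem Prolongs.mul {F F' : MA g → ℂ} {f f' : holFun g} (hF : Prolongs F f)
    (hF' : Prolongs F' f') : Prolongs (fun x => F x * F' x) (f * f' : holFun g) :=
  ⟨hF.1.mul hF'.1, fun x => by
    change F x * F' x = f.1 (proj x) * f'.1 (proj x)
    rw [hF.2, hF'.2]⟩

theorem Prolongs.smul {F : MA g → ℂ} {f : holFun g} (c : ℂ) (hF : Prolongs F f) :
    Prolongs (fun x => c * F x) (c • f : holFun g) :=
  ⟨hF.1.const_mul c, fun x => by
    change c * F x = c * f.1 (proj x)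
    rw [hF.2]⟩

theorem Prolongs.neg {F : MA g → ℂ} {f : holFun g} (hF : Prolongs F f) :
    Prolongs (fun x => -F x) (-f : holFun g) :=
  ⟨hF.1.neg, fun x => by
    change -F x = -f.1 (proj x)
    rw [hF.2]⟩

theorem prolongs_zero : Prolongs (g := g) (fun _ => 0) ((0 : holFun g) : Ntilde g → ℂ) :=
  ⟨differentiable_const _, fun _ => rfl⟩

theorem pbr_pen_add_left (a b : ℂ) {F F' K : MA g → ℂ} (hF : Differentiable ℂ F)
    (hF' : Differentiable ℂ F') (x : MA g) : pbr (pen a b) (fun x => F x + F' x) K x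
      = pbr (pen a b) F K x + pbr (pen a b) F' K x := by
  rw [pbr, fderiv_fun_add (hF x) (hF' x)]
  rfl

theorem pbr_pen_smul_left (a b c : ℂ) {F K : MA g → ℂ} (hF : Differentiable ℂ F) (x : MA g) :
    pbr (pen a b) (fun x => c * F x) K x = c * pbr (pen a b) F K x := by
  rw [pbr, fderiv_const_mul (hF x)]
  rfl

theorem redBr_skew (a b : ℂ) (f k : holFun g) : redBr a b f k = -redBr a b k f :=
  (prolongs_redBr a b (prol_spec f) (prol_spec k)).ext
    (prolongs_redBr a b (prol_spec k) (prol_spec f)).neg fun _ _ => pbr_pen_skew a b _ _ _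

theorem redBr_add_left (a b : ℂ) (f f' k : holFun g) :
    redBr a b (f + f') k = redBr a b f k + redBr a b f' k :=
  (prolongs_redBr a b ((prol_spec f).add (prol_spec f')) (prol_spec k)).ext
    ((prolongs_redBr a b (prol_spec f) (prol_spec k)).add
      (prolongs_redBr a b (prol_spec f') (prol_spec k)))
    fun x _ => pbr_pen_add_left a b (prol_spec f).1 (prol_spec f').1 x

theorem redBr_smul_left (a b c : ℂ) (f k : holFun g) :
    redBr a b (c • f) k = c • redBr a b f k :=
  (prolongs_redBr a b ((prol_spec f).smul c) (prol_spec k)).ext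
    ((prolongs_redBr a b (prol_spec f) (prol_spec k)).smul c)
    fun x _ => pbr_pen_smul_left a b c (prol_spec f).1 x

/-- The reduction of the bracket of `a P1 + b P0`. -/
def redB (a b : ℂ) : holFun g →ₗ[ℂ] holFun g →ₗ[ℂ] holFun g :=
  LinearMap.mk₂ ℂ (redBr a b) (redBr_add_left a b) (fun c f k => redBr_smul_left a b c f k)
    (fun f k k' => by
      rw [redBr_skew, redBr_add_left, neg_add, ← redBr_skew, ← redBr_skew])
    (fun c f k => by
      rw [redBr_skew, redBr_smul_left, ← smul_neg, ← redBr_skew])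

theorem prolongs_redB (a b : ℂ) {f k : holFun g} {F K : MA g → ℂ} (hF : Prolongs F f)
    (hK : Prolongs K k) : Prolongs (pbr (pen a b) F K) (redB a b f k) :=
  prolongs_redBr a b hF hK

theorem isPoisson_redB (a b : ℂ) : IsPoisson (redB (g := g) a b) where
  skew := redBr_skew a b
  leibniz f k l := by
    have hf := prol_spec f
    have hk := prol_spec k
    have hl := prol_spec l
    exact (prolongs_redB a b hf (hk.mul hl)).ext (((prolongs_redB a b hf hk).mul hl).add
      (hk.mul (prolongs_redB a b hf hl))) fun x _ => pbr_pen_leibniz a b hk.1 hl.1 x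
  jacobi f k l := by
    have hf := prol_spec f
    have hk := prol_spec k
    have hl := prol_spec l
    exact (((prolongs_redB a b hf (prolongs_redB a b hk hl)).add
      (prolongs_redB a b hk (prolongs_redB a b hl hf))).add
      (prolongs_redB a b hl (prolongs_redB a b hf hk))).ext prolongs_zero
      fun x _ => pbr_pen_jacobi a b hf.1 hk.1 hl.1 x

theorem smul_redB_add (a b : ℂ) :
    a • redB (g := g) 1 0 + b • redB (g := g) 0 1 = redB (g := g) a b := by
  refine LinearMap.ext fun f => LinearMap.ext fun k => ?_
  have hf := prol_spec f
  have hk := prol_spec k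
  refine (((prolongs_redB 1 0 hf hk).smul a).add ((prolongs_redB 0 1 hf hk).smul b)).ext
    (prolongs_redB a b hf hk) fun x _ => ?_
  rw [pbr_pen, pbr_pen, pbr_pen]
  ring

theorem pencil_redB (μ : ℂ) : pencil (redB (g := g) 0 1) (redB (g := g) 1 0) μ = redB (g := g) 1 (-μ) := by
  rw [pencil, ← smul_redB_add 1 (-μ), one_smul]

theorem isReduction_redB_zero : IsReduction (g := g) P0 (redB 0 1) := by
  intro f k F K hF hK x
  rw [show (P0 : MA g → MA g → MA g) = pen 0 1 from funext fun x => funext fun w => P0_eq_pen x w]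
  exact (prolongs_redB 0 1 hF hK).2 x

theorem isReduction_redB_one : IsReduction (g := g) P1 (redB 1 0) := by
  intro f k F K hF hK x
  rw [show (P1 : MA g → MA g → MA g) = pen 1 0 from funext fun x => funext fun w => P1_eq_pen x w]
  exact (prolongs_redB 1 0 hF hK).2 x

/-! ### The reduced Hamiltonians and vector fields -/

/-- The function induced by `ham i` on the quotient. -/
def hamQ (i : ℕ) : holFun g :=
  ⟨fun n => ham i (redQ n), ham i, differentiable_ham i, fun x => by
    change _ = ham i (redQ (proj x))
    rw [redQ_proj, red, ham_gauge]⟩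

theorem prolongs_hamQ (i : ℕ) : Prolongs (ham i : MA g → ℂ) ((hamQ i : holFun g) : Ntilde g → ℂ) :=
  ⟨differentiable_ham i, fun x => by
    change _ = ham i (redQ (proj x))
    rw [redQ_proj, red, ham_gauge]⟩

theorem pbr_P0_ham (F : MA g → ℂ) (i : ℕ) (x : MA g) :
    pbr (pen 0 1) F (ham i) x = fderiv ℂ F x (P0 x (hamGrad i x)) := by
  rw [pbr, grad_ham, ← P0_eq_pen]

theorem pbr_P1_ham (F : MA g → ℂ) (i : ℕ) (x : MA g) :
    pbr (pen 1 0) F (ham i) x = fderiv ℂ F x (P1 x (hamGrad i x)) := by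
  rw [pbr, grad_ham, ← P1_eq_pen]

theorem redB_hamQ_succ (f : holFun g) (i : ℕ) :
    redB 1 0 f (hamQ (i + 1)) = redB 0 1 f (hamQ i) :=
  (prolongs_redB 1 0 (prol_spec f) (prolongs_hamQ _)).ext
    (prolongs_redB 0 1 (prol_spec f) (prolongs_hamQ _)) fun x _ => by
      rw [pbr_P0_ham, pbr_P1_ham, P1_hamGrad_succ]

theorem redB_hamQ_zero (f : holFun g) : redB 1 0 f (hamQ 0) = 0 :=
  (prolongs_redB 1 0 (prol_spec f) (prolongs_hamQ _)).ext prolongs_zero fun x _ => by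
    rw [pbr_P1_ham, P1_hamGrad_zero, map_zero]

theorem redB_hamQ_top (f : holFun g) : redB 0 1 f (hamQ g) = 0 :=
  (prolongs_redB 0 1 (prol_spec f) (prolongs_hamQ _)).ext prolongs_zero fun x hx => by
    rw [pbr_P0_ham, P0_hamGrad_top, (prol_spec f).fderiv_gen hx]

/-- The Lenard relations shift `B1` of each `H_{i+1}` to `B0` of `H_i`, so the powers of `μ`
telescope; the end terms vanish because `B1 f H_0 = 0` and `B0 f H_g = 0`. -/
theorem pencil_casimir (μ : ℂ) (f : holFun g) :
    pencil (redB 0 1) (redB 1 0) μ f (∑ i ∈ Finset.range (g + 1), μ ^ i • hamQ i) = 0 := by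
  have h1 : redB 1 0 f (∑ i ∈ Finset.range (g + 1), μ ^ i • hamQ i)
      = ∑ i ∈ Finset.range g, μ ^ (i + 1) • redB 0 1 f (hamQ i) := by
    rw [map_sum, Finset.sum_range_succ', map_smul, redB_hamQ_zero, smul_zero, add_zero]
    simp only [map_smul, redB_hamQ_succ]
  have h2 : redB 0 1 f (∑ i ∈ Finset.range (g + 1), μ ^ i • hamQ i)
      = ∑ i ∈ Finset.range g, μ ^ i • redB 0 1 f (hamQ i) := by
    rw [map_sum, Finset.sum_range_succ, map_smul, redB_hamQ_top, smul_zero, add_zero]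
    simp only [map_smul]
  rw [pencil, LinearMap.add_apply, LinearMap.add_apply, LinearMap.smul_apply, LinearMap.smul_apply,
    h1, h2, Finset.smul_sum, ← Finset.sum_add_distrib]
  refine Finset.sum_eq_zero fun i _ => ?_
  rw [smul_smul, ← add_smul, pow_succ]
  simp [mul_comm]

/-- The projected Lax vector fields. -/
def flow (i : ℕ) : Derivation ℂ (holFun g) (holFun g) :=
  Derivation.mk' ((redB 0 1).flip (hamQ (g - 1 - i))) fun f k => by
    have hP := isPoisson_redB (g := g) 0 1
    rw [LinearMap.flip_apply, LinearMap.flip_apply, LinearMap.flip_apply, hP.skew, hP.leibniz,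
      hP.skew k, hP.skew f, smul_eq_mul, smul_eq_mul]
    ring

theorem flow_apply (i : ℕ) (f : holFun g) : flow i f = redB 0 1 f (hamQ (g - 1 - i)) := rfl

theorem projectsTo_flow {i : ℕ} (hi : i < g) : ProjectsTo (g := g) (laxField i) (flow i) := by
  intro x
  rw [laxField_eq hi]
  refine ⟨P0_mem_tangentS _ _, fun f F hF => ?_⟩
  rw [← pbr_P0_ham]
  exact (prolongs_redB 0 1 hF (prolongs_hamQ _)).2 x

/-! ### Pencils of linear maps -/

/-- With a section `s` of `f0` over its range and a projection `p` onto that range, `p (f1 - μ f0) s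
= p f1 s - μ`. This is injective unless `μ` is one of the finitely many eigenvalues of `p f1 s`, and
then the rank is at least that of `f0`. -/
theorem finite_setOf_finrank_range_lt {V : Type*} [AddCommGroup V] [Module ℂ V]
    [FiniteDimensional ℂ V] (f0 f1 : V →ₗ[ℂ] V) :
    {μ : ℂ | Module.finrank ℂ (LinearMap.range (f1 - μ • f0))
      < Module.finrank ℂ (LinearMap.range f0)}.Finite := by
  obtain ⟨s, hs⟩ := f0.rangeRestrict.exists_rightInverse_of_surjective f0.range_rangeRestrict
  obtain ⟨p, hp⟩ := (LinearMap.range f0).subtype.exists_leftInverse_of_injective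
    (Submodule.ker_subtype _)
  have hs' : ∀ w, f0 (s w) = (w : V) := fun w => congrArg Subtype.val (LinearMap.congr_fun hs w)
  have hp' : ∀ w : LinearMap.range f0, p (w : V) = w := fun w => LinearMap.congr_fun hp w
  refine (Module.End.finite_hasEigenvalue (p ∘ₗ f1 ∘ₗ s)).subset fun μ hμ => ?_
  by_contra hev
  have hinj : Function.Injective (p ∘ₗ (f1 - μ • f0) ∘ₗ s) := by
    rw [← LinearMap.ker_eq_bot, LinearMap.ker_eq_bot']
    intro w hw
    by_contra hw0
    refine hev (Module.End.hasEigenvalue_of_hasEigenvector (x := w) ⟨?_, hw0⟩)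
    rw [Module.End.mem_eigenspace_iff]
    simpa [hs', hp', sub_eq_zero] using hw
  have h1 : Module.finrank ℂ (LinearMap.range f0)
      ≤ Module.finrank ℂ (LinearMap.range (f1 - μ • f0)) := by
    rw [← LinearMap.finrank_range_of_inj hinj, LinearMap.range_comp]
    refine (Submodule.finrank_map_le _ _).trans (Submodule.finrank_mono ?_)
    exact LinearMap.range_comp_le_range _ _
  exact absurd hμ (not_lt.2 h1)

theorem rank_le_of_skew {n : ℕ} (M : Matrix (Fin (2 * n + 1)) (Fin (2 * n + 1)) ℂ)
    (hM : M.transpose = -M) : M.rank ≤ 2 * n := by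
  have hd : M.det = 0 := by
    have h := M.det_transpose
    rw [hM, Matrix.det_neg, Fintype.card_fin, pow_succ, pow_mul] at h
    simp at h
    exact self_eq_neg.1 h.symm
  obtain ⟨v, hv, hv'⟩ := Matrix.exists_mulVec_eq_zero_iff.2 hd
  have h1 := LinearMap.finrank_range_add_finrank_ker M.mulVecLin
  have h2 : 0 < Module.finrank ℂ (LinearMap.ker M.mulVecLin) :=
    Module.finrank_pos_iff_exists_ne_zero.2 ⟨⟨v, hv'⟩, fun h => hv (congrArg Subtype.val h)⟩
  rw [Module.finrank_fin_fun] at h1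
  rw [Matrix.rank]
  omega

/-! ### The reduced bivectors in coordinates -/

/-- A coordinate as a function on `MA g`. -/
def theta (l : Fin (2 * g + 1)) (x : MA g) : ℂ := coordMap (2 * g + 1) x l

theorem differentiable_theta (l : Fin (2 * g + 1)) : Differentiable ℂ (theta l) :=
  differentiable_pi.1 (differentiable_coordMap _) l

theorem fderiv_theta (l : Fin (2 * g + 1)) (x v : MA g) :
    fderiv ℂ (theta l) x v = fderiv ℂ (coordMap (2 * g + 1)) x v l := by
  have h := hasFDerivAt_pi'.1 (differentiable_coordMap (2 * g + 1) x).hasFDerivAt l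
  exact congrArg (fun T => T v) h.fderiv

/-- A coordinate as a function on the quotient. -/
def thetaQ (l : Fin (2 * g + 1)) : holFun g :=
  ⟨fun n => theta l (redQ n), theta l, differentiable_theta l, fun x => by
    change _ = theta l (redQ (proj x))
    rw [redQ_proj, theta, theta, coordMap, coordMap,
      hSer_congr (x := (x : MA g)) x.2 (red_mem (x := (x : MA g)) x.2)
        (red_of_last (red_last (x := (x : MA g)) x.2)).symm]⟩

/-- The expression of a function on the quotient in the coordinates. -/
def inCoords (f : holFun g) (c : Fin (2 * g + 1) → ℂ) : ℂ := f.1 (proj ⟨slicePt c, slicePt_mem c⟩)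

theorem inCoords_eq (f : holFun g) : inCoords f = fun c => prol f (slicePt c) :=
  funext fun _ => ((prol_spec f).2 _).symm

theorem differentiable_inCoords (f : holFun g) : Differentiable ℂ (inCoords f) := by
  rw [inCoords_eq]
  exact (prol_spec f).1.comp differentiable_slicePt

theorem prolongs_inCoords (f : holFun g) :
    Prolongs (fun x => inCoords f (coordMap (2 * g + 1) x)) (f : Ntilde g → ℂ) :=
  ⟨(differentiable_inCoords f).comp (differentiable_coordMap _), fun x => by
    have h : proj ⟨slicePt (coordMap (2 * g + 1) (x : MA g)), slicePt_mem _⟩ = proj x := by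
      rw [proj_eq_iff]
      simp only [slicePt_coordMap x.2]
      exact red_of_last (red_last (x := (x : MA g)) x.2)
    rw [← h]
    rfl⟩

theorem inCoords_thetaQ (l : Fin (2 * g + 1)) : inCoords (thetaQ l) = fun c => c l := funext fun c => by
  change theta l (redQ (proj _)) = c l
  rw [redQ_proj]
  simp only [red_of_last (slicePt_last c), theta, coordMap_slicePt]

/-- The partial derivatives of a function on the quotient. -/
def partials (c : Fin (2 * g + 1) → ℂ) : holFun g →ₗ[ℂ] (Fin (2 * g + 1) → ℂ) where
  toFun f l := fderiv ℂ (inCoords f) c (Pi.single l 1)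
  map_add' f k := by
    funext l
    have h : inCoords (f + k) = fun c => inCoords f c + inCoords k c := rfl
    rw [h, fderiv_fun_add (differentiable_inCoords f c) (differentiable_inCoords k c)]
    rfl
  map_smul' s f := by
    funext l
    have h : inCoords (s • f) = fun c => s * inCoords f c := rfl
    rw [h, fderiv_const_mul (differentiable_inCoords f c)]
    rfl

theorem partials_apply (c : Fin (2 * g + 1) → ℂ) (f : holFun g) (l : Fin (2 * g + 1)) :
    partials c f l = fderiv ℂ (inCoords f) c (Pi.single l 1) := rfl

theorem partials_surjective (c : Fin (2 * g + 1) → ℂ) : Function.Surjective (partials c) := by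
  intro w
  refine ⟨∑ m, w m • thetaQ m, funext fun l => ?_⟩
  rw [map_sum, Finset.sum_apply, Finset.sum_eq_single l]
  · rw [map_smul, Pi.smul_apply, partials_apply, inCoords_thetaQ,
      (hasFDerivAt_apply l c).fderiv]
    simp
  · intro m _ hm
    rw [map_smul, Pi.smul_apply, partials_apply, inCoords_thetaQ,
      (hasFDerivAt_apply m c).fderiv]
    simp [hm]
  · simp

theorem fderiv_inCoords (f : holFun g) (x : MA g) :
    fderiv ℂ (fun x => inCoords f (coordMap (2 * g + 1) x)) x
      = ∑ l, partials (coordMap (2 * g + 1) x) f l • fderiv ℂ (theta l) x := by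
  have h := ((differentiable_inCoords f (coordMap (2 * g + 1) x)).hasFDerivAt).comp x
    (differentiable_coordMap (2 * g + 1) x).hasFDerivAt
  have h' : fderiv ℂ (fun x => inCoords f (coordMap (2 * g + 1) x)) x = _ := h.fderiv
  ext v
  rw [h', ContinuousLinearMap.comp_apply]
  have e : fderiv ℂ (coordMap (2 * g + 1)) x v
      = ∑ l, fderiv ℂ (theta l) x v • (Pi.single l 1 : Fin (2 * g + 1) → ℂ) := by
    simp only [fderiv_theta]
    exact pi_eq_sum_univ' _
  rw [e, map_sum, sum_apply]
  refine Finset.sum_congr rfl fun l _ => ?_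
  rw [map_smul, smul_apply, partials_apply, smul_eq_mul, smul_eq_mul, mul_comm]

/-- The matrix of the reduction of `a P1 + b P0` in the coordinates. -/
def bivec (a b : ℂ) (x : MA g) : Matrix (Fin (2 * g + 1)) (Fin (2 * g + 1)) ℂ :=
  Matrix.of fun l m => pbr (pen a b) (theta l) (theta m) x

theorem transpose_bivec (a b : ℂ) (x : MA g) : (bivec a b x).transpose = -bivec a b x := by
  ext l m
  exact pbr_pen_skew a b _ _ _

theorem bivec_eq (μ : ℂ) (x : MA g) : bivec 1 (-μ) x = bivec 1 0 x - μ • bivec 0 1 x := by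
  ext l m
  simp only [bivec, Matrix.of_apply, Matrix.sub_apply, Matrix.smul_apply, pbr_pen]
  simp [sub_eq_add_neg]

theorem redB_eq (a b : ℂ) (f k : holFun g) {x : MA g} (hx : x ∈ leafS g) :
    (redB a b f k).1 (proj ⟨x, hx⟩) =
      partials (coordMap (2 * g + 1) x) f ⬝ᵥ
        Matrix.mulVec (bivec a b x) (partials (coordMap (2 * g + 1) x) k) := by
  rw [← (prolongs_redB a b (prolongs_inCoords f) (prolongs_inCoords k)).2 ⟨x, hx⟩, pbr,
    ← gradHom_apply, ← penHom_apply]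
  simp only [fderiv_inCoords]
  simp only [map_sum, map_smul, sum_apply, smul_apply,
    dotProduct, Matrix.mulVec, smul_eq_mul, Finset.mul_sum]
  rw [Finset.sum_comm]
  refine Finset.sum_congr rfl fun l _ => ?_
  refine Finset.sum_congr rfl fun m _ => ?_
  simp only [bivec, Matrix.of_apply, pbr, gradHom_apply, penHom_apply]
  ring

/-- The form factors through the differentials: `D` maps onto `ℂ^(2g+1)` because the coordinates are
holomorphic functions, and the dual map is injective, so only the matrix contributes to the rank. -/
theorem rankAt_redB (a b : ℂ) {x : MA g} (hx : x ∈ leafS g) :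
    rankAt (redB a b) (proj ⟨x, hx⟩) = ((bivec a b x).rank : Cardinal) := by
  set D := partials (coordMap (2 * g + 1) x) with hD
  have hDs : Function.Surjective D := partials_surjective _
  set J : (Fin (2 * g + 1) → ℂ) →ₗ[ℂ] Module.Dual ℂ (holFun g) :=
    D.dualMap ∘ₗ (dotProductEquiv ℂ (Fin (2 * g + 1))).toLinearMap with hJ
  have hJi : Function.Injective J :=
    (LinearMap.dualMap_injective_of_surjective hDs).comp (LinearEquiv.injective _)
  have e : (redB a b).compr₂ (evalAt (proj ⟨x, hx⟩))
      = J ∘ₗ ((bivec a b x).transpose.mulVecLin ∘ₗ D) := by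
    refine LinearMap.ext fun f => LinearMap.ext fun k => ?_
    change (redB a b f k).1 (proj ⟨x, hx⟩)
      = Matrix.mulVec (bivec a b x).transpose (D f) ⬝ᵥ D k
    rw [redB_eq, Matrix.mulVec_transpose, ← Matrix.dotProduct_mulVec]
  rw [rankAt, LinearMap.rank, e, LinearMap.range_comp,
    LinearMap.range_comp_of_range_eq_top _ (LinearMap.range_eq_top.2 hDs),
    ← (Submodule.equivMapOfInjective J hJi _).rank_eq, ← Module.finrank_eq_rank,
    ← Matrix.rank_transpose (bivec a b x), Matrix.rank]

/-- For `β` in the kernel, the tangent vector `P0 x (W β)` annihilates all coordinates, so it is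
determined by its `p_g` component `κ β`. If that vanishes as well, `W β` is in the kernel of `P0`,
hence annihilates its range, the tangent space; the differentials of the coordinates being
independent there, `β = 0`. -/
theorem finrank_ker_bivec {x : MA g} (hx : x ∈ leafS g) :
    Module.finrank ℂ (LinearMap.ker (bivec 0 1 x).mulVecLin) ≤ 1 := by
  let W : (Fin (2 * g + 1) → ℂ) →ₗ[ℂ] MA g :=
    ∑ m, (LinearMap.proj m : (Fin (2 * g + 1) → ℂ) →ₗ[ℂ] ℂ).smulRight (grad (fderiv ℂ (theta m) x))
  have hW : ∀ β, W β = ∑ m, β m • grad (fderiv ℂ (theta m) x) := fun β => by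
    simp [W, LinearMap.sum_apply]
  let κ : (Fin (2 * g + 1) → ℂ) →ₗ[ℂ] ℂ :=
    (LinearMap.proj 0 ∘ₗ LinearMap.proj (Fin.last g)) ∘ₗ penHom 0 1 x ∘ₗ W
  have hθ : ∀ β l, fderiv ℂ (theta l) x (P0 x (W β)) = Matrix.mulVec (bivec 0 1 x) β l := by
    intro β l
    rw [P0_eq_pen, ← penHom_apply, hW]
    simp only [map_sum, map_smul, Matrix.mulVec, dotProduct, bivec, Matrix.of_apply, pbr,
      penHom_apply, smul_eq_mul]
    exact Finset.sum_congr rfl fun m _ => mul_comm _ _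
  have hinv : ∀ v, fderiv ℂ paramInv x v
      = (fun l => fderiv ℂ (theta l) x v, v (Fin.last g) 0) := by
    intro v
    have hl : HasFDerivAt (fun x : MA g => x (Fin.last g) 0)
        ((ContinuousLinearMap.proj (R := ℂ) (φ := fun _ : Fin 3 => ℂ) 0).comp
          (ContinuousLinearMap.proj (R := ℂ) (φ := fun _ : Fin (g + 1) => Fin 3 → ℂ)
            (Fin.last g))) x :=
      ((ContinuousLinearMap.proj (R := ℂ) (φ := fun _ : Fin 3 => ℂ) 0).comp
        (ContinuousLinearMap.proj (R := ℂ) (φ := fun _ : Fin (g + 1) => Fin 3 → ℂ)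
          (Fin.last g))).hasFDerivAt
    have h := (differentiable_coordMap (2 * g + 1) x).hasFDerivAt.prodMk hl
    have h' : fderiv ℂ paramInv x = _ := h.fderiv
    rw [h']
    exact Prod.ext (funext fun l => (fderiv_theta l x v).symm) rfl
  have hinj : Function.Injective (κ ∘ₗ (LinearMap.ker (bivec 0 1 x).mulVecLin).subtype) := by
    rw [← LinearMap.ker_eq_bot, LinearMap.ker_eq_bot']
    rintro ⟨β, hβ⟩ hκ
    rw [LinearMap.mem_ker, Matrix.mulVecLin_apply] at hβ
    have hv : P0 x (W β) = 0 := by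
      have h := fderiv_param_fderiv_paramInv hx (P0_mem_tangentS x (W β))
      have hz : fderiv ℂ paramInv x (P0 x (W β)) = 0 := by
        rw [hinv]
        refine Prod.ext (funext fun l => ?_) ?_
        · exact (hθ β l).trans (congrFun hβ l)
        · simpa [κ, penHom_apply, ← P0_eq_pen] using hκ
      rw [← h, hz, map_zero]
    have ho : ∀ u ∈ tangentS x, pairing u (W β) = 0 := by
      intro u hu
      rw [← mem_ker_tanMap, ← range_P0] at hu
      obtain ⟨y, rfl⟩ := hu
      rw [penHom_apply, pairing_comm, pairing_pen_skew, ← P0_eq_pen, hv, ← pairingHom_apply,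
        map_zero, neg_zero]
    refine Subtype.ext (funext fun m => ?_)
    -- This tangent vector is dual to the coordinate `m`, so pairing it with `W β` extracts `β m`.
    set u := fderiv ℂ param (paramInv x) (Pi.single m 1, 0) with hu
    have hut : u ∈ tangentS x := fderiv_param_mem hx _
    have h1 : ∀ l, fderiv ℂ (theta l) x u = (Pi.single m 1 : Fin (2 * g + 1) → ℂ) l := by
      intro l
      have h2 := fderiv_paramInv_fderiv_param hx ((Pi.single m 1 : Fin (2 * g + 1) → ℂ), (0 : ℂ))
      rw [← hu, hinv] at h2
      exact congrFun (congrArg Prod.fst h2) l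
    have h3 := ho u hut
    rw [hW, ← pairingHom_apply, map_sum] at h3
    simp only [map_smul, pairingHom_apply, pairing_grad, h1, smul_eq_mul] at h3
    simpa [Pi.single_apply] using h3
  have := LinearMap.finrank_le_finrank_of_injective hinj
  rwa [Module.finrank_self] at this

theorem rank_bivec_zero_one {x : MA g} (hx : x ∈ leafS g) : 2 * g ≤ (bivec 0 1 x).rank := by
  have h1 := LinearMap.finrank_range_add_finrank_ker (bivec 0 1 x).mulVecLin
  have h2 := finrank_ker_bivec hx
  rw [Module.finrank_fin_fun] at h1
  rw [Matrix.rank]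
  omega

theorem finite_rankAt_ne (n : Ntilde g) :
    {μ : ℂ | rankAt (pencil (redB 0 1) (redB 1 0) μ) n ≠ ((2 * g : ℕ) : Cardinal)}.Finite := by
  obtain ⟨⟨x, hx⟩, rfl⟩ := proj_surjective n
  refine (finite_setOf_finrank_range_lt (bivec 0 1 x).mulVecLin (bivec 1 0 x).mulVecLin).subset
    fun μ hμ => ?_
  rw [Set.mem_ofPred_eq, pencil_redB, rankAt_redB, Ne, Nat.cast_inj] at hμ
  have h1 := rank_le_of_skew _ (transpose_bivec 1 (-μ) x)
  have h2 := rank_bivec_zero_one hx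
  have h3 : (bivec 1 0 x).mulVecLin - μ • (bivec 0 1 x).mulVecLin = (bivec 1 (-μ) x).mulVecLin := by
    rw [bivec_eq]
    refine LinearMap.ext fun v => ?_
    simp
  rw [Set.mem_ofPred_eq, h3]
  change (bivec 1 (-μ) x).rank < (bivec 0 1 x).rank
  omega

/-! ### Derivatives of power series of entire functions -/

/-- The derivative of entire functions at a point along a vector. -/
def der (x v : MA g) : entAlg g →ₗ[ℂ] ℂ where
  toFun f := fderiv ℂ f.1 x v
  map_add' f k := by
    have h : (f + k).1 = fun y => f.1 y + k.1 y := rfl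
    rw [h, fderiv_fun_add (f.2 x) (k.2 x)]
    rfl
  map_smul' s f := by
    have h : (s • f).1 = fun y => s * f.1 y := rfl
    rw [h, fderiv_const_mul (f.2 x)]
    rfl

theorem der_apply (x v : MA g) (f : entAlg g) : der x v f = fderiv ℂ f.1 x v := rfl

theorem der_mul (x v : MA g) (f k : entAlg g) :
    der x v (f * k) = der x v f * evalEnt x k + evalEnt x f * der x v k := by
  have h : (f * k).1 = fun y => f.1 y * k.1 y := rfl
  rw [der_apply, h, fderiv_fun_mul (f.2 x) (k.2 x)]
  change f.1 x * fderiv ℂ k.1 x v + k.1 x * fderiv ℂ f.1 x v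
    = fderiv ℂ f.1 x v * k.1 x + f.1 x * fderiv ℂ k.1 x v
  ring

/-- The derivative of power series of entire functions at a point along a vector. -/
def derSer (x v : MA g) : PowerSeries (entAlg g) →+ PowerSeries ℂ where
  toFun K := PowerSeries.mk fun n => der x v (PowerSeries.coeff n K)
  map_zero' := by ext n; simp
  map_add' K L := by ext n; simp

theorem coeff_derSer (x v : MA g) (K : PowerSeries (entAlg g)) (n : ℕ) :
    PowerSeries.coeff n (derSer x v K) = der x v (PowerSeries.coeff n K) :=
  PowerSeries.coeff_mk n fun n => der x v (PowerSeries.coeff n K)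

theorem derSer_mul (x v : MA g) (K L : PowerSeries (entAlg g)) :
    derSer x v (K * L) = derSer x v K * PowerSeries.map (evalEnt x) L
      + PowerSeries.map (evalEnt x) K * derSer x v L := by
  ext n
  simp only [coeff_derSer, map_add, PowerSeries.coeff_mul, map_sum, der_mul, PowerSeries.coeff_map,
    Finset.sum_add_distrib]

theorem derSer_X (x v : MA g) : derSer x v PowerSeries.X = 0 := by
  ext n
  rw [coeff_derSer, PowerSeries.coeff_X, der_apply]
  split_ifs
  · have h : (1 : entAlg g).1 = fun _ => (1 : ℂ) := rfl
    rw [h, fderiv_const_apply]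
    rfl
  · have h : (0 : entAlg g).1 = fun _ => (0 : ℂ) := rfl
    rw [h, fderiv_const_apply]
    rfl

theorem derSer_one (x v : MA g) : derSer x v 1 = 0 := by
  have h := derSer_mul x v 1 1
  rw [mul_one, map_one (PowerSeries.map (evalEnt x)), one_mul, mul_one] at h
  exact left_eq_add.1 h

theorem derSer_C_mul_X_pow (x v : MA g) (f : entAlg g) (n : ℕ) :
    derSer x v (PowerSeries.C f * PowerSeries.X ^ n)
      = PowerSeries.C (der x v f) * PowerSeries.X ^ n := by
  ext m
  rw [coeff_derSer, PowerSeries.coeff_C_mul_X_pow, PowerSeries.coeff_C_mul_X_pow]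
  split_ifs
  · rfl
  · exact map_zero _

theorem derSer_ser (x v : MA g) (s : ℕ → Fin 3 → entAlg g) :
    derSer x v (serR g s) = serR g (fun i e => der x v (s i e)) ∧
    derSer x v (serP g s) = serP g (fun i e => der x v (s i e)) ∧
    derSer x v (serQ g s) = serQ g (fun i e => der x v (s i e)) := by
  refine ⟨?_, ?_, ?_⟩ <;> simp only [serR, serP, serQ, map_sum, map_sub, derSer_C_mul_X_pow]

/-- When `p_g` and its variation both vanish, the normalizing gauge parameter is zero to first
order, so `red` differentiates to the identity. -/
theorem der_redCoef {x v : MA g} (hx : coef x g 0 = 0) (hv : coef0 v g 0 = 0) (i : ℕ) (e : Fin 3) :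
    der x v (redCoef i e) = coef0 v i e := by
  have hd : ∀ k e, HasFDerivAt (fun x : MA g => coef x k e) (fderiv ℂ (fun x : MA g => coef x k e) x) x :=
    fun k e => (differentiable_coef k e x).hasFDerivAt
  have hc := fun k e => (hasFDerivAt_coef x k e).2 v
  have key : ∀ {f : MA g → ℂ} {f' : MA g →L[ℂ] ℂ}, HasFDerivAt f f' x →
      (redCoef i e : entAlg g).1 = f → f' v = coef0 v i e → der x v (redCoef i e) = coef0 v i e := by
    intro f f' h1 h2 h3
    rw [der_apply, h2, h1.fderiv, h3]
  have hr : (redCoef i e : entAlg g).1 = fun x => gau (coef x g 0) (coef x i) e :=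
    funext fun x => congrFun (coef_red x i) e
  fin_cases e
  · refine key ((hd i 0).sub ((hd g 0).mul (hd i 1))) hr ?_
    simp [hc, hx, hv]
  · exact key (hd i 1) hr (hc i 1)
  · refine key (((hd i 2).add (((hd g 0).const_mul 2).mul (hd i 0))).sub
      (((hd g 0).pow 2).mul (hd i 1))) hr ?_
    simp [hc, hx, hv]

theorem derSer_serK {x v : MA g} (hx : x (Fin.last g) 0 = 0) (hv : v (Fin.last g) 0 = 0) :
    2 * derSer x v (serK g) =
      (PowerSeries.X * serQ g (coef0 v) - 2 * serP g (coef0 v)) + PowerSeries.X *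
        (-(PowerSeries.X * serR g (coef0 v)) * serKAt x ^ 2
          - (1 + PowerSeries.X * serR g (coef x)) * (2 * serKAt x * derSer x v (serK g))
          + (-2 * serP g (coef0 v) - 2 * serR g (coef0 v)) * serKAt x
          + (-2 * serP g (coef x) - 2 * serR g (coef x)) * derSer x v (serK g)) := by
  have hx' : coef x g 0 = 0 := by rw [← hx, ← coef_fin x (Fin.last g), Fin.val_last]
  have hv' : coef0 v g 0 = 0 := by rw [← hv, ← coef0_fin v (Fin.last g), Fin.val_last]
  have h := congrArg (derSer x v) (serK_spec g)
  obtain ⟨h1, h2, h3⟩ := derSer_ser x v redCoef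
  obtain ⟨m1, m2, m3⟩ := map_ser (g := g) (evalEnt x) redCoef
  have hm : (fun i e => evalEnt x (redCoef i e)) = coef x := by
    funext i e
    rw [evalEnt_apply]
    exact congrFun (congrArg (fun y => coef y i) (red_of_last hx)) e
  have hdv : (fun i e => der x v (redCoef i e)) = coef0 v :=
    funext fun i => funext fun e => der_redCoef hx' hv' i e
  rw [hdv] at h1 h2 h3
  rw [hm] at m1 m2 m3
  have hK : PowerSeries.map (evalEnt x) (serK g) = serKAt x := rfl
  have h2' : (2 : PowerSeries (entAlg g)) = 1 + 1 := by norm_num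
  rw [h2'] at h
  simp only [map_add, map_sub, map_neg, derSer_mul, pow_two, derSer_X, derSer_one, h1, h2, h3, m1, m2,
    m3, hK, map_mul, map_one, PowerSeries.map_X, add_mul, neg_mul, one_mul] at h
  linear_combination h

/-- The polynomial with coefficients a given entry of a tangent vector. -/
def ent0 (v : MA g) (e : Fin 3) : ℂ[X] := ∑ k ∈ Finset.range (g + 1), monomial k (coef0 v k e)

theorem coeff_ent0 (v : MA g) (e : Fin 3) (k : ℕ) : (ent0 v e).coeff k = coef0 v k e := by
  simp only [ent0, finsetSum_coeff, coeff_monomial]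
  rw [Finset.sum_ite_eq']
  split_ifs with h
  · rfl
  · rw [Finset.mem_range] at h
    simp [coef0, h]

theorem atZ2_ent0 {v : MA g} (h0 : v (Fin.last g) 0 = 0) (h1 : v (Fin.last g) 1 = 0) :
    atZ2 (ent0 v 0) = z ^ (2 * g) * hat (serP g (coef0 v)) ∧
    atZ2 (ent0 v 1) = z ^ (2 * g) * hat (PowerSeries.X * serR g (coef0 v)) ∧
    atZ2 (ent0 v 2) = z ^ (2 * g) * hat (serQ g (coef0 v)) + z ^ 2 * atZ2 (ent0 v 1) := by
  have hg : ∀ e, coef0 v g e = v (Fin.last g) e := fun e => congrFun (coef0_fin v (Fin.last g)) e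
  have ha : ∀ e, atZ2 (ent0 v e) = ∑ i ∈ Finset.range (g + 1), con (coef0 v i e) * z ^ (2 * i) :=
    fun e => by
      rw [ent0, map_sum]
      exact Finset.sum_congr rfl fun i _ => atZ2_monomial _ _
  have e1 : atZ2 (ent0 v 1) = z ^ (2 * g) * hat (PowerSeries.X * serR g (coef0 v)) := by
    rw [hat_serR, ha, Finset.sum_range_succ, hg, h1, map_zero, zero_mul, add_zero]
  refine ⟨?_, e1, ?_⟩
  · rw [hat_serP, ha, Finset.sum_range_succ, hg, h0, map_zero, zero_mul, add_zero]
  · rw [e1, hat_serQ, hat_serR, ha]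
    ring

/-- The derivative of the series `h` on the slice `p_g = 0`. -/
theorem hat_derSer_serK {x v : MA g} (hx : x (Fin.last g) 0 = 0) (hx1 : x (Fin.last g) 1 = 1)
    (hv : v (Fin.last g) 0 = 0) (hv1 : v (Fin.last g) 1 = 0) :
    2 * (atZ2 (ent x 0) + atZ2 (ent x 1) * hSer x) * hat (derSer x v (serK g))
      = atZ2 (ent0 v 2) - 2 * atZ2 (ent0 v 0) * hSer x - atZ2 (ent0 v 1) * hSer x ^ 2 := by
  obtain ⟨h0, h1, -⟩ := atZ2_ent_slice hx1 hx
  obtain ⟨d0, d1, d2⟩ := atZ2_ent0 hv hv1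
  have h := congrArg hat (derSer_serK hx hv)
  have hz := hat_X_mul_z
  simp only [map_add, map_mul, map_sub, map_pow, map_neg, map_one, map_ofNat] at h h0 h1 d0 d1 d2
  rw [d2, d1, d0, h1, h0, hSer]
  generalize hat (serKAt x) = k at *
  generalize hat (derSer x v (serK g)) = η at *
  generalize hat (serP g (coef x)) = p at *
  generalize hat (serR g (coef x)) = r at *
  generalize hat (serP g (coef0 v)) = p' at *
  generalize hat (serQ g (coef0 v)) = q' at *
  generalize hat (serR g (coef0 v)) = r' at *
  generalize hat PowerSeries.X = ζ at *
  linear_combination z ^ (2 * g) * z * h + z ^ (2 * g) * (2 * r * η + 2 * r' * k + q'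
    + (-(ζ * r') * k ^ 2 - (1 + ζ * r) * (2 * k * η) + (-2 * p' - 2 * r') * k
      + (-2 * p - 2 * r) * η)) * hz

/-! ### Shifted Lax matrices -/

theorem coeff_iterate_divX (P : ℂ[X]) (m n : ℕ) : (divX^[m] P).coeff n = P.coeff (n + m) := by
  induction m generalizing n with
  | zero => rfl
  | succ m ih => rw [Function.iterate_succ_apply', coeff_divX, ih]; congr 1; ring

theorem coeff_qPoly_add_two (h : Lau) (k n : ℕ) :
    (qPoly h (k + 2)).coeff (n + 1) = (qPoly h k).coeff n := by
  rw [qPoly, coeff_sub, coeff_X_mul, coeff_C_succ, sub_zero]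

theorem coeff_pPoly_add_two (h : Lau) (k n : ℕ) :
    (pPoly h (k + 2)).coeff (n + 1) = (pPoly h k).coeff n := by
  rw [pPoly, coeff_sub, coeff_X_mul, coeff_C_succ, sub_zero]

/-- The two extra summands contain `p_1 = 0` and `p_0 = 1` and contribute only in degree zero; the
additive constant is all that does not shift. -/
theorem coeff_lax_10_add_two (h : Lau) (k n : ℕ) :
    (lax h (k + 2) 1 0).coeff (n + 1) = (lax h k 1 0 - C ((cur h k).coeff 1)).coeff n := by
  rw [lax_10, lax_10, add_sub_cancel_right, coeff_add, coeff_C_succ, add_zero, coeff_add, coeff_add,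
    coeff_pPoly_add_two, finsetSum_coeff, finsetSum_coeff, Finset.sum_Icc_succ_top (by omega),
    Finset.sum_Icc_succ_top (by omega)]
  congr 1
  rw [show k + 2 - (k + 1) = 1 by omega, show k + 2 - (k + 1 + 1) = 0 by omega, coeff_C_mul,
    coeff_C_mul]
  simp only [pPoly, coeff_zero, coeff_one, mul_zero, add_zero, Nat.succ_ne_zero, if_false]
  refine Finset.sum_congr rfl fun l hl => ?_
  rw [Finset.mem_Icc] at hl
  rw [coeff_C_mul, coeff_C_mul, show k + 2 - l = k - l + 2 by omega, coeff_pPoly_add_two]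

/-- Thus `(λ^(i-g) X)_+` at a Lax matrix is the Lax matrix of index `2i + 1` up to a constant
multiple of `A`, which generates a gauge motion. -/
theorem lax_shift (h : Lau) (i m : ℕ) :
    divX^[m + 1] (lax h (2 * (i + m + 1) + 1) 0 0) = lax h (2 * i + 1) 0 0 ∧
    divX^[m + 1] (lax h (2 * (i + m + 1) + 1) 0 1) = lax h (2 * i + 1) 0 1 ∧
    divX^[m + 1] (lax h (2 * (i + m + 1) + 1) 1 0)
      = lax h (2 * i + 1) 1 0 - C ((cur h (2 * i + 1)).coeff 1) := by
  have e : ∀ m, 2 * (i + m + 1) + 1 = 2 * (i + m) + 1 + 2 := fun m => by ring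
  simp only [lax_00, lax_01]
  refine ⟨?_, ?_, ?_⟩ <;> ext n <;> rw [coeff_iterate_divX]
  · induction m with
    | zero => exact coeff_pPoly_add_two h (2 * i + 1) n
    | succ m ih => rw [← ih, e, ← add_assoc n, coeff_pPoly_add_two, ← add_assoc i]
  · induction m with
    | zero => exact coeff_qPoly_add_two h (2 * i + 1) n
    | succ m ih => rw [← ih, e, ← add_assoc n, coeff_qPoly_add_two, ← add_assoc i]
  · induction m with
    | zero => exact coeff_lax_10_add_two h (2 * i + 1) n
    | succ m ih =>
      rw [← ih, e, ← add_assoc n, coeff_lax_10_add_two, coeff_sub, ← add_assoc n m 1, coeff_C_succ,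
        sub_zero, ← add_assoc i]

/-- The entries of the commutator `[(λ ^ (-m) X)_+, X]`. -/
theorem coeff_commutator (x : MA g) (m n : ℕ) :
    (divX^[m] (ent x 1) * ent x 2 - ent x 1 * divX^[m] (ent x 2)).coeff n = lieSum x (n + m) (n + 1) 0 ∧
    (2 * (divX^[m] (ent x 0) * ent x 1 - divX^[m] (ent x 1) * ent x 0)).coeff n
      = lieSum x (n + m) (n + 1) 1 ∧
    (2 * (divX^[m] (ent x 2) * ent x 0 - divX^[m] (ent x 0) * ent x 2)).coeff n
      = lieSum x (n + m) (n + 1) 2 := by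
  have key : ∀ e e', (divX^[m] (ent x e) * ent x e').coeff n
      = ∑ l ∈ Finset.range (n + 1), coef x (n + m - l) e * coef x l e' := by
    intro e e'
    rw [mul_comm, coeff_mul, Finset.Nat.sum_antidiagonal_eq_sum_range_succ_mk]
    refine Finset.sum_congr rfl fun l hl => ?_
    rw [Finset.mem_range] at hl
    rw [coeff_iterate_divX, coeff_ent, coeff_ent, mul_comm,
      show n - l + m = n + m - l by omega]
  have h2 : (2 : ℂ[X]) = C 2 := rfl
  rw [mul_comm (ent x 1), h2, coeff_C_mul, coeff_C_mul]
  simp only [coeff_sub, key, lieSum, Finset.sum_apply, lie_eq]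
  refine ⟨?_, ?_, ?_⟩
  · rw [← Finset.sum_sub_distrib]
    refine Finset.sum_congr rfl fun l _ => ?_
    simp only [Matrix.cons_val]
    ring
  · rw [← Finset.sum_sub_distrib, Finset.mul_sum]
    rfl
  · rw [← Finset.sum_sub_distrib, Finset.mul_sum]
    rfl

/-- The commutator with the polynomial part of `λ^(-m) X` is minus the commutator with its negative
part, and so has degree at most `g`: the Lax field loses nothing by truncation. -/
theorem lieSum_eq_zero (x : MA g) (m n : ℕ) (hn : g < n) : lieSum x (n + m) (n + 1) = 0 := by
  rw [lieSum_eq_lieSum x (t := m) (by omega), lieSum]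
  refine Finset.sum_eq_zero fun l hl => ?_
  rw [Finset.mem_range] at hl
  rw [coef_of_lt x (by omega), zero_lie]

theorem coef0_laxField (i : ℕ) (x : MA g) (n : ℕ) :
    coef0 (laxField i x) n = lieSum x (n + (g - i)) (n + 1) := by
  rw [coef0]
  split_ifs with h
  · rw [laxField_eq_sum]
  · rw [lieSum_eq_zero _ _ _ (by omega)]

theorem coef0_gen (x : MA g) (n : ℕ) : coef0 (gen x) n = lie aVec (coef x n) := by
  rw [coef0, coef]
  split_ifs
  · rfl
  · rw [lie_self]
  · rw [lie_zero]

/-- The commutator of `X` with `(λ ^ (i-g) X)_+ + s A`. -/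
theorem ent0_laxField_add (i : ℕ) (s : ℂ) (x : MA g) :
    ent0 (laxField i x + s • gen x) 0 = divX^[g - i] (ent x 1) * ent x 2
      - ent x 1 * (divX^[g - i] (ent x 2) + C s) ∧
    ent0 (laxField i x + s • gen x) 1
      = 2 * (divX^[g - i] (ent x 0) * ent x 1 - divX^[g - i] (ent x 1) * ent x 0) ∧
    ent0 (laxField i x + s • gen x) 2
      = 2 * ((divX^[g - i] (ent x 2) + C s) * ent x 0 - divX^[g - i] (ent x 0) * ent x 2) := by
  have h := coeff_commutator x (g - i)
  refine ⟨?_, ?_, ?_⟩ <;> ext n <;>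
    rw [coeff_ent0, coef0_add, coef0_smul, coef0_laxField, coef0_gen, lie_aVec, Pi.add_apply,
      Pi.smul_apply]
  · rw [← (h n).1, mul_add, ← sub_sub, coeff_sub _ (ent x 1 * C s), coeff_mul_C, coeff_ent]
    simp
    ring
  · rw [← (h n).2.1]
    simp
  · rw [← (h n).2.2, show ∀ a b c d : ℂ[X], 2 * ((a + b) * c - d) = 2 * (a * c - d) + b * (2 * c) from
      fun a b c d => by ring, coeff_add, coeff_C_mul, show (2 : ℂ[X]) = C 2 from rfl, coeff_C_mul,
      coeff_C_mul, coeff_ent]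
    rfl

/-! ### The flows -/

theorem ent_one_of_tangent {x v : MA g} (hx : x ∈ leafS g) (hv : v ∈ tangentS x) :
    v (Fin.last g) 1 = 0 := by
  have h := fderiv_eq_of_eqOn (differentiable_coef g 1) (differentiable_const (1 : ℂ))
    (fun y hy => by rw [← leafS_ent_one hy, ← coef_fin y (Fin.last g), Fin.val_last]) hx hv
  rw [(hasFDerivAt_coef x g 1).2, fderiv_const_apply] at h
  rw [← coef0_fin v (Fin.last g), Fin.val_last, h]
  rfl

theorem coeff_zero_derSer_serK (x v : MA g) : (hat (derSer x v (serK g))).coeff 0 = 0 := by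
  rw [show (0 : ℤ) = ((0 : ℕ) : ℤ) from rfl, coeff_hat, coeff_derSer, der_apply]
  have h : (PowerSeries.coeff 0 (serK g)).1 = fun _ => (0 : ℂ) := funext fun y => by
    have h1 := hSer_mem y 0 le_rfl
    rw [hSer, add_sub_cancel_left, show (0 : ℤ) = ((0 : ℕ) : ℤ) from rfl, coeff_hat, serKAt,
      PowerSeries.coeff_map] at h1
    exact h1
  rw [h, fderiv_const_apply]
  rfl

/-- On the slice the derivative `η` of `h` satisfies `2 w η = q' - 2 p' h - r' h²`, where the primes
are the entries of a commutator `[M, X]`. The quadratic equation reduces the right-hand side to `2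
w` times the Riccati expression `M₁₀ - 2 M₀₀ h - M₀₁ h²`, and `M` is the Lax matrix of index `2i +
1` plus a multiple of `A`. -/
theorem hat_derSer_flow {i : ℕ} (hi : i < g) {h : Lau} (hh : h ∈ kdvSpace g) :
    ∃ s : ℂ, hat (derSer (laxPt g h) (laxField i (laxPt g h) + s • gen (laxPt g h)) (serK g))
      = cs2Field h (2 * i + 1) := by
  set x := laxPt g h with hxd
  have hx : x ∈ leafS g := laxPt_mem hh.1
  have hx0 : x (Fin.last g) 0 = 0 := laxPt_last h
  have hx1 := leafS_ent_one hx
  -- Since `r_g = 1`, the generator has `p_g` component `-1`, so this multiple keeps the corrected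
  -- field on the slice.
  refine ⟨laxField i x (Fin.last g) 0, ?_⟩
  set s := laxField i x (Fin.last g) 0 with hs
  set v := laxField i x + s • gen x with hv
  have hv0 : v (Fin.last g) 0 = 0 := by
    simp [hv, gen, lie_aVec, hx1, ← hs]
  have hvt : v ∈ tangentS x := by
    intro k hk hk'
    rw [hv, map_add, map_smul, fderiv_ham_gen, smul_zero, add_zero, laxField_eq hi]
    exact P0_mem_tangentS _ _ k hk hk'
  have hη := hat_derSer_serK hx0 hx1 hv0 (ent_one_of_tangent hx hvt)
  rw [hSer_eq hh, ← cur_eq_ent] at hη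
  set η := hat (derSer x v (serK g)) with hηd
  obtain ⟨d0, d1, d2⟩ := ent0_laxField_add i s x
  obtain ⟨e0, e1, e2⟩ := ent_laxPt (g := g) h
  obtain ⟨m, rfl⟩ : ∃ m, g = i + m + 1 := ⟨g - i - 1, by omega⟩
  obtain ⟨s0, s1, s2⟩ := lax_shift h i m
  rw [show i + m + 1 - i = m + 1 by omega] at d0 d1 d2
  rw [e1, e2, s1, s2, ← e1, ← e2] at d0
  rw [e0, e1, s0, s1, ← e0, ← e1] at d1
  rw [e0, e2, s0, s2, ← e0, ← e2] at d2
  set c := con (s - (cur h (2 * i + 1)).coeff 1) with hc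
  obtain ⟨l1, l2⟩ := lax_spec h (2 * i + 1)
  rw [lax_trace hh.1, map_neg] at l2
  have hq := lax_equation (g := i + m + 1) hh.1
  rw [hh.2, sub_zero] at hq
  have hw := cur_eq_ent (g := i + m + 1) h
  have hw0 : cur h (2 * (i + m + 1) + 1) ≠ 0 := by
    intro h0
    have := (dec_cur_neg hh.1 (k := 2 * (i + m + 1) + 1) (by omega)).2
    rw [h0, HahnSeries.coeff_zero] at this
    exact zero_ne_one this
  have h2 : (2 : Lau) ≠ 0 := by
    rw [← map_ofNat con 2]
    exact (map_ne_zero con).2 two_ne_zero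
  have key : η = cs2Field h (2 * i + 1) + c := by
    refine mul_left_cancel₀ (mul_ne_zero h2 hw0) ?_
    rw [hη, d0, d1, d2, hw]
    have hC : ∀ a, atZ2 (C a) = con a := fun a => by simp
    simp only [map_add, map_sub, map_mul, map_ofNat, hC, hc]
    linear_combination (2 * atZ2 (lax h (2 * i + 1) 0 0) + 2 * atZ2 (lax h (2 * i + 1) 0 1) * h) * hq
      - 2 * (atZ2 (ent (laxPt (i + m + 1) h) 0) + atZ2 (ent (laxPt (i + m + 1) h) 1) * h)
        * (l2 - h * l1)
  -- Neither `η` nor the KdV field has a term in `z^0`, so the constant `c` left by the multiple of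
  -- `A` is zero.
  have hc0 := coeff_zero_derSer_serK x v
  rw [← hηd, key, HahnSeries.coeff_add, dec_cs2Field hh.1 (by omega) 0 (by norm_num), hc, coeff_con,
    if_pos rfl, zero_add] at hc0
  rw [key, hc, hc0, map_zero, add_zero]

/-- The corrected field of `hat_derSer_flow` may replace the Lax field, because prolongations have
zero derivative along the generator; the chain rule for `G ∘ coordMap N` does the rest. -/
theorem kdvCorresponds_flow {i : ℕ} (hi : i < g) :
    KdVCorresponds (phi g) (2 * i + 1) (flow i) := by
  intro f N G hG hf h
  obtain ⟨s, hs⟩ := hat_derSer_flow hi h.2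
  set x := laxPt g (h : Lau) with hx
  have hxm : x ∈ leafS g := laxPt_mem h.2.1
  have hF : Prolongs (fun y => G (coordMap N y)) (f : Ntilde g → ℂ) :=
    ⟨hG.comp (differentiable_coordMap N), fun y => by
      rw [← phi_hSer, hf]
      rfl⟩
  have h1 := (projectsTo_flow hi ⟨x, hxm⟩).2 f _ hF
  have h2 : fderiv ℂ (fun y => G (coordMap N y)) x (laxField i x + s • gen x)
      = fderiv ℂ (fun y => G (coordMap N y)) x (laxField i x) := by
    rw [map_add, map_smul, hF.fderiv_gen hxm, smul_zero, add_zero]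
  change _ = (flow i f).1 (proj ⟨x, hxm⟩)
  rw [← h1, ← h2]
  have h3 := ((hG (coordMap N x)).hasFDerivAt).comp x (differentiable_coordMap N x).hasFDerivAt
  have h4 : fderiv ℂ (fun y => G (coordMap N y)) x = _ := h3.fderiv
  have h5 : coordMap N x = coords N (h : Lau) := congrArg (coords N) (hSer_eq h.2)
  rw [h4, ContinuousLinearMap.comp_apply, h5]
  congr 1
  funext l
  have h6 := hasFDerivAt_pi'.1 (differentiable_coordMap N x).hasFDerivAt l
  have h7 : (fun y : MA g => coordMap N y l) = (PowerSeries.coeff (l + 1) (serK g)).1 :=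
    funext fun y => coordMap_apply N y l
  rw [h7] at h6
  rw [coords, ← hs, show (l : ℤ) + 1 = ((l + 1 : ℕ) : ℤ) by push_cast; rfl, coeff_hat, coeff_derSer,
    der_apply, h6.fderiv]
  rfl

end
end StationaryKdV
-- The theorem
theorem mainTheorem7 (g : ℕ) :
    ∃ (Φ : StationaryKdV.kdvSpace g → StationaryKdV.Ntilde g)
      (Y : ℕ → Derivation ℂ (StationaryKdV.holFun g) (StationaryKdV.holFun g))
      (H : ℕ → StationaryKdV.holFun g)
      (B0 B1 : StationaryKdV.holFun g →ₗ[ℂ] StationaryKdV.holFun g →ₗ[ℂ] StationaryKdV.holFun g),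
      -- `Φ` is the biholomorphic identification of the two phase spaces through the Lax matrix
      (∀ h : StationaryKdV.kdvSpace g, ∃ x : StationaryKdV.leafS g,
        StationaryKdV.toPoly (x : StationaryKdV.MA g)
          = matPolyEquiv (StationaryKdV.lax h (2 * g + 1)) ∧
        Φ h = StationaryKdV.proj x) ∧
      Function.Bijective Φ ∧
      Function.Bijective
        (fun h : StationaryKdV.kdvSpace g => StationaryKdV.coords (2 * g + 1) h) ∧
      (∀ f : StationaryKdV.Ntilde g → ℂ, f ∈ StationaryKdV.holFun g ↔
        ∃ G : (Fin (2 * g + 1) → ℂ) → ℂ, Differentiable ℂ G ∧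
          ∀ h : StationaryKdV.kdvSpace g, f (Φ h) = G (StationaryKdV.coords (2 * g + 1) h)) ∧
      -- the projected Lax vector fields coincide with the KdV flows
      (∀ i < g, StationaryKdV.ProjectsTo (StationaryKdV.laxField i) (Y i)) ∧
      (∀ i < g, StationaryKdV.KdVCorresponds Φ (2 * i + 1) (Y i)) ∧
      -- the reduced Poisson pencil
      StationaryKdV.IsReduction StationaryKdV.P0 B0 ∧
      StationaryKdV.IsReduction StationaryKdV.P1 B1 ∧
      (∀ a b : ℂ, StationaryKdV.IsPoisson (a • B1 + b • B0)) ∧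
      (∀ n : StationaryKdV.Ntilde g,
        {μ : ℂ | StationaryKdV.rankAt (StationaryKdV.pencil B0 B1 μ) n ≠ ((2 * g : ℕ) : Cardinal)}.Finite) ∧
      -- the projected functions `H_0, …, H_g`, the polynomial Casimir and its vector fields
      (∀ i ≤ g, ∀ x : StationaryKdV.leafS g,
        (H i).1 (StationaryKdV.proj x) = StationaryKdV.ham i (x : StationaryKdV.MA g)) ∧
      (∀ (μ : ℂ) (f : StationaryKdV.holFun g),
        StationaryKdV.pencil B0 B1 μ f (∑ i ∈ Finset.range (g + 1), μ ^ i • H i) = 0) ∧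
      (∀ i < g, ∀ f : StationaryKdV.holFun g,
        Y i f = B0 f (H (g - 1 - i)) ∧ Y i f = B1 f (H (g - i))) := by
  refine ⟨StationaryKdV.phi g, StationaryKdV.flow, StationaryKdV.hamQ,
    StationaryKdV.redB 0 1, StationaryKdV.redB 1 0,
    fun h => ⟨⟨_, StationaryKdV.laxPt_mem h.2.1⟩, StationaryKdV.toPoly_laxPt h.2.1, rfl⟩,
    ⟨StationaryKdV.phi_injective, StationaryKdV.phi_surjective⟩,
    ⟨StationaryKdV.coords_injective, StationaryKdV.coords_surjective⟩,
    StationaryKdV.mem_holFun_iff, fun i hi => StationaryKdV.projectsTo_flow hi,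
    fun i hi => StationaryKdV.kdvCorresponds_flow hi, StationaryKdV.isReduction_redB_zero,
    StationaryKdV.isReduction_redB_one, fun a b => ?_, StationaryKdV.finite_rankAt_ne,
    fun i _ x => ((StationaryKdV.prolongs_hamQ i).2 x).symm, StationaryKdV.pencil_casimir,
    fun i hi f => ⟨rfl, ?_⟩⟩
  · rw [StationaryKdV.smul_redB_add]
    exact StationaryKdV.isPoisson_redB a b
  · rw [StationaryKdV.flow_apply, ← StationaryKdV.redB_hamQ_succ,
      show g - 1 - i + 1 = g - i by omega]
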